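/- **Algebras and languages.** A *modal bi-Heyting algebra* is a bi-Heyting algebra $\mathbf A$ (with implication $\to$ and subtraction $-$, $u-v\le w\iff u\le v\vee w$) with unary operations $\Box,\Diamond$ preserving finite meets and finite joins, respectively. The language $\mathcal L_1$ consists of the terms built from $\bot,\top$, propositional variables and fixed point variables by $\wedge,\vee,\to,-,\Diamond,\Box$ and the binders $\mu X.t$, $\nu X.t$ with $t$ positive in $X$; $\mathcal L_2$ is the same with binders $\mu_2,\nu_2$. In $\mathbf A$, $\mu X.t(X)$ is the meet of $\{a\mid t(a)\le a\}$ and $\nu X.t(X)$ the join of $\{a\mid a\le t(a)\}$, if these exist; $\mu_2X.t$ is the join of the transfinite iterates $t^0=\bot$, $t^{\alpha+1}=t(t^\alpha)$, $t^\lambda=\bigvee_{\alpha<\lambda}t^\alpha$ and $\nu_2X.t$ the meet of the dual iterates starting at $\top$, if all of these exist. $\mathbf A$ is a *mu-algebra of the second kind* if every $\mathcal L_2$-term is defined for all values of its variables. An $\mathcal L_1$-inequality is $\phi\le\psi$ with $\phi,\psi\in\mathcal L_1$ having no free fixed point variables; $\mathbf A\models\phi\le\psi$ means that it holds under all assignments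 of elements of $\mathbf A$ to the propositional variables. **Canonical extension.** $\mathbf A^\delta$ is the (up to isomorphism over $\mathbf A$ unique) complete lattice containing $\mathbf A$ as a bounded sublattice such that every element is a join of meets and a meet of joins of elements of $A$, and such that for $S,T\subseteq A$, $\bigwedge S\le\bigvee T$ implies $\bigwedge S'\le\bigvee T'$ for some finite $S'\subseteq S$, $T'\subseteq T$. It carries its own $\to$ and $-$ (the residuals of $\wedge$ and $\vee$) and the modalities $\Box^\pi,\Diamond^\sigma$, where, with $k$ ranging over meets and $u$ over joins of subsets of $A$, $f^\sigma(c)=\bigvee\{\bigwedge\{f(a)\mid k\le a\le u\}\mid k\le c\le u\}$ and $f^\pi(c)=\bigwedge\{\bigvee\{f(a)\mid k\le a\le u\}\mid k\le c\le u\}$. In $\mathbf A^\delta$ the binders $\mu,\nu$ are interpreted as above, over all of $A^\delta$; $\mathbf A^\delta\models\phi\le\psi$ means that $\phi\le\psi$ holds under all assignments into $A^\delta$. A *perfect* modal bi-Heyting algebra is one on a completely distributive complete lattice whose completely join-irreducibles are join-dense and whose completely meet-irreducibles are meet-dense, with $\Box$ completely meet- and $\Diamond$ completely join-preserving. **The algorithm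 $\mu^*$-ALBA.** It works in the language extended by nominals $\mathbf i,\mathbf j$ (ranging over completely join-irreducibles), co-nominals $\mathbf m,\mathbf n$ (completely meet-irreducibles), the left adjoint $\blacklozenge$ of $\Box$ and the right adjoint $\blacksquare$ of $\Diamond$, with binders written $\mu^*,\nu^*$. Signs of occurrences are those in signed generation trees: $\to$ changes the sign in its first, $-$ in its second argument. A run on $\phi\le\psi$ consists of the following. 1. *Preprocessing*: with respect to $+$lhs and $-$rhs, distribute positive $\Diamond,\wedge$ over positive $\vee$ and negative $\Box,\vee$ over negative $\wedge$; split $\alpha\vee\beta\le\gamma$ into $\alpha\le\gamma$, $\beta\le\gamma$ and $\alpha\le\beta\wedge\gamma$ into $\alpha\le\beta$, $\alpha\le\gamma$; replace $\alpha(p)\le\beta(p)$ by $\alpha(\bot)\le\beta(\bot)$ if $\alpha$ is negative and $\beta$ positive in $p$, and by $\alpha(\top)\le\beta(\top)$ if $\alpha$ is positive and $\beta$ negative in $p$. 2. *Starring and first approximation*: replace $\mu,\nu$ by $\mu^*,\nu^*$ and each resulting $\alpha\le\beta$ by the quasi-inequality $\mathbf i\le\alpha\ \&\ \beta\le\mathbf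 m\Rightarrow\mathbf i\le\mathbf m$. 3. Finitely many applications, to inequalities in antecedents, of the following rules (with $\wedge,\vee$ up to commutativity and with newly introduced nominals and co-nominals fresh): * residuation: $\chi-\psi\le\phi\,/\,\chi\le\psi\vee\phi$; $\phi\le\chi\to\psi\,/\,\phi\wedge\chi\le\psi$; $\chi\wedge\psi\le\phi\,/\,\chi\le\psi\to\phi$; $\phi\le\chi\vee\psi\,/\,\phi-\chi\le\psi$; * adjunction: $\phi\vee\chi\le\psi\,/\,\phi\le\psi,\ \chi\le\psi$; $\psi\le\phi\wedge\chi\,/\,\psi\le\phi,\ \psi\le\chi$; $\Diamond\phi\le\psi\,/\,\phi\le\blacksquare\psi$; $\phi\le\Box\psi\,/\,\blacklozenge\phi\le\psi$; * approximation: $\Box\psi\le\mathbf m\,/\,\Box\mathbf n\le\mathbf m,\ \psi\le\mathbf n$; $\mathbf j\le\Diamond\psi\,/\,\mathbf j\le\Diamond\mathbf i,\ \mathbf i\le\psi$; $\chi\to\phi\le\mathbf m\,/\,\mathbf j\to\mathbf n\le\mathbf m,\ \mathbf j\le\chi,\ \phi\le\mathbf n$; $\mathbf i\le\chi-\phi\,/\,\mathbf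 i\le\mathbf j-\mathbf n,\ \mathbf j\le\chi,\ \phi\le\mathbf n$; * $(\mu^\tau\text{-A-R})$: for an order type $\tau\in\{1,\partial\}^n$, replace the quasi-inequality by $n$ quasi-inequalities, the $k$-th having $\mathbf i\le\mu^*X.\psi(\overline{\mathbf j}^\tau_k/\overline x,X)$ and $\mathbf j^{\tau_k}\le^{\tau_k}\phi_k$ in place of $\mathbf i\le\mu^*X.\psi(\overline\phi/\overline x,X)$. Here $\mathbf j^{\tau_k}$ is a nominal if $\tau_k=1$ and a co-nominal if $\tau_k=\partial$, $\le^\partial$ is $\ge$, and $\overline{\mathbf j}^\tau_k$ has $\mathbf j^{\tau_k}$ at place $k$ and at the places $l\ne k$ the constant $\bot$ if $\tau_l=1$, $\top$ if $\tau_l=\partial$. It is required that $\psi(\overline x,X)$ contains no propositional variables and no free fixed point variables but $\overline x,X$, is positive (negative) in $x_l$ if $\tau_l=1$ ($\tau_l=\partial$), and that on every perfect modal bi-Heyting algebra $\mathbf C$ (with its binders read as ordinary least and greatest fixed points) its term function is completely join-preserving on $\mathbf C^\tau\times\mathbf C$; * $(\nu^\tau\text{-A-R})$: the order dual of the previous rule,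 for $\nu^*X.\phi(\overline\psi/\overline x,X)\le\mathbf m$, with complete meet-preservation; * Ackermann rules: if the inequalities of an antecedent that contain $p$ are among $\alpha_i\le p$ and $\beta_j(p)\le\gamma_j(p)$, with $\alpha_i$ $p$-free and syntactically closed, $\beta_j$ positive in $p$ and syntactically closed, $\gamma_j$ negative in $p$ and syntactically open, replace these inequalities by $\beta_j(\bigvee_i\alpha_i)\le\gamma_j(\bigvee_i\alpha_i)$; and dually, $p\le\alpha_i$ and $\gamma_j(p)\le\beta_j(p)$, with $\alpha_i$ $p$-free and syntactically open, $\gamma_j$ negative in $p$ and syntactically closed, $\beta_j$ positive in $p$ and syntactically open, are replaced by $\gamma_j(\bigwedge_i\alpha_i)\le\beta_j(\bigwedge_i\alpha_i)$. Here a term is syntactically open (closed) if all its occurrences of nominals, $\blacklozenge$ and $\mu^*$ are negative (positive) and all its occurrences of co-nominals, $\blacksquare$ and $\nu^*$ are positive (negative). An application of $(\mu^\tau\text{-A-R})$ *handles* the positive occurrences of $\mu^*$ and the negative occurrences of $\nu^*$ in $\mu^*X.\psi(\overline x,X)$, in particular the displayed binder; an application of $(\nu^\tau\text{-A-R})$ handles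 the positive occurrences of $\nu^*$ and the negative occurrences of $\mu^*$ in $\nu^*X.\phi(\overline x,X)$. The run *succeeds* if no propositional variables are left in the resulting quasi-inequalities, and it is *proper* if all occurrences of binders (that are left at the end) have been handled in this way. **Theorem (Canonicity).** Let $\mathbf A$ be a mu-algebra of the second kind and let $\phi\le\psi$ be an $\mathcal L_1$-inequality on which a proper run of $\mu^*$-ALBA succeeds. If $\mathbf A\models\phi\le\psi$, then $\mathbf A^\delta\models\phi\le\psi$. -/

import Mathlib

universe u v

namespace MuCanon

/-! ### Terms

Fixed point variables are de Bruijn indices: `Term β n` is the set of terms whose free fixed point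
(or placeholder) variables are among `n` given ones, so `Term β 0` is the set of sentences; the
body of a binder has one further variable, of index `0`. Propositional variables, nominals and
co-nominals are indexed by `ℕ`. Every binder carries a label from `β`. Terms of the languages with
binders `μ, ν` (resp. `μ₂, ν₂`) have labels in `Unit`; terms with binders `μ*, ν*` have labels in
`Bool`, the label recording whether that occurrence has been handled by a fixed point
approximation rule. -/

inductive Term (β : Type) : ℕ → Type
  | bot {n : ℕ} : Term β n
  | top {n : ℕ} : Term β n
  | var {n : ℕ} (p : ℕ) : Term β n
  | fvar {n : ℕ} (i : Fin n) : Term β n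
  | nom {n : ℕ} (j : ℕ) : Term β n
  | cnom {n : ℕ} (m : ℕ) : Term β n
  | and {n : ℕ} (s t : Term β n) : Term β n
  | or {n : ℕ} (s t : Term β n) : Term β n
  | imp {n : ℕ} (s t : Term β n) : Term β n
  | sub {n : ℕ} (s t : Term β n) : Term β n
  | dia {n : ℕ} (t : Term β n) : Term β n
  | box {n : ℕ} (t : Term β n) : Term β n
  | bdia {n : ℕ} (t : Term β n) : Term β n
  | bbox {n : ℕ} (t : Term β n) : Term β n
  | mu {n : ℕ} (b : β) (t : Term β (n + 1)) : Term β n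
  | nu {n : ℕ} (b : β) (t : Term β (n + 1)) : Term β n

/-- Extension of a tuple by a new entry of index `0`. -/
def extend {X : Type*} {n : ℕ} (a : X) (f : Fin n → X) : Fin (n + 1) → X :=
  fun i => Fin.cases a f i

namespace Term

variable {β : Type}

/-- Renaming of free fixed point variables. -/
def rename : {n m : ℕ} → (Fin n → Fin m) → Term β n → Term β m
  | _, _, _, bot => bot
  | _, _, _, top => top
  | _, _, _, var p => var p
  | _, _, r, fvar i => fvar (r i)
  | _, _, _, nom j => nom j
  | _, _, _, cnom m => cnom m
  | _, _, r, and s t => and (rename r s) (rename r t)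
  | _, _, r, or s t => or (rename r s) (rename r t)
  | _, _, r, imp s t => imp (rename r s) (rename r t)
  | _, _, r, sub s t => sub (rename r s) (rename r t)
  | _, _, r, dia t => dia (rename r t)
  | _, _, r, box t => box (rename r t)
  | _, _, r, bdia t => bdia (rename r t)
  | _, _, r, bbox t => bbox (rename r t)
  | _, _, r, mu b t => mu b (rename (extend 0 (fun i => (r i).succ)) t)
  | _, _, r, nu b t => nu b (rename (extend 0 (fun i => (r i).succ)) t)

/-- Passing a substitution under a binder. -/
def lift {n m : ℕ} (σ : Fin n → Term β m) : Fin (n + 1) → Term β (m + 1) :=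
  extend (fvar 0) (fun i => rename Fin.succ (σ i))

/-- Capture-avoiding substitution for the free fixed point / placeholder variables. -/
def subst : {n m : ℕ} → (Fin n → Term β m) → Term β n → Term β m
  | _, _, _, bot => bot
  | _, _, _, top => top
  | _, _, _, var p => var p
  | _, _, σ, fvar i => σ i
  | _, _, _, nom j => nom j
  | _, _, _, cnom m => cnom m
  | _, _, σ, and s t => and (subst σ s) (subst σ t)
  | _, _, σ, or s t => or (subst σ s) (subst σ t)
  | _, _, σ, imp s t => imp (subst σ s) (subst σ t)
  | _, _, σ, sub s t => sub (subst σ s) (subst σ t)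
  | _, _, σ, dia t => dia (subst σ t)
  | _, _, σ, box t => box (subst σ t)
  | _, _, σ, bdia t => bdia (subst σ t)
  | _, _, σ, bbox t => bbox (subst σ t)
  | _, _, σ, mu b t => mu b (subst (lift σ) t)
  | _, _, σ, nu b t => nu b (subst (lift σ) t)

/-- `substVar p α t` is `t(α/p)`: substitution of the sentence `α` for the propositional
variable `p`. -/
def substVar (p : ℕ) (α : Term β 0) : {n : ℕ} → Term β n → Term β n
  | _, bot => bot
  | _, top => top
  | _, var q => if q = p then rename Fin.elim0 α else var q
  | _, fvar i => fvar i
  | _, nom j => nom j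
  | _, cnom m => cnom m
  | _, and s t => and (substVar p α s) (substVar p α t)
  | _, or s t => or (substVar p α s) (substVar p α t)
  | _, imp s t => imp (substVar p α s) (substVar p α t)
  | _, sub s t => sub (substVar p α s) (substVar p α t)
  | _, dia t => dia (substVar p α t)
  | _, box t => box (substVar p α t)
  | _, bdia t => bdia (substVar p α t)
  | _, bbox t => bbox (substVar p α t)
  | _, mu b t => mu b (substVar p α t)
  | _, nu b t => nu b (substVar p α t)

/-- Terms without nominals, co-nominals and the adjoint modalities. -/
def Basic : {n : ℕ} → Term β n → Prop
  | _, bot => True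
  | _, top => True
  | _, var _ => True
  | _, fvar _ => True
  | _, nom _ => False
  | _, cnom _ => False
  | _, and s t => Basic s ∧ Basic t
  | _, or s t => Basic s ∧ Basic t
  | _, imp s t => Basic s ∧ Basic t
  | _, sub s t => Basic s ∧ Basic t
  | _, dia t => Basic t
  | _, box t => Basic t
  | _, bdia _ => False
  | _, bbox _ => False
  | _, mu _ t => Basic t
  | _, nu _ t => Basic t

/-- `VarSign p s t`: in the positive generation tree of `t` every `p`-node has sign `s`
(`true` is `+`). So `VarSign p true` is "positive in `p`", `VarSign p false` "negative in `p`". -/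
def VarSign (p : ℕ) : {n : ℕ} → Bool → Term β n → Prop
  | _, _, bot => True
  | _, _, top => True
  | _, s, var q => q = p → s = true
  | _, _, fvar _ => True
  | _, _, nom _ => True
  | _, _, cnom _ => True
  | _, s, and a b => VarSign p s a ∧ VarSign p s b
  | _, s, or a b => VarSign p s a ∧ VarSign p s b
  | _, s, imp a b => VarSign p (!s) a ∧ VarSign p s b
  | _, s, sub a b => VarSign p s a ∧ VarSign p (!s) b
  | _, s, dia t => VarSign p s t
  | _, s, box t => VarSign p s t
  | _, s, bdia t => VarSign p s t
  | _, s, bbox t => VarSign p s t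
  | _, s, mu _ t => VarSign p s t
  | _, s, nu _ t => VarSign p s t

/-- The same for the free fixed point / placeholder variable of index `i`. -/
def FVarSign : {n : ℕ} → Fin n → Bool → Term β n → Prop
  | _, _, _, bot => True
  | _, _, _, top => True
  | _, _, _, var _ => True
  | _, i, s, fvar k => k = i → s = true
  | _, _, _, nom _ => True
  | _, _, _, cnom _ => True
  | _, i, s, and a b => FVarSign i s a ∧ FVarSign i s b
  | _, i, s, or a b => FVarSign i s a ∧ FVarSign i s b
  | _, i, s, imp a b => FVarSign i (!s) a ∧ FVarSign i s b
  | _, i, s, sub a b => FVarSign i s a ∧ FVarSign i (!s) b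
  | _, i, s, dia t => FVarSign i s t
  | _, i, s, box t => FVarSign i s t
  | _, i, s, bdia t => FVarSign i s t
  | _, i, s, bbox t => FVarSign i s t
  | _, i, s, mu _ t => FVarSign i.succ s t
  | _, i, s, nu _ t => FVarSign i.succ s t

/-- Well-formedness: the body of every binder is positive in the bound variable. -/
def WF : {n : ℕ} → Term β n → Prop
  | _, bot => True
  | _, top => True
  | _, var _ => True
  | _, fvar _ => True
  | _, nom _ => True
  | _, cnom _ => True
  | _, and s t => WF s ∧ WF t
  | _, or s t => WF s ∧ WF t
  | _, imp s t => WF s ∧ WF t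
  | _, sub s t => WF s ∧ WF t
  | _, dia t => WF t
  | _, box t => WF t
  | _, bdia t => WF t
  | _, bbox t => WF t
  | _, mu _ t => FVarSign 0 true t ∧ WF t
  | _, nu _ t => FVarSign 0 true t ∧ WF t

/-- `VarFree p t`: the propositional variable `p` does not occur in `t`. -/
def VarFree (p : ℕ) : {n : ℕ} → Term β n → Prop
  | _, bot => True
  | _, top => True
  | _, var q => q ≠ p
  | _, fvar _ => True
  | _, nom _ => True
  | _, cnom _ => True
  | _, and s t => VarFree p s ∧ VarFree p t
  | _, or s t => VarFree p s ∧ VarFree p t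
  | _, imp s t => VarFree p s ∧ VarFree p t
  | _, sub s t => VarFree p s ∧ VarFree p t
  | _, dia t => VarFree p t
  | _, box t => VarFree p t
  | _, bdia t => VarFree p t
  | _, bbox t => VarFree p t
  | _, mu _ t => VarFree p t
  | _, nu _ t => VarFree p t

/-- No propositional variable occurs in `t`. -/
def Pure {n : ℕ} (t : Term β n) : Prop := ∀ p, VarFree p t

/-- The nominal `j` does not occur in `t`. -/
def NomFree (j : ℕ) : {n : ℕ} → Term β n → Prop
  | _, bot => True
  | _, top => True
  | _, var _ => True
  | _, fvar _ => True
  | _, nom k => k ≠ j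
  | _, cnom _ => True
  | _, and s t => NomFree j s ∧ NomFree j t
  | _, or s t => NomFree j s ∧ NomFree j t
  | _, imp s t => NomFree j s ∧ NomFree j t
  | _, sub s t => NomFree j s ∧ NomFree j t
  | _, dia t => NomFree j t
  | _, box t => NomFree j t
  | _, bdia t => NomFree j t
  | _, bbox t => NomFree j t
  | _, mu _ t => NomFree j t
  | _, nu _ t => NomFree j t

/-- The co-nominal `m` does not occur in `t`. -/
def CnomFree (m : ℕ) : {n : ℕ} → Term β n → Prop
  | _, bot => True
  | _, top => True
  | _, var _ => True
  | _, fvar _ => True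
  | _, nom _ => True
  | _, cnom k => k ≠ m
  | _, and s t => CnomFree m s ∧ CnomFree m t
  | _, or s t => CnomFree m s ∧ CnomFree m t
  | _, imp s t => CnomFree m s ∧ CnomFree m t
  | _, sub s t => CnomFree m s ∧ CnomFree m t
  | _, dia t => CnomFree m t
  | _, box t => CnomFree m t
  | _, bdia t => CnomFree m t
  | _, bbox t => CnomFree m t
  | _, mu _ t => CnomFree m t
  | _, nu _ t => CnomFree m t

/-- `Syn true`: syntactically open terms; `Syn false`: syntactically closed terms. -/
def Syn : {n : ℕ} → Bool → Term β n → Prop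
  | _, _, bot => True
  | _, _, top => True
  | _, _, var _ => True
  | _, _, fvar _ => True
  | _, s, nom _ => s = false
  | _, s, cnom _ => s = true
  | _, s, and a b => Syn s a ∧ Syn s b
  | _, s, or a b => Syn s a ∧ Syn s b
  | _, s, imp a b => Syn (!s) a ∧ Syn s b
  | _, s, sub a b => Syn s a ∧ Syn (!s) b
  | _, s, dia t => Syn s t
  | _, s, box t => Syn s t
  | _, s, bdia t => s = false ∧ Syn s t
  | _, s, bbox t => s = true ∧ Syn s t
  | _, s, mu _ t => s = false ∧ Syn s t
  | _, s, nu _ t => s = true ∧ Syn s t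

abbrev SynOpen {n : ℕ} (t : Term β n) : Prop := Syn true t

abbrev SynClosed {n : ℕ} (t : Term β n) : Prop := Syn false t

/-- The translation `t ↦ t*`, replacing `μ, ν` by (not yet handled) `μ*, ν*`. -/
def star : {n : ℕ} → Term Unit n → Term Bool n
  | _, bot => bot
  | _, top => top
  | _, var p => var p
  | _, fvar i => fvar i
  | _, nom j => nom j
  | _, cnom m => cnom m
  | _, and s t => and (star s) (star t)
  | _, or s t => or (star s) (star t)
  | _, imp s t => imp (star s) (star t)
  | _, sub s t => sub (star s) (star t)
  | _, dia t => dia (star t)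
  | _, box t => box (star t)
  | _, bdia t => bdia (star t)
  | _, bbox t => bbox (star t)
  | _, mu _ t => mu false (star t)
  | _, nu _ t => nu false (star t)

/-- `handle s t` labels as handled the skeleton binders, i.e. the nodes `+μ*` and `-ν*`, of the
signed generation tree of `t` whose root has sign `s`. -/
def handle : {n : ℕ} → Bool → Term Bool n → Term Bool n
  | _, _, bot => bot
  | _, _, top => top
  | _, _, var p => var p
  | _, _, fvar i => fvar i
  | _, _, nom j => nom j
  | _, _, cnom m => cnom m
  | _, s, and a b => and (handle s a) (handle s b)
  | _, s, or a b => or (handle s a) (handle s b)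
  | _, s, imp a b => imp (handle (!s) a) (handle s b)
  | _, s, sub a b => sub (handle s a) (handle (!s) b)
  | _, s, dia t => dia (handle s t)
  | _, s, box t => box (handle s t)
  | _, s, bdia t => bdia (handle s t)
  | _, s, bbox t => bbox (handle s t)
  | _, s, mu b t => mu (b || s) (handle s t)
  | _, s, nu b t => nu (b || !s) (handle s t)

/-- Every binder occurring in the term is labelled as handled. -/
def AllHandled : {n : ℕ} → Term Bool n → Prop
  | _, bot => True
  | _, top => True
  | _, var _ => True
  | _, fvar _ => True
  | _, nom _ => True
  | _, cnom _ => True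
  | _, and s t => AllHandled s ∧ AllHandled t
  | _, or s t => AllHandled s ∧ AllHandled t
  | _, imp s t => AllHandled s ∧ AllHandled t
  | _, sub s t => AllHandled s ∧ AllHandled t
  | _, dia t => AllHandled t
  | _, box t => AllHandled t
  | _, bdia t => AllHandled t
  | _, bbox t => AllHandled t
  | _, mu b t => b = true ∧ AllHandled t
  | _, nu b t => b = true ∧ AllHandled t

end Term

/-- Terms of the modal mu-language: no nominals, co-nominals or adjoint modalities, and binders
only over bodies positive in the bound variable. -/
def IsMuTerm {n : ℕ} (t : Term Unit n) : Prop := t.Basic ∧ t.WF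

/-! ### Modal bi-Heyting algebras and mu-algebras -/

/-- Modal bi-Heyting algebras; `a ⇨ b` is implication and `a \ b` is subtraction. -/
class ModalBiheytingAlgebra (A : Type u) extends BiheytingAlgebra A where
  box : A → A
  dia : A → A
  box_top : box ⊤ = ⊤
  box_inf : ∀ a b, box (a ⊓ b) = box a ⊓ box b
  dia_bot : dia ⊥ = ⊥
  dia_sup : ∀ a b, dia (a ⊔ b) = dia a ⊔ dia b

section Algebra

variable {A : Type u} [ModalBiheytingAlgebra A]

/-- `Val L G v t env b`: the term `t` is defined under the assignment `v` of the propositional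
variables and `env` of the free fixed point variables, and `b` is its value. Here `L f b`
(`G f b`) says that the least (greatest) fixed point of `f` is defined and equal to `b`. -/
def Val (L G : (A → A) → A → Prop) (v : ℕ → A) :
    {n : ℕ} → Term Unit n → (Fin n → A) → A → Prop
  | _, .bot, _, b => b = ⊥
  | _, .top, _, b => b = ⊤
  | _, .var p, _, b => b = v p
  | _, .fvar i, env, b => b = env i
  | _, .nom _, _, _ => False
  | _, .cnom _, _, _ => False
  | _, .and s t, env, b => ∃ x y, Val L G v s env x ∧ Val L G v t env y ∧ b = x ⊓ y
  | _, .or s t, env, b => ∃ x y, Val L G v s env x ∧ Val L G v t env y ∧ b = x ⊔ y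
  | _, .imp s t, env, b => ∃ x y, Val L G v s env x ∧ Val L G v t env y ∧ b = x ⇨ y
  | _, .sub s t, env, b => ∃ x y, Val L G v s env x ∧ Val L G v t env y ∧ b = x \ y
  | _, .dia t, env, b => ∃ x, Val L G v t env x ∧ b = ModalBiheytingAlgebra.dia x
  | _, .box t, env, b => ∃ x, Val L G v t env x ∧ b = ModalBiheytingAlgebra.box x
  | _, .bdia _, _, _ => False
  | _, .bbox _, _, _ => False
  | _, .mu _ t, env, b => ∃ f : A → A, (∀ a, Val L G v t (extend a env) (f a)) ∧ L f b
  | _, .nu _ t, env, b => ∃ f : A → A, (∀ a, Val L G v t (extend a env) (f a)) ∧ G f b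

/-- `b` is the meet of the pre-fixed points of `f`. -/
def IsMu (f : A → A) (b : A) : Prop := IsGLB {a | f a ≤ a} b

/-- `b` is the join of the post-fixed points of `f`. -/
def IsNu (f : A → A) (b : A) : Prop := IsLUB {a | a ≤ f a} b

/-- All transfinite iterates of `f` starting at `⊥` exist, and `b` is their join. -/
def IsMu₂ (f : A → A) (b : A) : Prop :=
  ∃ g : Ordinal.{u} → A, g 0 = ⊥ ∧ (∀ α, g (Order.succ α) = f (g α)) ∧
    (∀ l, Order.IsSuccLimit l → IsLUB (g '' Set.Iio l) (g l)) ∧ IsLUB (Set.range g) b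

/-- All transfinite iterates of `f` starting at `⊤` exist, and `b` is their meet. -/
def IsNu₂ (f : A → A) (b : A) : Prop :=
  ∃ g : Ordinal.{u} → A, g 0 = ⊤ ∧ (∀ α, g (Order.succ α) = f (g α)) ∧
    (∀ l, Order.IsSuccLimit l → IsGLB (g '' Set.Iio l) (g l)) ∧ IsGLB (Set.range g) b

variable (A) in
/-- Mu-algebras of the second kind: every term is defined everywhere when its binders are
interpreted as `μ₂, ν₂`. -/
def SecondKind : Prop :=
  ∀ (n : ℕ) (t : Term Unit n), IsMuTerm t → ∀ (v : ℕ → A) (env : Fin n → A),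
    ∃ b, Val IsMu₂ IsNu₂ v t env b

variable (A) in
/-- `A ⊨ φ ≤ ψ`, with the binders interpreted as `μ, ν`. -/
def Models (φ ψ : Term Unit 0) : Prop :=
  ∀ (v : ℕ → A) (a b : A),
    Val IsMu IsNu v φ Fin.elim0 a → Val IsMu IsNu v ψ Fin.elim0 b → a ≤ b

end Algebra

/-! ### Interpretation in complete lattices with modalities -/

section Complete

variable {C : Type v} [CompleteLattice C]

def IsCompletelyJoinIrreducible (j : C) : Prop := ∀ X : Set C, j = sSup X → j ∈ X

def IsCompletelyMeetIrreducible (m : C) : Prop := ∀ Y : Set C, m = sInf Y → m ∈ Y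

variable (C) in
structure Assignment where
  var : ℕ → C
  nom : ℕ → C
  cnom : ℕ → C

/-- Nominals are sent to completely join-irreducible and co-nominals to completely
meet-irreducible elements. -/
def Assignment.Respects (V : Assignment C) : Prop :=
  (∀ j, IsCompletelyJoinIrreducible (V.nom j)) ∧ ∀ m, IsCompletelyMeetIrreducible (V.cnom m)

/-- Interpretation of terms. Implication, subtraction, the left adjoint of `box` and the right
adjoint of `dia` are given by the usual formulas for residuals and adjoints in complete lattices;
least and greatest fixed points are the meet of all pre-fixed and the join of all post-fixed
points in `C`. -/
def eval (box dia : C → C) (V : Assignment C) {β : Type} : {n : ℕ} → Term β n → (Fin n → C) → C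
  | _, .bot, _ => ⊥
  | _, .top, _ => ⊤
  | _, .var p, _ => V.var p
  | _, .fvar i, env => env i
  | _, .nom j, _ => V.nom j
  | _, .cnom m, _ => V.cnom m
  | _, .and s t, env => eval box dia V s env ⊓ eval box dia V t env
  | _, .or s t, env => eval box dia V s env ⊔ eval box dia V t env
  | _, .imp s t, env => sSup {c | c ⊓ eval box dia V s env ≤ eval box dia V t env}
  | _, .sub s t, env => sInf {c | eval box dia V s env ≤ eval box dia V t env ⊔ c}
  | _, .dia t, env => dia (eval box dia V t env)
  | _, .box t, env => box (eval box dia V t env)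
  | _, .bdia t, env => sInf {c | eval box dia V t env ≤ box c}
  | _, .bbox t, env => sSup {c | dia c ≤ eval box dia V t env}
  | _, .mu _ t, env => sInf {c | eval box dia V t (extend c env) ≤ c}
  | _, .nu _ t, env => sSup {c | c ≤ eval box dia V t (extend c env)}

/-- Perfect modal bi-Heyting algebras: completely distributive complete lattices in which the
completely join-irreducibles are join-dense and the completely meet-irreducibles meet-dense, with
a completely meet-preserving `box` and a completely join-preserving `dia`. -/
structure IsPerfect (box dia : C → C) : Prop where
  distrib : ∀ (ι : Type v) (κ : ι → Type v) (f : ∀ i, κ i → C),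
    ⨅ i, ⨆ k, f i k = ⨆ g : ∀ i, κ i, ⨅ i, f i (g i)
  join_dense : ∀ c : C, c = sSup {j | IsCompletelyJoinIrreducible j ∧ j ≤ c}
  meet_dense : ∀ c : C, c = sInf {m | IsCompletelyMeetIrreducible m ∧ c ≤ m}
  box_sInf : ∀ S : Set C, box (sInf S) = sInf (box '' S)
  dia_sSup : ∀ S : Set C, dia (sSup S) = sSup (dia '' S)

/-- The join in `C^τ × C` of a set of tuples `(X, x₁, …, xₙ)`; the variable `X` has index `0` and
`τ k = true` stands for `1`, `τ k = false` for `∂`. -/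
def joinOrd {n : ℕ} (τ : Fin n → Bool) (S : Set (Fin (n + 1) → C)) : Fin (n + 1) → C :=
  extend (sSup ((fun x => x 0) '' S))
    (fun k => if τ k then sSup ((fun x => x k.succ) '' S) else sInf ((fun x => x k.succ) '' S))

/-- The meet in `C^τ × C`. -/
def meetOrd {n : ℕ} (τ : Fin n → Bool) (S : Set (Fin (n + 1) → C)) : Fin (n + 1) → C :=
  extend (sInf ((fun x => x 0) '' S))
    (fun k => if τ k then sInf ((fun x => x k.succ) '' S) else sSup ((fun x => x k.succ) '' S))

end Complete

/-- On every perfect modal bi-Heyting algebra the term function of `ψ(x₁, …, xₙ, X)` is completely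
join-preserving on `C^τ × C`. -/
def JoinPreserving {n : ℕ} (ψ : Term Bool (n + 1)) (τ : Fin n → Bool) : Prop :=
  ∀ (C : Type v) [CompleteLattice C] (box dia : C → C), IsPerfect box dia →
    ∀ V : Assignment C, V.Respects → ∀ S : Set (Fin (n + 1) → C),
      eval box dia V ψ (joinOrd τ S) = sSup (eval box dia V ψ '' S)

/-- The order dual of `JoinPreserving`. -/
def MeetPreserving {n : ℕ} (φ : Term Bool (n + 1)) (τ : Fin n → Bool) : Prop :=
  ∀ (C : Type v) [CompleteLattice C] (box dia : C → C), IsPerfect box dia →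
    ∀ V : Assignment C, V.Respects → ∀ S : Set (Fin (n + 1) → C),
      eval box dia V φ (meetOrd τ S) = sInf (eval box dia V φ '' S)

/-! ### The canonical extension -/

section CanonicalExtension

variable {A : Type u} [ModalBiheytingAlgebra A] {C : Type v} [CompleteLattice C]

/-- The embedding `e` exhibits the complete lattice `C` as the canonical extension of `A`. -/
structure IsCanonicalExtension (e : BoundedLatticeHom A C) : Prop where
  injective : Function.Injective e
  join_of_meets : ∀ c : C, ∃ F : Set (Set A), c = sSup ((fun S => sInf (e '' S)) '' F)
  meet_of_joins : ∀ c : C, ∃ F : Set (Set A), c = sInf ((fun S => sSup (e '' S)) '' F)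
  compact : ∀ S T : Set A, sInf (e '' S) ≤ sSup (e '' T) →
    ∃ S' T' : Finset A, ↑S' ⊆ S ∧ ↑T' ⊆ T ∧ S'.inf id ≤ T'.sup id

def ClosedElts (e : BoundedLatticeHom A C) : Set C := {c | ∃ S : Set A, c = sInf (e '' S)}

def OpenElts (e : BoundedLatticeHom A C) : Set C := {c | ∃ S : Set A, c = sSup (e '' S)}

/-- The extension `f^σ`. -/
def sigmaExt (e : BoundedLatticeHom A C) (f : A → A) (c : C) : C :=
  sSup {x | ∃ k ∈ ClosedElts e, ∃ w ∈ OpenElts e, k ≤ c ∧ c ≤ w ∧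
    x = sInf ((fun a => e (f a)) '' {a | k ≤ e a ∧ e a ≤ w})}

/-- The extension `f^π`. -/
def piExt (e : BoundedLatticeHom A C) (f : A → A) (c : C) : C :=
  sInf {x | ∃ k ∈ ClosedElts e, ∃ w ∈ OpenElts e, k ≤ c ∧ c ≤ w ∧
    x = sSup ((fun a => e (f a)) '' {a | k ≤ e a ∧ e a ≤ w})}

/-- `A^δ ⊨ φ ≤ ψ`, the modalities of `A^δ` being `box^π` and `dia^σ`. (Nominals and co-nominals do
not occur in terms of the modal mu-language, so their values do not matter.) -/
def CanonicalModels (e : BoundedLatticeHom A C) (φ ψ : Term Unit 0) : Prop :=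
  ∀ V : Assignment C,
    eval (piExt e ModalBiheytingAlgebra.box) (sigmaExt e ModalBiheytingAlgebra.dia) V φ Fin.elim0 ≤
      eval (piExt e ModalBiheytingAlgebra.box) (sigmaExt e ModalBiheytingAlgebra.dia) V ψ Fin.elim0

end CanonicalExtension

/-! ### The algorithm -/

/-- Inequalities between sentences. -/
structure Ineq (β : Type) where
  lhs : Term β 0
  rhs : Term β 0

/-- One application of a distribution law inside a term, at a node of the signed generation tree
whose root has the given sign: positive diamonds and meets are distributed over positive joins,
negative boxes and joins over negative meets. -/
inductive Distr : Bool → {n : ℕ} → Term Unit n → Term Unit n → Prop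
  | dia_or {n : ℕ} (a b : Term Unit n) :
      Distr true (.dia (.or a b)) (.or (.dia a) (.dia b))
  | or_and {n : ℕ} (a b c : Term Unit n) :
      Distr true (.and (.or a b) c) (.or (.and a c) (.and b c))
  | and_or {n : ℕ} (a b c : Term Unit n) :
      Distr true (.and c (.or a b)) (.or (.and c a) (.and c b))
  | box_and {n : ℕ} (a b : Term Unit n) :
      Distr false (.box (.and a b)) (.and (.box a) (.box b))
  | and_orN {n : ℕ} (a b c : Term Unit n) :
      Distr false (.or (.and a b) c) (.and (.or a c) (.or b c))
  | or_andN {n : ℕ} (a b c : Term Unit n) :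
      Distr false (.or c (.and a b)) (.and (.or c a) (.or c b))
  | andL {n : ℕ} {s : Bool} {a a' : Term Unit n} (b : Term Unit n) :
      Distr s a a' → Distr s (.and a b) (.and a' b)
  | andR {n : ℕ} {s : Bool} {b b' : Term Unit n} (a : Term Unit n) :
      Distr s b b' → Distr s (.and a b) (.and a b')
  | orL {n : ℕ} {s : Bool} {a a' : Term Unit n} (b : Term Unit n) :
      Distr s a a' → Distr s (.or a b) (.or a' b)
  | orR {n : ℕ} {s : Bool} {b b' : Term Unit n} (a : Term Unit n) :
      Distr s b b' → Distr s (.or a b) (.or a b')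
  | impL {n : ℕ} {s : Bool} {a a' : Term Unit n} (b : Term Unit n) :
      Distr (!s) a a' → Distr s (.imp a b) (.imp a' b)
  | impR {n : ℕ} {s : Bool} {b b' : Term Unit n} (a : Term Unit n) :
      Distr s b b' → Distr s (.imp a b) (.imp a b')
  | subL {n : ℕ} {s : Bool} {a a' : Term Unit n} (b : Term Unit n) :
      Distr s a a' → Distr s (.sub a b) (.sub a' b)
  | subR {n : ℕ} {s : Bool} {b b' : Term Unit n} (a : Term Unit n) :
      Distr (!s) b b' → Distr s (.sub a b) (.sub a b')
  | dia {n : ℕ} {s : Bool} {a a' : Term Unit n} : Distr s a a' → Distr s (.dia a) (.dia a')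
  | box {n : ℕ} {s : Bool} {a a' : Term Unit n} : Distr s a a' → Distr s (.box a) (.box a')
  | mu {n : ℕ} {s : Bool} {b : Unit} {a a' : Term Unit (n + 1)} :
      Distr s a a' → Distr s (.mu b a) (.mu b a')
  | nu {n : ℕ} {s : Bool} {b : Unit} {a a' : Term Unit (n + 1)} :
      Distr s a a' → Distr s (.nu b a) (.nu b a')

/-- Preprocessing rules: an inequality is replaced by a list of inequalities. -/
inductive PreRule : Ineq Unit → List (Ineq Unit) → Prop
  | distrL {φ φ' : Term Unit 0} (ψ : Term Unit 0) : Distr true φ φ' → PreRule ⟨φ, ψ⟩ [⟨φ', ψ⟩]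
  | distrR {ψ ψ' : Term Unit 0} (φ : Term Unit 0) : Distr false ψ ψ' → PreRule ⟨φ, ψ⟩ [⟨φ, ψ'⟩]
  | orLA (α β γ : Term Unit 0) : PreRule ⟨.or α β, γ⟩ [⟨α, γ⟩, ⟨β, γ⟩]
  | andRA (α β γ : Term Unit 0) : PreRule ⟨α, .and β γ⟩ [⟨α, β⟩, ⟨α, γ⟩]
  | elimBot (p : ℕ) (α β : Term Unit 0) : α.VarSign p false → β.VarSign p true →
      PreRule ⟨α, β⟩ [⟨Term.substVar p .bot α, Term.substVar p .bot β⟩]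
  | elimTop (p : ℕ) (γ χ : Term Unit 0) : γ.VarSign p true → χ.VarSign p false →
      PreRule ⟨γ, χ⟩ [⟨Term.substVar p .top γ, Term.substVar p .top χ⟩]

/-- One preprocessing step on the current list of inequalities. -/
inductive PreStep : List (Ineq Unit) → List (Ineq Unit) → Prop
  | mk (l₁ l₂ : List (Ineq Unit)) {I : Ineq Unit} {Is : List (Ineq Unit)} :
      PreRule I Is → PreStep (l₁ ++ I :: l₂) (l₁ ++ Is ++ l₂)

/-- The quasi-inequality whose antecedent is the conjunction of `ants` and whose consequent is
`i ≤ m`, for the nominal `i` and co-nominal `m` with the given indices. -/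
structure QIneq where
  ants : List (Ineq Bool)
  i : ℕ
  m : ℕ

/-- Starring of the binders followed by first approximation. -/
def firstApprox (i m : ℕ) (I : Ineq Unit) : QIneq :=
  ⟨[⟨.nom i, I.lhs.star⟩, ⟨I.rhs.star, .cnom m⟩], i, m⟩

def QIneq.FreshNom (Q : QIneq) (j : ℕ) : Prop :=
  j ≠ Q.i ∧ ∀ I ∈ Q.ants, I.lhs.NomFree j ∧ I.rhs.NomFree j

def QIneq.FreshCnom (Q : QIneq) (n : ℕ) : Prop :=
  n ≠ Q.m ∧ ∀ I ∈ Q.ants, I.lhs.CnomFree n ∧ I.rhs.CnomFree n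

/-- The tuple with a nominal (co-nominal, if `τ k = ∂`) of index `c` at place `k` and `⊥^τ` at the
other places. -/
def nomTuple {n : ℕ} (τ : Fin n → Bool) (k : Fin n) (c : ℕ) : Fin n → Term Bool 0 :=
  fun l => if l = k then (if τ k then .nom c else .cnom c) else (if τ l then .bot else .top)

/-- The tuple with a co-nominal (nominal, if `τ k = ∂`) of index `c` at place `k` and `⊤^τ` at the
other places. -/
def cnomTuple {n : ℕ} (τ : Fin n → Bool) (k : Fin n) (c : ℕ) : Fin n → Term Bool 0 :=
  fun l => if l = k then (if τ k then .cnom c else .nom c) else (if τ l then .top else .bot)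

/-- The rules acting on a single inequality in an antecedent. Such an inequality is replaced by a
disjunction (outer list) of conjunctions (inner lists) of inequalities. `FN` and `FC` are the
sets of fresh nominals and co-nominals. Residuation and meet / join are used up to commutativity.
-/
inductive Rule (FN FC : ℕ → Prop) : Ineq Bool → List (List (Ineq Bool)) → Prop
  -- residuation
  | subLR (χ ψ φ : Term Bool 0) : Rule FN FC ⟨.sub χ ψ, φ⟩ [[⟨χ, .or ψ φ⟩]]
  | impRR (φ χ ψ : Term Bool 0) : Rule FN FC ⟨φ, .imp χ ψ⟩ [[⟨.and φ χ, ψ⟩]]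
  | andLR (χ ψ φ : Term Bool 0) : Rule FN FC ⟨.and χ ψ, φ⟩ [[⟨χ, .imp ψ φ⟩]]
  | andLR_comm (χ ψ φ : Term Bool 0) : Rule FN FC ⟨.and χ ψ, φ⟩ [[⟨ψ, .imp χ φ⟩]]
  | orRR (φ χ ψ : Term Bool 0) : Rule FN FC ⟨φ, .or χ ψ⟩ [[⟨.sub φ χ, ψ⟩]]
  | orRR_comm (φ χ ψ : Term Bool 0) : Rule FN FC ⟨φ, .or χ ψ⟩ [[⟨.sub φ ψ, χ⟩]]
  -- adjunction
  | orLA (φ χ ψ : Term Bool 0) : Rule FN FC ⟨.or φ χ, ψ⟩ [[⟨φ, ψ⟩, ⟨χ, ψ⟩]]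
  | andRA (ψ φ χ : Term Bool 0) : Rule FN FC ⟨ψ, .and φ χ⟩ [[⟨ψ, φ⟩, ⟨ψ, χ⟩]]
  | diaLA (φ ψ : Term Bool 0) : Rule FN FC ⟨.dia φ, ψ⟩ [[⟨φ, .bbox ψ⟩]]
  | boxRA (φ ψ : Term Bool 0) : Rule FN FC ⟨φ, .box ψ⟩ [[⟨.bdia φ, ψ⟩]]
  -- ordinary approximation
  | boxAppr (ψ : Term Bool 0) (m n : ℕ) : FC n →
      Rule FN FC ⟨.box ψ, .cnom m⟩ [[⟨.box (.cnom n), .cnom m⟩, ⟨ψ, .cnom n⟩]]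
  | diaAppr (ψ : Term Bool 0) (j i : ℕ) : FN i →
      Rule FN FC ⟨.nom j, .dia ψ⟩ [[⟨.nom j, .dia (.nom i)⟩, ⟨.nom i, ψ⟩]]
  | impAppr (χ φ : Term Bool 0) (m j n : ℕ) : FN j → FC n →
      Rule FN FC ⟨.imp χ φ, .cnom m⟩
        [[⟨.imp (.nom j) (.cnom n), .cnom m⟩, ⟨.nom j, χ⟩, ⟨φ, .cnom n⟩]]
  | subAppr (χ φ : Term Bool 0) (i j n : ℕ) : FN j → FC n →
      Rule FN FC ⟨.nom i, .sub χ φ⟩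
        [[⟨.nom i, .sub (.nom j) (.cnom n)⟩, ⟨.nom j, χ⟩, ⟨φ, .cnom n⟩]]
  -- approximation for `μ*`
  | muAppr {n : ℕ} (τ : Fin n → Bool) (b : Bool) (ψ : Term Bool (n + 1)) (φ : Fin n → Term Bool 0)
      (i : ℕ) (c : Fin n → ℕ) :
      ψ.Pure → (∀ k, ψ.FVarSign k.succ (τ k)) → JoinPreserving.{v} ψ τ →
      (∀ k, if τ k then FN (c k) else FC (c k)) →
      Rule FN FC ⟨.nom i, (Term.mu b ψ).subst φ⟩
        (List.ofFn fun k =>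
          [⟨.nom i, ((Term.mu b ψ).handle true).subst (nomTuple τ k (c k))⟩,
            if τ k then ⟨.nom (c k), φ k⟩ else ⟨φ k, .cnom (c k)⟩])
  -- approximation for `ν*`
  | nuAppr {n : ℕ} (τ : Fin n → Bool) (b : Bool) (φ : Term Bool (n + 1)) (ψ : Fin n → Term Bool 0)
      (m : ℕ) (c : Fin n → ℕ) :
      φ.Pure → (∀ k, φ.FVarSign k.succ (τ k)) → MeetPreserving.{v} φ τ →
      (∀ k, if τ k then FC (c k) else FN (c k)) →
      Rule FN FC ⟨(Term.nu b φ).subst ψ, .cnom m⟩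
        (List.ofFn fun k =>
          [⟨((Term.nu b φ).handle false).subst (cnomTuple τ k (c k)), .cnom m⟩,
            if τ k then ⟨ψ k, .cnom (c k)⟩ else ⟨.nom (c k), ψ k⟩])

/-- Finite joins and meets of terms; the empty ones are `⊥` and `⊤`. -/
def bigOr : List (Term Bool 0) → Term Bool 0
  | [] => .bot
  | [a] => a
  | a :: b :: l => .or a (bigOr (b :: l))

def bigAnd : List (Term Bool 0) → Term Bool 0
  | [] => .top
  | [a] => a
  | a :: b :: l => .and a (bigAnd (b :: l))

def Ineq.substVar (p : ℕ) (α : Term Bool 0) (I : Ineq Bool) : Ineq Bool :=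
  ⟨Term.substVar p α I.lhs, Term.substVar p α I.rhs⟩

/-- Application of a rule to a quasi-inequality, which is replaced by a list of quasi-inequalities.
In the Ackermann rules `αs` bound the variable `p`, `Bs` are the other inequalities
containing `p`, and `rest` are inequalities without `p`, which the rule does not touch. -/
inductive QRule : QIneq → List QIneq → Prop
  | single (l₁ l₂ : List (Ineq Bool)) (I : Ineq Bool) (i m : ℕ) (D : List (List (Ineq Bool))) :
      Rule.{v} (QIneq.FreshNom ⟨l₁ ++ I :: l₂, i, m⟩) (QIneq.FreshCnom ⟨l₁ ++ I :: l₂, i, m⟩) I D →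
      QRule ⟨l₁ ++ I :: l₂, i, m⟩ (D.map fun Is => ⟨l₁ ++ Is ++ l₂, i, m⟩)
  | rightAckermann (p : ℕ) (αs : List (Term Bool 0)) (Bs rest ants : List (Ineq Bool)) (i m : ℕ) :
      ants.Perm (αs.map (fun α => ⟨α, .var p⟩) ++ Bs ++ rest) →
      (∀ α ∈ αs, α.VarFree p ∧ α.SynClosed) →
      (∀ I ∈ Bs, I.lhs.VarSign p true ∧ I.lhs.SynClosed ∧ I.rhs.VarSign p false ∧ I.rhs.SynOpen) →
      (∀ I ∈ rest, I.lhs.VarFree p ∧ I.rhs.VarFree p) →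
      QRule ⟨ants, i, m⟩ [⟨Bs.map (Ineq.substVar p (bigOr αs)) ++ rest, i, m⟩]
  | leftAckermann (p : ℕ) (αs : List (Term Bool 0)) (Bs rest ants : List (Ineq Bool)) (i m : ℕ) :
      ants.Perm (αs.map (fun α => ⟨.var p, α⟩) ++ Bs ++ rest) →
      (∀ α ∈ αs, α.VarFree p ∧ α.SynOpen) →
      (∀ I ∈ Bs, I.lhs.VarSign p false ∧ I.lhs.SynClosed ∧ I.rhs.VarSign p true ∧ I.rhs.SynOpen) →
      (∀ I ∈ rest, I.lhs.VarFree p ∧ I.rhs.VarFree p) →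
      QRule ⟨ants, i, m⟩ [⟨Bs.map (Ineq.substVar p (bigAnd αs)) ++ rest, i, m⟩]

/-- One step of the algorithm on the current list of quasi-inequalities. -/
inductive Step : List QIneq → List QIneq → Prop
  | mk (l₁ l₂ : List QIneq) {Q : QIneq} {Qs : List QIneq} :
      QRule.{v} Q Qs → Step (l₁ ++ Q :: l₂) (l₁ ++ Qs ++ l₂)

/-- `Run φ ψ Qs`: some run on `φ ≤ ψ` (preprocessing, starring and first approximation, then any
finite number of rule applications) produces the quasi-inequalities `Qs`. -/
def Run (φ ψ : Term Unit 0) (Qs : List QIneq) : Prop :=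
  ∃ (Is : List (Ineq Unit)) (i m : ℕ),
    Relation.ReflTransGen PreStep [⟨φ, ψ⟩] Is ∧
      Relation.ReflTransGen Step.{v} (Is.map (firstApprox i m)) Qs

/-- All propositional variables have been eliminated. -/
def Purified (Qs : List QIneq) : Prop :=
  ∀ Q ∈ Qs, ∀ I ∈ Q.ants, I.lhs.Pure ∧ I.rhs.Pure

/-- All occurrences of binders have been handled by fixed point approximation rules. -/
def BindersHandled (Qs : List QIneq) : Prop :=
  ∀ Q ∈ Qs, ∀ I ∈ Q.ants, I.lhs.AllHandled ∧ I.rhs.AllHandled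

/-- A proper run of the algorithm succeeds on `φ ≤ ψ`. -/
def ProperRunSucceeds (φ ψ : Term Unit 0) : Prop :=
  ∃ Qs : List QIneq, Run.{v} φ ψ Qs ∧ Purified Qs ∧ BindersHandled Qs

end MuCanon

universe w

namespace MuCanon

/-! ### Canonical extensions of bi-Heyting algebras -/

section CanExt

variable {A : Type u} [BiheytingAlgebra A] {C : Type v} [CompleteLattice C]

/-! The argument compares two readings of terms in the canonical extension `C`, both given by
`evalIn K`. With `K = Set.univ` binders are ordinary fixed points of `C`. With `K = Set.range e` a
binder sees only those pre- or post-fixed points that come from the algebra `A`. `ValidIn K`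
likewise lets propositional variables range over `K`. The hypothesis amounts to validity for
`Set.range e`, the goal to validity for `Set.univ`.

Entry: in a mu-algebra of the second kind the transfinite iterates stabilise for reasons of size, so
a fixed point is an actual minimum of the pre-fixed points, or maximum of the post-fixed points.
Unlike arbitrary meets and joins, minima and maxima survive the embedding, so values in `A` agree
with restricted values in `C` (`IsCanonicalExtension.val`).

Down the run, restricted validity passes from premise to conclusions (`QRule.validIn_range`). For
this the new inequalities only have to imply the old one, which for the approximation rules is mere
monotonicity (`Rule.holds`). The work lies in the Ackermann rules: the minimal value of `p` is only
a closed element (dually, the maximal value is only an open one), while `p` must take a value in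
`A`. Closed and open terms commute with suitable directed limits (`evalIn_lim`), and compactness
then yields an admissible value in `A`. Restricted fixed points fit in because they are meets or
joins over elements of `A` (`ClosedLim.mu`).

At the end of a proper run there are no propositional variables, and every binder carries a handled
label, which by the invariant `Good` fixes its sign. Passing from ordinary to restricted fixed
points then shrinks left-hand sides and enlarges right-hand sides (`eval_le_evalIn`), so ordinary
antecedents imply restricted ones and restricted validity implies ordinary validity.

Up the run, ordinary validity passes from conclusions to premise (`QRule.validIn_univ`). Now the
Ackermann rules are mere monotonicity, and the approximation rules carry the weight: fresh nominals
must be found (`Rule.exists_holds`). They exist because `C` is perfect with prime irreducibles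
(`CanExt.exists_prime`) and, for fixed points, because complete join preservation of the body passes
to its least fixed point (`exists_singleTuple`). -/

def IsClosedElt (e : BoundedLatticeHom A C) (c : C) : Prop := ∃ S : Set A, c = sInf (e '' S)

def IsOpenElt (e : BoundedLatticeHom A C) (c : C) : Prop := ∃ S : Set A, c = sSup (e '' S)

/-- Density and compactness, in a form that only mentions the bi-Heyting algebra. -/
structure CanExt (e : BoundedLatticeHom A C) : Prop where
  le_iff : ∀ a b, e a ≤ e b ↔ a ≤ b
  closed_dense : ∀ c d, (∀ k, IsClosedElt e k → k ≤ c → k ≤ d) → c ≤ d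
  open_dense : ∀ c d, (∀ o, IsOpenElt e o → d ≤ o → c ≤ o) → c ≤ d
  compact : ∀ S T : Set A, sInf (e '' S) ≤ sSup (e '' T) →
    ∃ S' T' : Finset A, ↑S' ⊆ S ∧ ↑T' ⊆ T ∧ S'.inf id ≤ T'.sup id

/-- The conditions come in dual pairs, and closed elements of `e.dual` are by definition open
elements of `e`. Results on joins, open elements and diamonds are obtained below by applying those
on meets, closed elements and boxes to `e.dual`. -/
theorem CanExt.dual {e : BoundedLatticeHom A C} (h : CanExt e) : CanExt (e.dual) where
  le_iff a b := h.le_iff b a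
  closed_dense c d H := h.open_dense d c H
  open_dense c d H := h.closed_dense d c H
  compact S T H := by
    obtain ⟨S', T', h1, h2, h3⟩ := h.compact T S H
    exact ⟨T', S', h2, h1, h3⟩

/-! ### Closed and open elements, and forms of compactness. -/

section Basic

variable {e : BoundedLatticeHom A C}

theorem isClosedElt_map (e : BoundedLatticeHom A C) (a : A) : IsClosedElt e (e a) :=
  ⟨{a}, by simp⟩

theorem isOpenElt_map (e : BoundedLatticeHom A C) (a : A) : IsOpenElt e (e a) :=
  ⟨{a}, by simp⟩

theorem isClosedElt_sInf (e : BoundedLatticeHom A C) (S : Set A) : IsClosedElt e (sInf (e '' S)) :=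
  ⟨S, rfl⟩

theorem IsClosedElt.eq_sInf {k : C} (hk : IsClosedElt e k) : k = sInf (e '' {a | k ≤ e a}) := by
  apply le_antisymm
  · apply le_sInf
    rintro _ ⟨a, ha, rfl⟩
    exact ha
  · obtain ⟨S, rfl⟩ := hk
    apply sInf_le_sInf
    rintro _ ⟨a, ha, rfl⟩
    exact ⟨a, sInf_le ⟨a, ha, rfl⟩, rfl⟩

theorem IsOpenElt.eq_sSup {o : C} (ho : IsOpenElt e o) : o = sSup (e '' {a | e a ≤ o}) :=
  IsClosedElt.eq_sInf (e := e.dual) (C := Cᵒᵈ) ho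

theorem map_finset_inf_ge {x : C} (S : Finset A) (h : ∀ a ∈ S, x ≤ e a) : x ≤ e (S.inf id) := by
  rw [map_finset_inf]
  exact Finset.le_inf h

theorem map_finset_sup_le {x : C} (S : Finset A) (h : ∀ a ∈ S, e a ≤ x) : e (S.sup id) ≤ x := by
  rw [map_finset_sup]
  exact Finset.sup_le h

variable (he : CanExt e)
include he

theorem CanExt.mono {a b : A} (h : a ≤ b) : e a ≤ e b := (he.le_iff a b).2 h

/-- Compactness for a meet of elements of `A` below an open element. -/
theorem CanExt.compact_sInf {S : Set A} {o : C} (ho : IsOpenElt e o) (h : sInf (e '' S) ≤ o) :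
    ∃ S' : Finset A, ↑S' ⊆ S ∧ e (S'.inf id) ≤ o := by
  obtain ⟨T, rfl⟩ := ho
  obtain ⟨S', T', h1, h2, h3⟩ := he.compact S T h
  refine ⟨S', h1, (he.mono h3).trans (map_finset_sup_le T' fun a ha => le_sSup ⟨a, h2 ha, rfl⟩)⟩

/-- Compactness for the meet of a filter. -/
theorem CanExt.compact_filter {G : Set A} {o : C} (ho : IsOpenElt e o) (htop : ⊤ ∈ G)
    (hinf : ∀ a ∈ G, ∀ b ∈ G, a ⊓ b ∈ G) (h : sInf (e '' G) ≤ o) : ∃ a ∈ G, e a ≤ o := by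
  obtain ⟨S', h1, h2⟩ := he.compact_sInf ho h
  refine ⟨_, ?_, h2⟩
  exact Finset.inf_mem G htop hinf S' id fun i hi => h1 hi

/-- Compactness for the join of an ideal. -/
theorem CanExt.compact_ideal {G : Set A} {k : C} (hk : IsClosedElt e k) (hbot : ⊥ ∈ G)
    (hsup : ∀ a ∈ G, ∀ b ∈ G, a ⊔ b ∈ G) (h : k ≤ sSup (e '' G)) : ∃ a ∈ G, k ≤ e a :=
  he.dual.compact_filter (G := G) (o := k) hk hbot hsup h

theorem CanExt.interpolate {k o : C} (hk : IsClosedElt e k) (ho : IsOpenElt e o) (h : k ≤ o) :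
    ∃ a, k ≤ e a ∧ e a ≤ o := by
  rw [hk.eq_sInf] at h
  exact he.compact_filter (G := {a | k ≤ e a}) ho (show k ≤ e ⊤ by simp) (fun a ha b hb => by
    change k ≤ e (a ⊓ b)
    rw [map_inf]; exact le_inf ha hb) h

/-- The elements of `A` above some `a ⊓ b` with `x ≤ e a` and `y ≤ e b` form a filter whose meet
lies below `x ⊓ y`; compactness finds a member of it below `o`. -/
theorem CanExt.inf_le_open {x y o : C} (hx : IsClosedElt e x) (hy : IsClosedElt e y)
    (ho : IsOpenElt e o) (h : x ⊓ y ≤ o) : ∃ a b, x ≤ e a ∧ y ≤ e b ∧ e (a ⊓ b) ≤ o := by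
  obtain ⟨c, ⟨a, b, ha, hb, hab⟩, hc⟩ :=
    he.compact_filter (G := {c | ∃ a b, x ≤ e a ∧ y ≤ e b ∧ a ⊓ b ≤ c}) ho
      ⟨⊤, ⊤, by simp, by simp, le_top⟩
      (by
        rintro c ⟨a, b, ha, hb, hc⟩ c' ⟨a', b', ha', hb', hc'⟩
        refine ⟨a ⊓ a', b ⊓ b', ?_, ?_, ?_⟩
        · rw [map_inf]; exact le_inf ha ha'
        · rw [map_inf]; exact le_inf hb hb'
        · exact le_inf ((inf_le_inf inf_le_left inf_le_left).trans hc)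
            ((inf_le_inf inf_le_right inf_le_right).trans hc'))
      (by
        refine le_trans (le_inf ?_ ?_) h
        · refine le_of_le_of_eq (sInf_le_sInf ?_) hx.eq_sInf.symm
          rintro _ ⟨a, ha, rfl⟩
          exact ⟨a, ⟨a, ⊤, ha, by simp, by simp⟩, rfl⟩
        · refine le_of_le_of_eq (sInf_le_sInf ?_) hy.eq_sInf.symm
          rintro _ ⟨a, ha, rfl⟩
          exact ⟨a, ⟨⊤, a, by simp, ha, by simp⟩, rfl⟩)
  exact ⟨a, b, ha, hb, (he.mono hab).trans hc⟩

theorem CanExt.closed_le_sup {x y k : C} (hx : IsOpenElt e x) (hy : IsOpenElt e y)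
    (hk : IsClosedElt e k) (h : k ≤ x ⊔ y) : ∃ a b, e a ≤ x ∧ e b ≤ y ∧ k ≤ e (a ⊔ b) :=
  he.dual.inf_le_open (x := x) (y := y) (o := k) hx hy hk h

end Basic

/-! ### Primes -/

def IsJoinPrime (j : C) : Prop := ∀ X : Set C, j ≤ sSup X → ∃ x ∈ X, j ≤ x

def IsMeetPrime (m : C) : Prop := ∀ X : Set C, sInf X ≤ m → ∃ x ∈ X, x ≤ m

section Primes

variable {e : BoundedLatticeHom A C} (he : CanExt e)
include he

/-- As `k ≰ o`, the filter of elements above `k` is disjoint from the ideal of elements below `o`. A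
prime ideal `J` separates them, and `j` is the meet of the complement of `J`. If `j` is below no
member of `X`, each member lies below an open `w` with `j ≰ w`; elements of `A` below `w` belong to
`J`, so `sSup X` is below the join of `J`. By compactness, `j` below that join would put some
element outside `J` below one inside. -/
theorem CanExt.exists_prime {k o : C} (hk : IsClosedElt e k) (ho : IsOpenElt e o) (h : ¬ k ≤ o) :
    ∃ j, IsJoinPrime j ∧ j ≤ k ∧ ¬ j ≤ o := by
  let F : Order.PFilter A := Order.IsPFilter.toPFilter (F := {a | k ≤ e a})
    (.of_def ⟨⊤, by simp⟩
      (fun a ha b hb => ⟨a ⊓ b, by change k ≤ e (a ⊓ b); rw [map_inf]; exact le_inf ha hb,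
        inf_le_left, inf_le_right⟩)
      (fun {a b} hab ha => le_trans ha (he.mono hab)))
  let I : Order.Ideal A := Order.IsIdeal.toIdeal (I := {a | e a ≤ o})
    ⟨fun a b hab ha => le_trans (he.mono hab) ha, ⟨⊥, by simp⟩,
      (fun a ha b hb => ⟨a ⊔ b, by change e (a ⊔ b) ≤ o; rw [map_sup]; exact sup_le ha hb,
        le_sup_left, le_sup_right⟩)⟩
  have hFI : Disjoint (F : Set A) (I : Set A) := by
    rw [Set.disjoint_left]
    intro a (ha : k ≤ e a) (hb : e a ≤ o)
    exact h (ha.trans hb)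
  obtain ⟨J, hJ, hIJ, hFJ⟩ := DistribLattice.prime_ideal_of_disjoint_filter_ideal hFI
  have htop : (⊤ : A) ∈ ((J : Set A)ᶜ) := fun ht =>
    Set.disjoint_left.1 hFJ (show k ≤ e ⊤ by simp) ht
  have hinf : ∀ a ∈ ((J : Set A)ᶜ), ∀ b ∈ ((J : Set A)ᶜ), a ⊓ b ∈ ((J : Set A)ᶜ) :=
    fun a ha b hb hab => (hJ.mem_or_mem hab).elim ha hb
  refine ⟨sInf (e '' ((J : Set A)ᶜ)), ?_, ?_, ?_⟩
  · intro X hX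
    by_contra! hno
    have hx : ∀ x ∈ X, ∃ w, IsOpenElt e w ∧ x ≤ w ∧ ¬ sInf (e '' ((J : Set A)ᶜ)) ≤ w := by
      intro x hx
      by_contra! hcon
      exact hno x hx (he.open_dense _ _ hcon)
    have hle : sSup X ≤ sSup (e '' (J : Set A)) := by
      apply sSup_le
      intro x hxX
      obtain ⟨w, hw, hxw, hnw⟩ := hx x hxX
      refine hxw.trans ?_
      refine le_of_eq_of_le hw.eq_sSup (sSup_le_sSup ?_)
      rintro _ ⟨a, ha, rfl⟩
      refine ⟨a, ?_, rfl⟩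
      by_contra haJ
      exact hnw ((sInf_le (Set.mem_image_of_mem e haJ)).trans ha)
    obtain ⟨a, haJ, ha⟩ := he.compact_ideal (isClosedElt_sInf e _) J.bot_mem
      (fun a ha b hb => Order.Ideal.sup_mem ha hb) (hX.trans hle)
    obtain ⟨b, hb, hba⟩ := he.compact_filter (isOpenElt_map e a) htop hinf ha
    exact hb (J.lower ((he.le_iff _ _).1 hba) haJ)
  · refine le_of_le_of_eq (sInf_le_sInf ?_) hk.eq_sInf.symm
    rintro _ ⟨a, ha, rfl⟩
    exact ⟨a, fun haJ => Set.disjoint_left.1 hFJ (show k ≤ e a from ha) haJ, rfl⟩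
  · intro hle
    obtain ⟨a, ha, hao⟩ := he.compact_filter ho htop hinf hle
    exact ha (hIJ (show e a ≤ o from hao))

theorem CanExt.joinPrime_dense (c d : C) (h : ∀ j, IsJoinPrime j → j ≤ c → j ≤ d) : c ≤ d := by
  refine he.closed_dense _ _ fun k hk hkc => he.open_dense _ _ fun o ho hdo => ?_
  by_contra hko
  obtain ⟨j, hj, hjk, hjo⟩ := he.exists_prime hk ho hko
  exact hjo ((h j hj (hjk.trans hkc)).trans hdo)

end Primes

end CanExt

/-! ### Complete lattices with a dense set of completely prime elements -/

section Prime

variable {C : Type v} [CompleteLattice C]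

/-- The completely join-prime elements are join-dense. -/
def JoinPrimeDense (C : Type v) [CompleteLattice C] : Prop :=
  ∀ c d : C, (∀ j, IsJoinPrime j → j ≤ c → j ≤ d) → c ≤ d

theorem IsJoinPrime.irreducible {j : C} (h : IsJoinPrime j) : IsCompletelyJoinIrreducible j := by
  intro X hX
  obtain ⟨x, hx, hjx⟩ := h X hX.le
  rwa [le_antisymm hjx (hX ▸ le_sSup hx)]

/-- By density `j` is the join of the primes below it, so irreducibility makes it one of them. -/
theorem IsCompletelyJoinIrreducible.joinPrime (hC : JoinPrimeDense C) {j : C}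
    (h : IsCompletelyJoinIrreducible j) : IsJoinPrime j := by
  have : j ∈ {i | IsJoinPrime i ∧ i ≤ j} := h _ (le_antisymm
    (hC _ _ fun i hi hij => le_sSup ⟨hi, hij⟩) (sSup_le fun i hi => hi.2))
  exact this.1

theorem JoinPrimeDense.eq_sSup (hC : JoinPrimeDense C) (c : C) :
    c = sSup {j | IsCompletelyJoinIrreducible j ∧ j ≤ c} :=
  le_antisymm (hC _ _ fun _ hi hij => le_sSup ⟨hi.irreducible, hij⟩) (sSup_le fun _ hi => hi.2)

/-- A prime below the left side lies, for each `i`, below some `f i k`; these choices form the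
function `g`. -/
theorem JoinPrimeDense.iInf_iSup (hC : JoinPrimeDense C) {ι : Type v} {κ : ι → Type v}
    (f : ∀ i, κ i → C) : ⨅ i, ⨆ k, f i k = ⨆ g : ∀ i, κ i, ⨅ i, f i (g i) := by
  apply le_antisymm
  · refine hC _ _ fun j hj hle => ?_
    have : ∀ i, ∃ k, j ≤ f i k := by
      intro i
      obtain ⟨_, ⟨k, rfl⟩, hk⟩ := hj (Set.range (f i)) (hle.trans (iInf_le _ i))
      exact ⟨k, hk⟩
    choose g hg using this
    exact (le_iInf hg).trans (le_iSup (fun g : ∀ i, κ i => ⨅ i, f i (g i)) g)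
  · exact iSup_le fun g => le_iInf fun i => (iInf_le _ i).trans (le_iSup (f i) (g i))

/-- Testing on primes replaces infinite distributivity: a prime below the join is already below one
of its members. -/
theorem JoinPrimeDense.le_imp_iff (hC : JoinPrimeDense C) (x y z : C) :
    z ≤ sSup {c | c ⊓ x ≤ y} ↔ z ⊓ x ≤ y := by
  refine ⟨fun h => hC _ _ fun j hj hle => ?_, fun h => le_sSup h⟩
  obtain ⟨c, hc, hjc⟩ := hj _ ((hle.trans inf_le_left).trans h)
  exact (le_inf hjc (hle.trans inf_le_right)).trans hc

theorem JoinPrimeDense.sub_le_iff (hC : JoinPrimeDense Cᵒᵈ) (x y z : C) :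
    sInf {c | x ≤ y ⊔ c} ≤ z ↔ x ≤ y ⊔ z := by
  have h := hC.le_imp_iff y x z
  have h1 : sInf {c | x ≤ y ⊔ c} = sInf {c | x ≤ c ⊔ y} := by simp only [sup_comm]
  rw [h1, sup_comm]
  exact h

end Prime

section CanExt

variable {A : Type u} [BiheytingAlgebra A] {C : Type v} [CompleteLattice C]

/-! ### Extensions of boxes -/

/-- `F` extends the box operator `f` and has a left adjoint, computed on closed elements. The
same condition for `e.dual` describes the extensions of diamonds. -/
structure IsBoxExt (e : BoundedLatticeHom A C) (f : A → A) (F : C → C) : Prop where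
  f_top : f ⊤ = ⊤
  f_inf : ∀ a b, f (a ⊓ b) = f a ⊓ f b
  closed_le_iff : ∀ k, IsClosedElt e k → ∀ c, k ≤ F c ↔ sInf (e '' {a | k ≤ e (f a)}) ≤ c

/-- The extension of `f` determined by its values on intervals with closed lower and open upper
bound. -/
def piMap (e : BoundedLatticeHom A C) (f : A → A) (c : C) : C :=
  sInf {x | ∃ k, IsClosedElt e k ∧ ∃ w, IsOpenElt e w ∧ k ≤ c ∧ c ≤ w ∧
    x = sSup ((fun a => e (f a)) '' {a | k ≤ e a ∧ e a ≤ w})}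

theorem IsBoxExt.map_mono {e : BoundedLatticeHom A C} {f : A → A} {F : C → C}
    (hF : IsBoxExt e f F) {a b : A} (hab : a ≤ b) : f a ≤ f b := by
  rw [← inf_eq_left.2 hab, hF.f_inf]
  exact inf_le_right

section Box

variable {e : BoundedLatticeHom A C} (he : CanExt e)
include he

/-- Both directions are compactness: the elements of `A` whose box lies above `k` form a filter, and
any open element above its meet contains one of them. -/
theorem CanExt.isBoxExt_piMap {f : A → A} (htop : f ⊤ = ⊤)
    (hinf : ∀ a b, f (a ⊓ b) = f a ⊓ f b) : IsBoxExt e f (piMap e f) := by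
  have hmono : ∀ {a b}, a ≤ b → f a ≤ f b := by
    intro a b hab
    rw [← inf_eq_left.2 hab, hinf]
    exact inf_le_right
  refine ⟨htop, hinf, fun k hk c => ⟨fun h => ?_, fun h => ?_⟩⟩
  · refine he.open_dense _ _ fun o ho hco => ?_
    have h1 : k ≤ sSup (e '' {b | ∃ a, e a ≤ o ∧ b ≤ f a}) := by
      -- The interval used in the infimum goes from `⊥`, which is closed as the meet of all of `A`,
      -- to `o`.
      refine h.trans (le_trans (sInf_le ⟨⊥, ⟨Set.univ, ?_⟩, o, ho, bot_le, hco, rfl⟩) ?_)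
      · exact le_antisymm bot_le (sInf_le ⟨⊥, trivial, by simp⟩)
      · apply sSup_le
        rintro _ ⟨a, ha, rfl⟩
        exact le_sSup ⟨f a, ⟨a, ha.2, le_rfl⟩, rfl⟩
    obtain ⟨b, ⟨a, hao, hba⟩, hkb⟩ := he.compact_ideal
      (G := {b | ∃ a, e a ≤ o ∧ b ≤ f a}) hk ⟨⊥, by simp, bot_le⟩
      (by
        rintro b ⟨a, ha, hb⟩ b' ⟨a', ha', hb'⟩
        refine ⟨a ⊔ a', ?_, sup_le (hb.trans (hmono le_sup_left)) (hb'.trans (hmono le_sup_right))⟩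
        rw [map_sup]
        exact sup_le ha ha') h1
    exact le_trans (sInf_le ⟨a, hkb.trans (he.mono hba), rfl⟩) hao
  · apply le_sInf
    rintro _ ⟨k', hk', o, ho, hkc, hco, rfl⟩
    obtain ⟨a, ha, hao⟩ := he.compact_filter (G := {a | k ≤ e (f a)}) ho
      (show k ≤ e (f ⊤) by simp [htop])
      (fun a ha b hb => show k ≤ e (f (a ⊓ b)) by
        rw [hinf, map_inf]; exact le_inf ha hb) (h.trans hco)
    -- The witness `a` lies below `o` but perhaps not above `k'`; joining it with an interpolant
    -- `a'` puts it into the interval and only enlarges its box.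
    obtain ⟨a', hka', hao'⟩ := he.interpolate hk' ho (hkc.trans hco)
    refine le_trans ?_ (le_sSup ⟨a ⊔ a', ⟨hka'.trans (he.mono le_sup_right), ?_⟩, rfl⟩)
    · exact ha.trans (he.mono (hmono le_sup_left))
    · rw [map_sup]; exact sup_le hao hao'

variable {f : A → A} {F : C → C} (hF : IsBoxExt e f F)
include hF

theorem IsBoxExt.map_sInf (S : Set C) : F (sInf S) = sInf (F '' S) := by
  apply le_antisymm
  · refine he.closed_dense _ _ fun k hk hle => le_sInf ?_
    rintro _ ⟨c, hc, rfl⟩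
    exact (hF.closed_le_iff k hk _).2 (((hF.closed_le_iff k hk _).1 hle).trans (sInf_le hc))
  · refine he.closed_dense _ _ fun k hk hle => (hF.closed_le_iff k hk _).2 (le_sInf fun c hc => ?_)
    exact (hF.closed_le_iff k hk _).1 (hle.trans (sInf_le ⟨c, hc, rfl⟩))

theorem IsBoxExt.mono : Monotone F := by
  intro x y hxy
  have h := hF.map_sInf he {x, y}
  rw [sInf_pair, inf_eq_left.2 hxy, Set.image_pair, sInf_pair] at h
  exact h ▸ inf_le_right

theorem IsBoxExt.bdia_le_iff (x y : C) : sInf {c | x ≤ F c} ≤ y ↔ x ≤ F y := by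
  refine ⟨fun h => le_trans ?_ (hF.mono he h), fun h => sInf_le h⟩
  rw [hF.map_sInf he]
  apply le_sInf
  rintro _ ⟨c, hc, rfl⟩
  exact hc

theorem IsBoxExt.closed_le_open {k o : C} (hk : IsClosedElt e k) (ho : IsOpenElt e o)
    (h : k ≤ F o) : ∃ a, k ≤ e (f a) ∧ e a ≤ o :=
  he.compact_filter (G := {a | k ≤ e (f a)}) ho
    (show k ≤ e (f ⊤) by simp [hF.f_top])
    (fun a ha b hb => show k ≤ e (f (a ⊓ b)) by
      rw [hF.f_inf, map_inf]; exact le_inf ha hb) ((hF.closed_le_iff k hk _).1 h)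

theorem IsBoxExt.map_apply (a : A) : F (e a) = e (f a) := by
  apply le_antisymm
  · refine he.closed_dense _ _ fun k hk hle => ?_
    obtain ⟨b, hkb, hba⟩ := hF.closed_le_open he hk (isOpenElt_map e a) hle
    exact hkb.trans (he.mono (hF.map_mono ((he.le_iff _ _).1 hba)))
  · exact (hF.closed_le_iff _ (isClosedElt_map e _) _).2 (sInf_le ⟨a, le_rfl, rfl⟩)

end Box

/-! ### Residuals of elements of `A` -/

section Residual

variable {e : BoundedLatticeHom A C} (he : CanExt e)
include he

/-- A closed `k` with `k ⊓ e a ≤ e b` can by compactness be enlarged to some `e c` with `c ⊓ a ≤ b`,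
so that `c ≤ a ⇨ b`. Taking the residual as any `I` with the adjunction property makes subtraction
the dual case, with its arguments swapped. -/
theorem CanExt.map_himp {I : C → C → C} (hI : ∀ x y z, z ≤ I x y ↔ z ⊓ x ≤ y) (a b : A) :
    e (a ⇨ b) = I (e a) (e b) := by
  apply le_antisymm
  · rw [hI, ← map_inf]
    exact he.mono himp_inf_le
  · refine he.closed_dense _ _ fun k hk hle => ?_
    obtain ⟨c, d, hc, hd, hcd⟩ := he.inf_le_open hk (isClosedElt_map e a) (isOpenElt_map e b)
      ((hI _ _ _).1 hle)
    refine hc.trans (he.mono (le_himp_iff.2 ?_))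
    exact (inf_le_inf_left c ((he.le_iff _ _).1 hd)).trans ((he.le_iff _ _).1 hcd)

theorem CanExt.map_sdiff {I : C → C → C} (hI : ∀ x y z, I x y ≤ z ↔ x ≤ y ⊔ z) (a b : A) :
    e (a \ b) = I (e a) (e b) :=
  he.dual.map_himp (I := fun x y => I y x)
    (fun x y z => (hI y x z).trans (Iff.of_eq (congrArg (@LE.le C _ y) (sup_comm (α := C) x z)))) b a

end Residual

/-! ### Limits of directed families with closed or open limit -/

section Limit

variable {D : Type w} [Preorder D]

/-- The antitone family `f` converges to the closed element `x`. -/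
structure ClosedLim (e : BoundedLatticeHom A C) (x : C) (f : D → C) : Prop where
  le : ∀ d, x ≤ f d
  anti : ∀ d d', d ≤ d' → f d' ≤ f d
  approx : ∀ o, IsOpenElt e o → x ≤ o → ∃ d a, f d ≤ e a ∧ e a ≤ o

/-- The monotone family `f` converges to the open element `x`. -/
structure OpenLim (e : BoundedLatticeHom A C) (x : C) (f : D → C) : Prop where
  le : ∀ d, f d ≤ x
  mono : ∀ d d', d ≤ d' → f d ≤ f d'
  approx : ∀ k, IsClosedElt e k → k ≤ x → ∃ d a, e a ≤ f d ∧ k ≤ e a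

variable {e : BoundedLatticeHom A C} {x y : C} {f g : D → C}

theorem OpenLim.dual (h : OpenLim e x f) : ClosedLim (C := Cᵒᵈ) e.dual x f :=
  ⟨h.le, h.mono, h.approx⟩

theorem ClosedLim.dual (h : ClosedLim e x f) : OpenLim (C := Cᵒᵈ) e.dual x f :=
  ⟨h.le, h.anti, h.approx⟩

theorem ClosedLim.of_dual (h : ClosedLim (C := Cᵒᵈ) e.dual x f) : OpenLim e x f :=
  ⟨h.le, h.anti, h.approx⟩

theorem ClosedLim.const [Nonempty D] (he : CanExt e) (hx : IsClosedElt e x) :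
    ClosedLim e x (fun _ : D => x) :=
  ⟨fun _ => le_rfl, fun _ _ _ => le_rfl, fun _ ho h =>
    ⟨Classical.arbitrary D, he.interpolate hx ho h⟩⟩

theorem OpenLim.const [Nonempty D] (he : CanExt e) (hx : IsOpenElt e x) :
    OpenLim e x (fun _ : D => x) :=
  (ClosedLim.const (C := Cᵒᵈ) he.dual hx).of_dual

/-- The element of `A` interposed in `approx` between `f d` and `o` is what exhibits `x` as a meet
of elements of `A`; the members `f d` themselves need not be closed. -/
theorem ClosedLim.isClosedElt (he : CanExt e) (h : ClosedLim e x f) : IsClosedElt e x := by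
  refine ⟨{a | x ≤ e a}, le_antisymm (le_sInf ?_) (he.open_dense _ _ fun o ho hxo => ?_)⟩
  · rintro _ ⟨a, ha, rfl⟩
    exact ha
  · obtain ⟨d, a, hda, hao⟩ := h.approx o ho hxo
    exact le_trans (sInf_le ⟨a, (h.le d).trans hda, rfl⟩) hao

theorem OpenLim.isOpenElt (he : CanExt e) (h : OpenLim e x f) : IsOpenElt e x :=
  h.dual.isClosedElt he.dual

theorem ClosedLim.exists_le_map (hf : ClosedLim e x f) {a : A} (h : x ≤ e a) :
    ∃ d, f d ≤ e a := by
  obtain ⟨d, b, hd, hb⟩ := hf.approx _ (isOpenElt_map e a) h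
  exact ⟨d, hd.trans hb⟩

theorem OpenLim.exists_map_le (hf : OpenLim e x f) {a : A} (h : e a ≤ x) :
    ∃ d, e a ≤ f d :=
  hf.dual.exists_le_map h

/-- Since `B` preserves meets, `B x` is a meet of elements `e (b a)` with `x ≤ e a`. Compactness
selects one such `a`, and some `f d` is already below `e a`. -/
theorem ClosedLim.box (he : CanExt e) {b : A → A} {B : C → C} (hB : IsBoxExt e b B)
    (hf : ClosedLim e x f) : ClosedLim e (B x) (fun d => B (f d)) := by
  refine ⟨fun d => hB.mono he (hf.le d), fun d d' h => hB.mono he (hf.anti _ _ h),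
    fun o ho h => ?_⟩
  have hle : sInf (e '' {c | ∃ a, x ≤ e a ∧ b a ≤ c}) ≤ B x := by
    refine le_of_le_of_eq ?_ (congrArg B (hf.isClosedElt he).eq_sInf.symm)
    rw [hB.map_sInf he]
    apply le_sInf
    rintro _ ⟨_, ⟨a, ha, rfl⟩, rfl⟩
    rw [hB.map_apply he]
    exact sInf_le ⟨_, ⟨a, ha, le_rfl⟩, rfl⟩
  obtain ⟨c, ⟨a, ha, hac⟩, hc⟩ := he.compact_filter
    (G := {c | ∃ a, x ≤ e a ∧ b a ≤ c}) ho ⟨⊤, by simp, le_top⟩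
    (by
      rintro c ⟨a, ha, hc⟩ c' ⟨a', ha', hc'⟩
      refine ⟨a ⊓ a', ?_, ?_⟩
      · rw [map_inf]; exact le_inf ha ha'
      · rw [hB.f_inf]; exact inf_le_inf hc hc') (hle.trans h)
  obtain ⟨d, hd⟩ := hf.exists_le_map ha
  refine ⟨d, b a, ?_, (he.mono hac).trans hc⟩
  rw [← hB.map_apply he]
  exact hB.mono he hd

theorem OpenLim.dia (he : CanExt e) {b : A → A} {B : C → C}
    (hB : IsBoxExt (A := Aᵒᵈ) (C := Cᵒᵈ) e.dual b B)
    (hf : OpenLim e x f) : OpenLim e (B x) (fun d => B (f d)) :=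
  (hf.dual.box he.dual hB).of_dual

/-- This is not dual to the closed case: here the adjunction on closed elements gives, from `k ≤ B
x` with `x` open, an element of `A` below `x` whose box is above `k`. -/
theorem OpenLim.box (he : CanExt e) {b : A → A} {B : C → C} (hB : IsBoxExt e b B)
    (hf : OpenLim e x f) : OpenLim e (B x) (fun d => B (f d)) := by
  refine ⟨fun d => hB.mono he (hf.le d), fun d d' h => hB.mono he (hf.mono _ _ h),
    fun k hk h => ?_⟩
  obtain ⟨a, hka, hax⟩ := hB.closed_le_open he hk (hf.isOpenElt he) h
  obtain ⟨d, hd⟩ := hf.exists_map_le hax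
  refine ⟨d, b a, ?_, hka⟩
  rw [← hB.map_apply he]
  exact hB.mono he hd

theorem ClosedLim.dia (he : CanExt e) {b : A → A} {B : C → C}
    (hB : IsBoxExt (A := Aᵒᵈ) (C := Cᵒᵈ) e.dual b B)
    (hf : ClosedLim e x f) : ClosedLim e (B x) (fun d => B (f d)) := by
  have h := OpenLim.box he.dual hB hf.dual
  exact ⟨h.le, h.mono, h.approx⟩

theorem ClosedLim.bdia (he : CanExt e) {b : A → A} {B : C → C} (hB : IsBoxExt e b B)
    (hf : ClosedLim e x f) :
    ClosedLim e (sInf {c | x ≤ B c}) (fun d => sInf {c | f d ≤ B c}) := by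
  refine ⟨fun d => sInf_le_sInf fun c hc => (hf.le d).trans hc,
    fun d d' h => sInf_le_sInf fun c hc => (hf.anti _ _ h).trans hc, fun o ho h => ?_⟩
  obtain ⟨a, hxa, hao⟩ := hB.closed_le_open he (hf.isClosedElt he) ho
    ((hB.bdia_le_iff he _ _).1 h)
  obtain ⟨d, hd⟩ := hf.exists_le_map hxa
  exact ⟨d, a, sInf_le (hd.trans (hB.map_apply he a).ge), hao⟩

theorem OpenLim.bbox (he : CanExt e) {b : A → A} {B : C → C}
    (hB : IsBoxExt (A := Aᵒᵈ) (C := Cᵒᵈ) e.dual b B) (hf : OpenLim e x f) :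
    OpenLim e (sSup {c | B c ≤ x}) (fun d => sSup {c | B c ≤ f d}) :=
  (hf.dual.bdia he.dual hB).of_dual

variable [IsDirectedOrder D]

theorem ClosedLim.sup (hf : ClosedLim e x f) (hg : ClosedLim e y g) :
    ClosedLim e (x ⊔ y) (fun d => f d ⊔ g d) := by
  refine ⟨fun d => sup_le_sup (hf.le d) (hg.le d),
    fun d d' h => sup_le_sup (hf.anti _ _ h) (hg.anti _ _ h), fun o ho h => ?_⟩
  obtain ⟨d₁, a₁, h₁, h₁'⟩ := hf.approx o ho (le_sup_left.trans h)
  obtain ⟨d₂, a₂, h₂, h₂'⟩ := hg.approx o ho (le_sup_right.trans h)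
  obtain ⟨d, hd₁, hd₂⟩ := exists_ge_ge d₁ d₂
  refine ⟨d, a₁ ⊔ a₂, ?_, ?_⟩
  · rw [map_sup]
    exact sup_le_sup ((hf.anti _ _ hd₁).trans h₁) ((hg.anti _ _ hd₂).trans h₂)
  · rw [map_sup]
    exact sup_le h₁' h₂'

theorem OpenLim.inf (hf : OpenLim e x f) (hg : OpenLim e y g) :
    OpenLim e (x ⊓ y) (fun d => f d ⊓ g d) :=
  (hf.dual.sup hg.dual).of_dual

theorem ClosedLim.inf (he : CanExt e) (hf : ClosedLim e x f) (hg : ClosedLim e y g) :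
    ClosedLim e (x ⊓ y) (fun d => f d ⊓ g d) := by
  refine ⟨fun d => inf_le_inf (hf.le d) (hg.le d),
    fun d d' h => inf_le_inf (hf.anti _ _ h) (hg.anti _ _ h), fun o ho h => ?_⟩
  obtain ⟨a, b, ha, hb, hab⟩ := he.inf_le_open (hf.isClosedElt he) (hg.isClosedElt he) ho h
  obtain ⟨d₁, h₁⟩ := hf.exists_le_map ha
  obtain ⟨d₂, h₂⟩ := hg.exists_le_map hb
  obtain ⟨d, hd₁, hd₂⟩ := exists_ge_ge d₁ d₂
  refine ⟨d, a ⊓ b, ?_, hab⟩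
  rw [map_inf]
  exact inf_le_inf ((hf.anti _ _ hd₁).trans h₁) ((hg.anti _ _ hd₂).trans h₂)

theorem OpenLim.sup (he : CanExt e) (hf : OpenLim e x f) (hg : OpenLim e y g) :
    OpenLim e (x ⊔ y) (fun d => f d ⊔ g d) :=
  (hf.dual.inf he.dual hg.dual).of_dual

/-- The elements above some `a ⇨ b`, with `a` below the open `x` and `b` above the closed `y`, form
a filter whose meet is at most `I x y`. Compactness reduces the limit to a single pair `a`, `b`,
which the two families pass at a common stage. -/
theorem ClosedLim.imp (he : CanExt e) {I : C → C → C} (hI : ∀ x y z, z ≤ I x y ↔ z ⊓ x ≤ y)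
    (hf : OpenLim e x f) (hg : ClosedLim e y g) :
    ClosedLim e (I x y) (fun d => I (f d) (g d)) := by
  have hmono : ∀ {x x' y y'}, x' ≤ x → y ≤ y' → I x y ≤ I x' y' := fun hx hy =>
    (hI _ _ _).2 ((inf_le_inf_left _ hx).trans (((hI _ _ _).1 le_rfl).trans hy))
  refine ⟨fun d => hmono (hf.le d) (hg.le d),
    fun d d' h => hmono (hf.mono _ _ h) (hg.anti _ _ h), fun o ho h => ?_⟩
  have hle : sInf (e '' {c | ∃ a b, e a ≤ x ∧ y ≤ e b ∧ a ⇨ b ≤ c}) ≤ I x y := by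
    -- Residuating twice leaves `x` alone on the left, where it can be expanded as a join.
    rw [hI, inf_comm, ← hI, (hf.isOpenElt he).eq_sSup]
    apply sSup_le
    rintro _ ⟨a, ha, rfl⟩
    rw [hI, (hg.isClosedElt he).eq_sInf]
    apply le_sInf
    rintro _ ⟨b, hb, rfl⟩
    have h1 : sInf (e '' {c | ∃ a b, e a ≤ x ∧ y ≤ e b ∧ a ⇨ b ≤ c}) ≤ e (a ⇨ b) :=
      sInf_le ⟨_, ⟨a, b, ha, hb, le_rfl⟩, rfl⟩
    rw [← (hf.isOpenElt he).eq_sSup, ← (hg.isClosedElt he).eq_sInf]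
    refine (inf_le_inf_left _ h1).trans ?_
    rw [← map_inf]
    exact he.mono inf_himp_le
  obtain ⟨c, ⟨a, b, ha, hb, hab⟩, hc⟩ := he.compact_filter
    (G := {c | ∃ a b, e a ≤ x ∧ y ≤ e b ∧ a ⇨ b ≤ c}) ho ⟨⊥, ⊤, by simp, by simp, by simp⟩
    (by
      rintro c ⟨a, b, ha, hb, hc⟩ c' ⟨a', b', ha', hb', hc'⟩
      refine ⟨a ⊔ a', b ⊓ b', ?_, ?_, ?_⟩
      · rw [map_sup]; exact sup_le ha ha'
      · rw [map_inf]; exact le_inf hb hb'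
      · exact le_inf ((himp_le_himp le_sup_left inf_le_left).trans hc)
          ((himp_le_himp le_sup_right inf_le_right).trans hc')) (hle.trans h)
  obtain ⟨d₁, h₁⟩ := hf.exists_map_le ha
  obtain ⟨d₂, h₂⟩ := hg.exists_le_map hb
  obtain ⟨d, hd₁, hd₂⟩ := exists_ge_ge d₁ d₂
  refine ⟨d, a ⇨ b, ?_, (he.mono hab).trans hc⟩
  rw [he.map_himp hI]
  exact hmono (h₁.trans (hf.mono _ _ hd₁)) ((hg.anti _ _ hd₂).trans h₂)

theorem OpenLim.sub (he : CanExt e) {I : C → C → C} (hI : ∀ x y z, I x y ≤ z ↔ x ≤ y ⊔ z)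
    (hf : OpenLim e x f) (hg : ClosedLim e y g) :
    OpenLim e (I x y) (fun d => I (f d) (g d)) :=
  (ClosedLim.imp he.dual (I := fun x y => I y x)
    (fun x y z => (hI y x z).trans (Iff.of_eq (congrArg (@LE.le C _ y) (sup_comm (α := C) x z)))) hg.dual hf.dual).of_dual

/-- By residuation `I x y ≤ o` means `x ≤ y ⊔ o`, and compactness splits this into an element of `A`
below `y` and one below `o`. -/
theorem ClosedLim.sub (he : CanExt e) {I : C → C → C} (hI : ∀ x y z, I x y ≤ z ↔ x ≤ y ⊔ z)
    (hf : ClosedLim e x f) (hg : OpenLim e y g) :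
    ClosedLim e (I x y) (fun d => I (f d) (g d)) := by
  have hmono : ∀ {x x' y y'}, x ≤ x' → y' ≤ y → I x y ≤ I x' y' := fun hx hy =>
    (hI _ _ _).2 (hx.trans (((hI _ _ _).1 le_rfl).trans (sup_le_sup_right hy _)))
  refine ⟨fun d => hmono (hf.le d) (hg.le d),
    fun d d' h => hmono (hf.anti _ _ h) (hg.mono _ _ h), fun o ho h => ?_⟩
  obtain ⟨a, b, ha, hb, hab⟩ := he.closed_le_sup (hg.isOpenElt he) ho (hf.isClosedElt he)
    ((hI _ _ _).1 h)
  obtain ⟨d₁, h₁⟩ := hf.exists_le_map hab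
  obtain ⟨d₂, h₂⟩ := hg.exists_map_le ha
  obtain ⟨d, hd₁, hd₂⟩ := exists_ge_ge d₁ d₂
  refine ⟨d, b, (hI _ _ _).2 ?_, hb⟩
  refine ((hf.anti _ _ hd₁).trans h₁).trans ?_
  rw [map_sup]
  exact sup_le_sup_right (h₂.trans (hg.mono _ _ hd₂)) _

theorem OpenLim.imp (he : CanExt e) {I : C → C → C} (hI : ∀ x y z, z ≤ I x y ↔ z ⊓ x ≤ y)
    (hf : ClosedLim e x f) (hg : OpenLim e y g) :
    OpenLim e (I x y) (fun d => I (f d) (g d)) :=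
  (ClosedLim.sub he.dual (I := fun x y => I y x)
    (fun x y z => (hI y x z).trans (Iff.of_eq (congrArg (fun w : C => w ≤ (x : C)) (inf_comm (α := C) z y)))) hg.dual hf.dual).of_dual

/-- This is the reason for restricting fixed points to `A`. By compactness only finitely many
pre-fixed points `e a` of the limit matter below `o`. Each satisfies `X (e a) ≤ e a`, hence `F d (e
a) ≤ e a` from some stage on, and directedness provides one stage for all. Nothing is needed about
`X` outside the range of `e`. -/
theorem ClosedLim.mu [Nonempty D] (he : CanExt e) {X : C → C} {F : D → C → C}
    (h : ∀ a, ClosedLim e (X (e a)) (fun d => F d (e a))) :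
    ClosedLim e (sInf {c | c ∈ Set.range e ∧ X c ≤ c})
      (fun d => sInf {c | c ∈ Set.range e ∧ F d c ≤ c}) := by
  refine ⟨fun d => sInf_le_sInf ?_, fun d d' hd => sInf_le_sInf ?_, fun o ho hle => ?_⟩
  · rintro _ ⟨⟨a, rfl⟩, ha⟩
    exact ⟨⟨a, rfl⟩, ((h a).le d).trans ha⟩
  · rintro _ ⟨⟨a, rfl⟩, ha⟩
    exact ⟨⟨a, rfl⟩, ((h a).anti _ _ hd).trans ha⟩
  · have hset : {c | c ∈ Set.range e ∧ X c ≤ c} = e '' {a | X (e a) ≤ e a} := by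
      ext c
      constructor
      · rintro ⟨⟨a, rfl⟩, ha⟩
        exact ⟨a, ha, rfl⟩
      · rintro ⟨a, ha, rfl⟩
        exact ⟨⟨a, rfl⟩, ha⟩
    rw [hset] at hle
    obtain ⟨S, hS, hSo⟩ := he.compact_sInf ho hle
    have : ∀ a : S, ∃ d, F d (e a) ≤ e a := fun a => (h a).exists_le_map (hS a.2)
    choose φ hφ using this
    classical
    obtain ⟨d, hd⟩ := Finset.exists_le (Finset.univ.image φ)
    -- The finite meet need not be a pre-fixed point itself; it suffices that the infimum at stage
    -- `d` is below each member of `S`.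
    refine ⟨d, S.inf id, map_finset_inf_ge S fun a ha => sInf_le ⟨⟨a, rfl⟩, ?_⟩, hSo⟩
    exact ((h a).anti _ _ (hd _ (Finset.mem_image_of_mem φ (Finset.mem_univ ⟨a, ha⟩)))).trans
      (hφ ⟨a, ha⟩)

theorem OpenLim.nu [Nonempty D] (he : CanExt e) {X : C → C} {F : D → C → C}
    (h : ∀ a, OpenLim e (X (e a)) (fun d => F d (e a))) :
    OpenLim e (sSup {c | c ∈ Set.range e ∧ c ≤ X c})
      (fun d => sSup {c | c ∈ Set.range e ∧ c ≤ F d c}) :=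
  (ClosedLim.mu he.dual (C := Cᵒᵈ) (X := X) (F := F) fun a => (h a).dual).of_dual

end Limit

end CanExt

/-! ### Interpretation with restricted fixed points -/

section EvalIn

variable {C : Type v} [CompleteLattice C] {β : Type}

/-- The interpretation of terms in which least and greatest fixed points are computed from the pre-
and post-fixed points in `K` only. -/
def evalIn (K : Set C) (box dia : C → C) (V : Assignment C) : {n : ℕ} → Term β n → (Fin n → C) → C
  | _, .bot, _ => ⊥
  | _, .top, _ => ⊤
  | _, .var p, _ => V.var p
  | _, .fvar i, env => env i
  | _, .nom j, _ => V.nom j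
  | _, .cnom m, _ => V.cnom m
  | _, .and s t, env => evalIn K box dia V s env ⊓ evalIn K box dia V t env
  | _, .or s t, env => evalIn K box dia V s env ⊔ evalIn K box dia V t env
  | _, .imp s t, env => sSup {c | c ⊓ evalIn K box dia V s env ≤ evalIn K box dia V t env}
  | _, .sub s t, env => sInf {c | evalIn K box dia V s env ≤ evalIn K box dia V t env ⊔ c}
  | _, .dia t, env => dia (evalIn K box dia V t env)
  | _, .box t, env => box (evalIn K box dia V t env)
  | _, .bdia t, env => sInf {c | evalIn K box dia V t env ≤ box c}
  | _, .bbox t, env => sSup {c | dia c ≤ evalIn K box dia V t env}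
  | _, .mu _ t, env => sInf {c | c ∈ K ∧ evalIn K box dia V t (extend c env) ≤ c}
  | _, .nu _ t, env => sSup {c | c ∈ K ∧ c ≤ evalIn K box dia V t (extend c env)}

variable {K : Set C} {box dia : C → C}

theorem evalIn_univ (V : Assignment C) {n : ℕ} (t : Term β n) (env : Fin n → C) :
    evalIn Set.univ box dia V t env = eval box dia V t env := by
  induction t <;> simp_all [evalIn, eval]

theorem imp_mono {x x' y y' : C} (hx : x' ≤ x) (hy : y ≤ y') :
    sSup {c | c ⊓ x ≤ y} ≤ sSup {c | c ⊓ x' ≤ y'} :=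
  sSup_le_sSup fun _ hc => (inf_le_inf_left _ hx).trans (le_trans hc hy)

theorem sub_mono {x x' y y' : C} (hx : x ≤ x') (hy : y' ≤ y) :
    sInf {c | x ≤ y ⊔ c} ≤ sInf {c | x' ≤ y' ⊔ c} :=
  sInf_le_sInf fun _ hc => hx.trans (le_trans hc (sup_le_sup_right hy _))

/-- The second assignment is above the first one on what occurs positively in `t` and below it on
what occurs negatively. -/
structure AssignmentLE {n : ℕ} (t : Term β n) (V V' : Assignment C) (env env' : Fin n → C) :
    Prop where
  var_le : ∀ p, ¬ t.VarSign p false → V.var p ≤ V'.var p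
  var_ge : ∀ p, ¬ t.VarSign p true → V'.var p ≤ V.var p
  env_le : ∀ i, ¬ t.FVarSign i false → env i ≤ env' i
  env_ge : ∀ i, ¬ t.FVarSign i true → env' i ≤ env i
  nom_eq : ∀ j, ¬ t.NomFree j → V.nom j = V'.nom j
  cnom_eq : ∀ m, ¬ t.CnomFree m → V.cnom m = V'.cnom m

theorem AssignmentLE.binder {n : ℕ} {t : Term β n} {s : Term β (n + 1)} {V V' : Assignment C}
    {env env' : Fin n → C} (h : AssignmentLE t V V' env env') (c : C)
    (h1 : ∀ p b, t.VarSign p b → s.VarSign p b) (h2 : ∀ i b, t.FVarSign i b → s.FVarSign i.succ b)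
    (h3 : ∀ j, t.NomFree j → s.NomFree j) (h4 : ∀ m, t.CnomFree m → s.CnomFree m) :
    AssignmentLE s V V' (extend c env) (extend c env') where
  var_le p hp := h.var_le p (mt (h1 _ _) hp)
  var_ge p hp := h.var_ge p (mt (h1 _ _) hp)
  env_le i := by
    refine Fin.cases (fun _ => le_rfl) (fun i hi => ?_) i
    exact h.env_le i (mt (h2 _ _) hi)
  env_ge i := by
    refine Fin.cases (fun _ => le_rfl) (fun i hi => ?_) i
    exact h.env_ge i (mt (h2 _ _) hi)
  nom_eq j hj := h.nom_eq j (mt (h3 _) hj)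
  cnom_eq j hj := h.cnom_eq j (mt (h4 _) hj)

theorem AssignmentLE.sub {n : ℕ} {t s : Term β n} {V V' : Assignment C}
    {env env' : Fin n → C} (h : AssignmentLE t V V' env env')
    (h1 : ∀ p b, t.VarSign p b → s.VarSign p b) (h2 : ∀ i b, t.FVarSign i b → s.FVarSign i b)
    (h3 : ∀ j, t.NomFree j → s.NomFree j) (h4 : ∀ m, t.CnomFree m → s.CnomFree m) :
    AssignmentLE s V V' env env' where
  var_le p hp := h.var_le p (mt (h1 _ _) hp)
  var_ge p hp := h.var_ge p (mt (h1 _ _) hp)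
  env_le i hi := h.env_le i (mt (h2 _ _) hi)
  env_ge i hi := h.env_ge i (mt (h2 _ _) hi)
  nom_eq j hj := h.nom_eq j (mt (h3 _) hj)
  cnom_eq j hj := h.cnom_eq j (mt (h4 _) hj)

theorem AssignmentLE.subNeg {n : ℕ} {t s : Term β n} {V V' : Assignment C}
    {env env' : Fin n → C} (h : AssignmentLE t V V' env env')
    (h1 : ∀ p b, t.VarSign p b → s.VarSign p !b) (h2 : ∀ i b, t.FVarSign i b → s.FVarSign i !b)
    (h3 : ∀ j, t.NomFree j → s.NomFree j) (h4 : ∀ m, t.CnomFree m → s.CnomFree m) :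
    AssignmentLE s V' V env' env where
  var_le p hp := h.var_ge p (mt (h1 _ true) hp)
  var_ge p hp := h.var_le p (mt (h1 _ false) hp)
  env_le i hi := h.env_ge i (mt (h2 _ true) hi)
  env_ge i hi := h.env_le i (mt (h2 _ false) hi)
  nom_eq j hj := (h.nom_eq j (mt (h3 _) hj)).symm
  cnom_eq j hj := (h.cnom_eq j (mt (h4 _) hj)).symm

/-- Each connective is monotone up to sign. Under a binder the two bodies are compared at the same
`c`, so their sets of pre- or post-fixed points are nested; neither positivity in the bound variable
nor existence of fixed points in `K` plays a role. -/
theorem evalIn_mono (hbox : Monotone box) (hdia : Monotone dia) {n : ℕ} {t : Term β n}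
    {V V' : Assignment C} {env env' : Fin n → C} (h : AssignmentLE t V V' env env') :
    evalIn K box dia V t env ≤ evalIn K box dia V' t env' := by
  induction t generalizing V V' with
  | bot => exact le_rfl
  | top => exact le_rfl
  | var p => exact h.var_le p (by simp [Term.VarSign])
  | fvar i => exact h.env_le i (by simp [Term.FVarSign])
  | nom j => exact (h.nom_eq j (by simp [Term.NomFree])).le
  | cnom m => exact (h.cnom_eq m (by simp [Term.CnomFree])).le
  | and s t ihs iht =>
    exact inf_le_inf
      (ihs (h.sub (fun _ _ h => h.1) (fun _ _ h => h.1) (fun _ h => h.1) (fun _ h => h.1)))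
      (iht (h.sub (fun _ _ h => h.2) (fun _ _ h => h.2) (fun _ h => h.2) (fun _ h => h.2)))
  | or s t ihs iht =>
    exact sup_le_sup
      (ihs (h.sub (fun _ _ h => h.1) (fun _ _ h => h.1) (fun _ h => h.1) (fun _ h => h.1)))
      (iht (h.sub (fun _ _ h => h.2) (fun _ _ h => h.2) (fun _ h => h.2) (fun _ h => h.2)))
  | imp s t ihs iht =>
    exact imp_mono
      (ihs (h.subNeg (fun _ _ h => h.1) (fun _ _ h => h.1) (fun _ h => h.1) (fun _ h => h.1)))
      (iht (h.sub (fun _ _ h => h.2) (fun _ _ h => h.2) (fun _ h => h.2) (fun _ h => h.2)))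
  | sub s t ihs iht =>
    exact sub_mono
      (ihs (h.sub (fun _ _ h => h.1) (fun _ _ h => h.1) (fun _ h => h.1) (fun _ h => h.1)))
      (iht (h.subNeg (fun _ _ h => h.2) (fun _ _ h => h.2) (fun _ h => h.2) (fun _ h => h.2)))
  | dia t ih =>
    exact hdia (ih (h.sub (fun _ _ h => h) (fun _ _ h => h) (fun _ h => h) (fun _ h => h)))
  | box t ih =>
    exact hbox (ih (h.sub (fun _ _ h => h) (fun _ _ h => h) (fun _ h => h) (fun _ h => h)))
  | bdia t ih =>
    exact sInf_le_sInf fun c hc => le_trans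
      (ih (h.sub (fun _ _ h => h) (fun _ _ h => h) (fun _ h => h) (fun _ h => h))) hc
  | bbox t ih =>
    exact sSup_le_sSup fun c hc => le_trans hc
      (ih (h.sub (fun _ _ h => h) (fun _ _ h => h) (fun _ h => h) (fun _ h => h)))
  | mu b t ih =>
    exact sInf_le_sInf fun c hc => ⟨hc.1, le_trans
      (ih (h.binder c (fun _ _ h => h) (fun _ _ h => h) (fun _ h => h) (fun _ h => h))) hc.2⟩
  | nu b t ih =>
    exact sSup_le_sSup fun c hc => ⟨hc.1, le_trans hc.2
      (ih (h.binder c (fun _ _ h => h) (fun _ _ h => h) (fun _ h => h) (fun _ h => h)))⟩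

theorem Term.VarFree.varSign {p : ℕ} {n : ℕ} {t : Term β n} (h : t.VarFree p) (s : Bool) :
    t.VarSign p s := by
  induction t generalizing s <;> simp_all [-Bool.forall_bool, Term.VarFree, Term.VarSign]

theorem evalIn_congr (hbox : Monotone box) (hdia : Monotone dia) {n : ℕ} {t : Term β n}
    {V V' : Assignment C} {env env' : Fin n → C} (hvar : ∀ p, ¬ t.VarFree p → V.var p = V'.var p)
    (henv : ∀ i, ¬ (t.FVarSign i true ∧ t.FVarSign i false) → env i = env' i)
    (hnom : ∀ j, ¬ t.NomFree j → V.nom j = V'.nom j)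
    (hcnom : ∀ m, ¬ t.CnomFree m → V.cnom m = V'.cnom m) :
    evalIn K box dia V t env = evalIn K box dia V' t env' :=
  le_antisymm
    (evalIn_mono hbox hdia
      ⟨fun p hp => (hvar p fun h => hp (h.varSign _)).le, fun p hp => (hvar p fun h => hp
        (h.varSign _)).ge, fun i hi => (henv i fun h => hi h.2).le,
        fun i hi => (henv i fun h => hi h.1).ge, hnom, hcnom⟩)
    (evalIn_mono hbox hdia
      ⟨fun p hp => (hvar p fun h => hp (h.varSign _)).ge, fun p hp => (hvar p fun h => hp
        (h.varSign _)).le, fun i hi => (henv i fun h => hi h.2).ge,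
        fun i hi => (henv i fun h => hi h.1).le, fun j hj => (hnom j hj).symm,
        fun m hm => (hcnom m hm).symm⟩)

/-! ### Substitution -/

theorem extend_comp_lift {X : Type*} {n m : ℕ} (r : Fin n → Fin m) (c : X) (env : Fin m → X) :
    (fun i => extend c env (extend (0 : Fin (m + 1)) (fun i => (r i).succ) i)) =
      extend c (fun i => env (r i)) := by
  funext i
  exact Fin.cases rfl (fun _ => rfl) i

theorem evalIn_rename (V : Assignment C) {n m : ℕ} (r : Fin n → Fin m) (t : Term β n)
    (env : Fin m → C) :
    evalIn K box dia V (t.rename r) env = evalIn K box dia V t (fun i => env (r i)) := by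
  induction t generalizing m with
  | mu b t ih => simp only [Term.rename, evalIn, ih, extend_comp_lift]
  | nu b t ih => simp only [Term.rename, evalIn, ih, extend_comp_lift]
  | _ => simp_all [Term.rename, evalIn]

theorem evalIn_lift (V : Assignment C) {n m : ℕ} (σ : Fin n → Term β m) (c : C)
    (env : Fin m → C) :
    (fun i => evalIn K box dia V (Term.lift σ i) (extend c env)) =
      extend c (fun i => evalIn K box dia V (σ i) env) := by
  funext i
  refine Fin.cases rfl (fun i => ?_) i
  exact evalIn_rename V Fin.succ (σ i) (extend c env)

theorem evalIn_subst (V : Assignment C) {n m : ℕ} (σ : Fin n → Term β m) (t : Term β n)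
    (env : Fin m → C) :
    evalIn K box dia V (t.subst σ) env =
      evalIn K box dia V t (fun i => evalIn K box dia V (σ i) env) := by
  induction t generalizing m with
  | mu b t ih => simp only [Term.subst, evalIn, ih, evalIn_lift]
  | nu b t ih => simp only [Term.subst, evalIn, ih, evalIn_lift]
  | _ => simp_all [Term.subst, evalIn]

def Assignment.setVar (V : Assignment C) (p : ℕ) (x : C) : Assignment C :=
  { V with var := Function.update V.var p x }

theorem evalIn_substVar (V : Assignment C) {n : ℕ} (p : ℕ) (α : Term β 0) (t : Term β n)
    (env : Fin n → C) :
    evalIn K box dia V (Term.substVar p α t) env =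
      evalIn K box dia (V.setVar p (evalIn K box dia V α Fin.elim0)) t env := by
  induction t with
  | var q =>
    by_cases h : q = p
    · subst h
      simp only [Term.substVar, if_true, evalIn_rename, evalIn, Assignment.setVar,
        Function.update_self]
      congr 1
      funext i
      exact i.elim0
    · simp [Term.substVar, h, evalIn, Assignment.setVar]
  | _ => simp_all [Term.substVar, evalIn, Assignment.setVar]

theorem evalIn_star (V : Assignment C) {n : ℕ} (t : Term Unit n) (env : Fin n → C) :
    evalIn K box dia V t.star env = evalIn K box dia V t env := by
  induction t <;> simp_all [Term.star, evalIn]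

theorem evalIn_handle (V : Assignment C) {n : ℕ} (s : Bool) (t : Term Bool n) (env : Fin n → C) :
    evalIn K box dia V (t.handle s) env = evalIn K box dia V t env := by
  induction t generalizing s <;> simp_all [-Bool.forall_bool, Term.handle, evalIn]

end EvalIn

/-! ### Signs of handled binders -/

/-- In the signed generation tree of `t` whose root has sign `s` all handled binders are `+μ*` or
`-ν*`. -/
def Good : {n : ℕ} → Bool → Term Bool n → Prop
  | _, s, .and a b => Good s a ∧ Good s b
  | _, s, .or a b => Good s a ∧ Good s b
  | _, s, .imp a b => Good (!s) a ∧ Good s b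
  | _, s, .sub a b => Good s a ∧ Good (!s) b
  | _, s, .dia t => Good s t
  | _, s, .box t => Good s t
  | _, s, .bdia t => Good s t
  | _, s, .bbox t => Good s t
  | _, s, .mu b t => (b = true → s = true) ∧ Good s t
  | _, s, .nu b t => (b = true → s = false) ∧ Good s t
  | _, _, _ => True

/-- Starring marks every binder as not handled, so the sign condition is vacuous at the start of a
run. -/
theorem good_star {n : ℕ} (s : Bool) (t : Term Unit n) : Good s t.star := by
  induction t generalizing s <;> simp_all [-Bool.forall_bool, Term.star, Good]

theorem Good.handle {n : ℕ} {s : Bool} {t : Term Bool n} (h : Good s t) : Good s (t.handle s) := by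
  induction t generalizing s with
  | mu b t ih => exact ⟨fun hb => (Bool.or_eq_true_iff.1 hb).elim h.1 id, ih h.2⟩
  | nu b t ih =>
    exact ⟨fun hb => (Bool.or_eq_true_iff.1 hb).elim h.1 (fun hs => by simpa using hs), ih h.2⟩
  | _ => simp_all [-Bool.forall_bool, Term.handle, Good]

theorem good_rename {n m : ℕ} (r : Fin n → Fin m) (s : Bool) (t : Term Bool n) :
    Good s (t.rename r) ↔ Good s t := by
  induction t generalizing m s <;> simp_all [-Bool.forall_bool, Term.rename, Good]

/-- Both signs are asked of the substituted terms since placeholders may occur with either; in the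
application these terms are constants, nominals or co-nominals and contain no binder. -/
theorem Good.subst {n m : ℕ} {σ : Fin n → Term Bool m} (hσ : ∀ i s, Good s (σ i)) {s : Bool}
    {t : Term Bool n} (h : Good s t) : Good s (t.subst σ) := by
  have hlift : ∀ {n m : ℕ} {σ : Fin n → Term Bool m}, (∀ i s, Good s (σ i)) →
      ∀ i s, Good s (Term.lift σ i) := by
    intro n m σ hσ i s
    refine Fin.cases trivial (fun i => ?_) i
    exact (good_rename _ _ _).2 (hσ i s)
  induction t generalizing m s with
  | fvar i => exact hσ i s
  | mu b t ih => exact ⟨h.1, ih (hlift hσ) h.2⟩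
  | nu b t ih => exact ⟨h.1, ih (hlift hσ) h.2⟩
  | imp a b iha ihb => exact ⟨iha hσ h.1, ihb hσ h.2⟩
  | sub a b iha ihb => exact ⟨iha hσ h.1, ihb hσ h.2⟩
  | and a b iha ihb => exact ⟨iha hσ h.1, ihb hσ h.2⟩
  | or a b iha ihb => exact ⟨iha hσ h.1, ihb hσ h.2⟩
  | dia a iha => exact iha (s := s) hσ h
  | box a iha => exact iha (s := s) hσ h
  | bdia a iha => exact iha (s := s) hσ h
  | bbox a iha => exact iha (s := s) hσ h
  | _ => exact True.intro

theorem Good.of_subst {n m : ℕ} {σ : Fin n → Term Bool m} {s : Bool}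
    {t : Term Bool n} (h : Good s (t.subst σ)) : Good s t := by
  induction t generalizing m s with
  | fvar i => exact True.intro
  | mu b t ih => exact ⟨h.1, ih h.2⟩
  | nu b t ih => exact ⟨h.1, ih h.2⟩
  | imp a b iha ihb => exact ⟨iha h.1, ihb h.2⟩
  | sub a b iha ihb => exact ⟨iha h.1, ihb h.2⟩
  | and a b iha ihb => exact ⟨iha h.1, ihb h.2⟩
  | or a b iha ihb => exact ⟨iha h.1, ihb h.2⟩
  | dia a iha => exact iha (σ := σ) h
  | box a iha => exact iha (σ := σ) h
  | bdia a iha => exact iha (σ := σ) h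
  | bbox a iha => exact iha (σ := σ) h
  | _ => exact True.intro

/-- A term substituted at an occurrence of sign `!b`. -/
theorem Good.of_subst_occ {n m : ℕ} {σ : Fin n → Term Bool m} {s b : Bool}
    {t : Term Bool n} {k : Fin n} (hk : ¬ t.FVarSign k b) (h : Good s (t.subst σ)) :
    Good (s ^^ b) (σ k) := by
  induction t generalizing m s b with
  | fvar i =>
    simp only [Term.FVarSign, Classical.not_imp, Bool.not_eq_true] at hk
    obtain ⟨rfl, rfl⟩ := hk
    simpa [Term.subst] using h
  | mu c t ih => exact (good_rename _ _ _).1 (ih (σ := Term.lift σ) hk h.2)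
  | nu c t ih => exact (good_rename _ _ _).1 (ih (σ := Term.lift σ) hk h.2)
  | imp x y ihx ihy =>
    rcases not_and_or.1 hk with hk | hk
    · simpa using ihx hk h.1
    · exact ihy hk h.2
  | sub x y ihx ihy =>
    rcases not_and_or.1 hk with hk | hk
    · exact ihx hk h.1
    · simpa using ihy hk h.2
  | and x y ihx ihy =>
    rcases not_and_or.1 hk with hk | hk
    · exact ihx hk h.1
    · exact ihy hk h.2
  | or x y ihx ihy =>
    rcases not_and_or.1 hk with hk | hk
    · exact ihx hk h.1
    · exact ihy hk h.2
  | dia a iha => exact iha (σ := σ) hk h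
  | box a iha => exact iha (σ := σ) hk h
  | bdia a iha => exact iha (σ := σ) hk h
  | bbox a iha => exact iha (σ := σ) hk h
  | _ => exact absurd True.intro hk

/-- Under a root of sign `s` the occurrences of `p` are positive exactly when `s = b`, so `s == b`
is the sign with which the roots of the copies of `α` appear. -/
theorem Good.substVar {n : ℕ} {p : ℕ} {α : Term Bool 0} {s b : Bool} {t : Term Bool n}
    (h : Good s t) (ht : t.VarSign p b) (hα : Good (s == b) α) : Good s (Term.substVar p α t) := by
  have hnot : ∀ s b : Bool, ((!s) == !b) = (s == b) := by decide
  induction t generalizing s b with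
  | var q =>
    by_cases hq : q = p
    · have hb : b = true := ht hq
      simp only [Term.substVar, hq, if_true]
      rw [good_rename]
      simpa [hb] using hα
    · simp [Term.substVar, hq, Good]
  | imp x y ihx ihy => exact ⟨ihx h.1 ht.1 ((hnot s b).symm ▸ hα), ihy h.2 ht.2 hα⟩
  | sub x y ihx ihy => exact ⟨ihx h.1 ht.1 hα, ihy h.2 ht.2 ((hnot s b).symm ▸ hα)⟩
  | and x y ihx ihy => exact ⟨ihx h.1 ht.1 hα, ihy h.2 ht.2 hα⟩
  | or x y ihx ihy => exact ⟨ihx h.1 ht.1 hα, ihy h.2 ht.2 hα⟩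
  | mu c t ih => exact ⟨h.1, ih h.2 ht hα⟩
  | nu c t ih => exact ⟨h.1, ih h.2 ht hα⟩
  | dia t ih => exact ih (s := s) h ht hα
  | box t ih => exact ih (s := s) h ht hα
  | bdia t ih => exact ih (s := s) h ht hα
  | bbox t ih => exact ih (s := s) h ht hα
  | _ => exact True.intro

/-! ### Freshness of nominals and co-nominals under renaming and substitution. -/

theorem nomFree_rename {β : Type} {n m : ℕ} (r : Fin n → Fin m) (j : ℕ) (t : Term β n) :
    (t.rename r).NomFree j ↔ t.NomFree j := by
  induction t generalizing m <;> simp_all [Term.rename, Term.NomFree]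

theorem cnomFree_rename {β : Type} {n m : ℕ} (r : Fin n → Fin m) (j : ℕ) (t : Term β n) :
    (t.rename r).CnomFree j ↔ t.CnomFree j := by
  induction t generalizing m <;> simp_all [Term.rename, Term.CnomFree]

theorem Term.NomFree.of_subst {β : Type} {n m : ℕ} {σ : Fin n → Term β m} {j : ℕ} {t : Term β n}
    (h : (t.subst σ).NomFree j) : t.NomFree j := by
  induction t generalizing m with
  | fvar i => exact True.intro
  | mu b t ih => exact ih (σ := Term.lift σ) h
  | nu b t ih => exact ih (σ := Term.lift σ) h
  | imp a b iha ihb => exact ⟨iha h.1, ihb h.2⟩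
  | sub a b iha ihb => exact ⟨iha h.1, ihb h.2⟩
  | and a b iha ihb => exact ⟨iha h.1, ihb h.2⟩
  | or a b iha ihb => exact ⟨iha h.1, ihb h.2⟩
  | dia a iha => exact iha (σ := σ) h
  | box a iha => exact iha (σ := σ) h
  | bdia a iha => exact iha (σ := σ) h
  | bbox a iha => exact iha (σ := σ) h
  | _ => exact h

theorem Term.CnomFree.of_subst {β : Type} {n m : ℕ} {σ : Fin n → Term β m} {j : ℕ} {t : Term β n}
    (h : (t.subst σ).CnomFree j) : t.CnomFree j := by
  induction t generalizing m with
  | fvar i => exact True.intro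
  | mu b t ih => exact ih (σ := Term.lift σ) h
  | nu b t ih => exact ih (σ := Term.lift σ) h
  | imp a b iha ihb => exact ⟨iha h.1, ihb h.2⟩
  | sub a b iha ihb => exact ⟨iha h.1, ihb h.2⟩
  | and a b iha ihb => exact ⟨iha h.1, ihb h.2⟩
  | or a b iha ihb => exact ⟨iha h.1, ihb h.2⟩
  | dia a iha => exact iha (σ := σ) h
  | box a iha => exact iha (σ := σ) h
  | bdia a iha => exact iha (σ := σ) h
  | bbox a iha => exact iha (σ := σ) h
  | _ => exact h

/-- A placeholder that occurs in `t` is replaced by a subterm of `t.subst σ`. -/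
theorem Term.NomFree.of_subst_occ {β : Type} {n m : ℕ} {σ : Fin n → Term β m} {j : ℕ} {b : Bool}
    {t : Term β n} {k : Fin n} (hk : ¬ t.FVarSign k b) (h : (t.subst σ).NomFree j) :
    (σ k).NomFree j := by
  induction t generalizing m b with
  | fvar i =>
    simp only [Term.FVarSign, Classical.not_imp] at hk
    exact hk.1 ▸ h
  | mu c t ih => exact (nomFree_rename _ _ _).1 (ih (σ := Term.lift σ) hk h)
  | nu c t ih => exact (nomFree_rename _ _ _).1 (ih (σ := Term.lift σ) hk h)
  | imp x y ihx ihy =>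
    exact (not_and_or.1 hk).elim (fun hk => ihx hk h.1) (fun hk => ihy hk h.2)
  | sub x y ihx ihy =>
    exact (not_and_or.1 hk).elim (fun hk => ihx hk h.1) (fun hk => ihy hk h.2)
  | and x y ihx ihy =>
    exact (not_and_or.1 hk).elim (fun hk => ihx hk h.1) (fun hk => ihy hk h.2)
  | or x y ihx ihy =>
    exact (not_and_or.1 hk).elim (fun hk => ihx hk h.1) (fun hk => ihy hk h.2)
  | dia a iha => exact iha (σ := σ) hk h
  | box a iha => exact iha (σ := σ) hk h
  | bdia a iha => exact iha (σ := σ) hk h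
  | bbox a iha => exact iha (σ := σ) hk h
  | _ => exact absurd True.intro hk

theorem Term.CnomFree.of_subst_occ {β : Type} {n m : ℕ} {σ : Fin n → Term β m} {j : ℕ} {b : Bool}
    {t : Term β n} {k : Fin n} (hk : ¬ t.FVarSign k b) (h : (t.subst σ).CnomFree j) :
    (σ k).CnomFree j := by
  induction t generalizing m b with
  | fvar i =>
    simp only [Term.FVarSign, Classical.not_imp] at hk
    exact hk.1 ▸ h
  | mu c t ih => exact (cnomFree_rename _ _ _).1 (ih (σ := Term.lift σ) hk h)
  | nu c t ih => exact (cnomFree_rename _ _ _).1 (ih (σ := Term.lift σ) hk h)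
  | imp x y ihx ihy =>
    exact (not_and_or.1 hk).elim (fun hk => ihx hk h.1) (fun hk => ihy hk h.2)
  | sub x y ihx ihy =>
    exact (not_and_or.1 hk).elim (fun hk => ihx hk h.1) (fun hk => ihy hk h.2)
  | and x y ihx ihy =>
    exact (not_and_or.1 hk).elim (fun hk => ihx hk h.1) (fun hk => ihy hk h.2)
  | or x y ihx ihy =>
    exact (not_and_or.1 hk).elim (fun hk => ihx hk h.1) (fun hk => ihy hk h.2)
  | dia a iha => exact iha (σ := σ) hk h
  | box a iha => exact iha (σ := σ) hk h
  | bdia a iha => exact iha (σ := σ) hk h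
  | bbox a iha => exact iha (σ := σ) hk h
  | _ => exact absurd True.intro hk

/-- Where only handled binders occur, with the right signs, restricting the fixed points makes the
value grow. -/
theorem eval_le_evalIn {C : Type v} [CompleteLattice C] {K : Set C} {box dia : C → C}
    (hbox : Monotone box) (hdia : Monotone dia) (V : Assignment C) {n : ℕ} {t : Term Bool n}
    (hh : t.AllHandled) (env : Fin n → C) :
    (Good true t → evalIn Set.univ box dia V t env ≤ evalIn K box dia V t env) ∧
      (Good false t → evalIn K box dia V t env ≤ evalIn Set.univ box dia V t env) := by
  induction t with
  | and x y ihx ihy =>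
    exact ⟨fun h => inf_le_inf ((ihx hh.1 env).1 h.1) ((ihy hh.2 env).1 h.2),
      fun h => inf_le_inf ((ihx hh.1 env).2 h.1) ((ihy hh.2 env).2 h.2)⟩
  | or x y ihx ihy =>
    exact ⟨fun h => sup_le_sup ((ihx hh.1 env).1 h.1) ((ihy hh.2 env).1 h.2),
      fun h => sup_le_sup ((ihx hh.1 env).2 h.1) ((ihy hh.2 env).2 h.2)⟩
  | imp x y ihx ihy =>
    exact ⟨fun h => imp_mono ((ihx hh.1 env).2 h.1) ((ihy hh.2 env).1 h.2),
      fun h => imp_mono ((ihx hh.1 env).1 h.1) ((ihy hh.2 env).2 h.2)⟩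
  | sub x y ihx ihy =>
    exact ⟨fun h => sub_mono ((ihx hh.1 env).1 h.1) ((ihy hh.2 env).2 h.2),
      fun h => sub_mono ((ihx hh.1 env).2 h.1) ((ihy hh.2 env).1 h.2)⟩
  | dia t ih => exact ⟨fun h => hdia ((ih hh env).1 h), fun h => hdia ((ih hh env).2 h)⟩
  | box t ih => exact ⟨fun h => hbox ((ih hh env).1 h), fun h => hbox ((ih hh env).2 h)⟩
  | bdia t ih =>
    exact ⟨fun h => sInf_le_sInf fun c hc => ((ih hh env).1 h).trans hc,
      fun h => sInf_le_sInf fun c hc => ((ih hh env).2 h).trans hc⟩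
  | bbox t ih =>
    exact ⟨fun h => sSup_le_sSup fun c hc => le_trans hc ((ih hh env).1 h),
      fun h => sSup_le_sSup fun c hc => le_trans hc ((ih hh env).2 h)⟩
  | mu b t ih =>
    refine ⟨fun h => sInf_le_sInf fun c hc => ⟨trivial, ((ih hh.2 _).1 h.2).trans hc.2⟩,
      fun h => ?_⟩
    exact absurd (h.1 hh.1) (by simp)
  | nu b t ih =>
    refine ⟨fun h => absurd (h.1 hh.1) (by simp),
      fun h => sSup_le_sSup fun c hc => ⟨trivial, le_trans hc.2 ((ih hh.2 _).2 h.2)⟩⟩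
  | _ => exact ⟨fun _ => le_rfl, fun _ => le_rfl⟩

/-! ### Perfect algebras -/

section Rules

variable {C : Type v} [CompleteLattice C]

/-- Perfect algebras, with the irreducible elements known to be prime. -/
structure PerfectLaws (box dia : C → C) : Prop where
  perfect : IsPerfect box dia
  joinDense : JoinPrimeDense C
  meetDense : JoinPrimeDense Cᵒᵈ

variable {box dia : C → C}

theorem IsPerfect.box_mono (h : IsPerfect box dia) : Monotone box := by
  intro x y hxy
  have := h.box_sInf {x, y}
  rw [sInf_pair, inf_eq_left.2 hxy, Set.image_pair, sInf_pair] at this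
  exact this ▸ inf_le_right

theorem IsPerfect.dia_mono (h : IsPerfect box dia) : Monotone dia := by
  intro x y hxy
  have := h.dia_sSup {x, y}
  rw [sSup_pair, sup_eq_right.2 hxy, Set.image_pair, sSup_pair] at this
  exact this ▸ le_sup_left

theorem IsPerfect.bdia_le_iff (h : IsPerfect box dia) (x y : C) :
    sInf {c | x ≤ box c} ≤ y ↔ x ≤ box y := by
  refine ⟨fun hle => le_trans ?_ (h.box_mono hle), fun hle => sInf_le hle⟩
  rw [h.box_sInf]
  apply le_sInf
  rintro _ ⟨c, hc, rfl⟩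
  exact hc

theorem IsPerfect.le_bbox_iff (h : IsPerfect box dia) (x y : C) :
    x ≤ sSup {c | dia c ≤ y} ↔ dia x ≤ y := by
  refine ⟨fun hle => le_trans (h.dia_mono hle) ?_, fun hle => le_sSup hle⟩
  rw [h.dia_sSup]
  apply sSup_le
  rintro _ ⟨c, hc, rfl⟩
  exact hc

theorem IsPerfect.box_inf (h : IsPerfect box dia) (x y : C) : box (x ⊓ y) = box x ⊓ box y := by
  rw [← sInf_pair, h.box_sInf, Set.image_pair, sInf_pair]

theorem IsPerfect.dia_sup (h : IsPerfect box dia) (x y : C) : dia (x ⊔ y) = dia x ⊔ dia y := by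
  rw [← sSup_pair, h.dia_sSup, Set.image_pair, sSup_pair]

namespace PerfectLaws

variable (L : PerfectLaws box dia)
include L

theorem le_imp_iff (x y z : C) : z ≤ sSup {c | c ⊓ x ≤ y} ↔ z ⊓ x ≤ y :=
  L.joinDense.le_imp_iff x y z

theorem sub_le_iff (x y z : C) : sInf {c | x ≤ y ⊔ c} ≤ z ↔ x ≤ y ⊔ z :=
  L.meetDense.sub_le_iff x y z

theorem joinPrime {j : C} (h : IsCompletelyJoinIrreducible j) : IsJoinPrime j :=
  h.joinPrime L.joinDense

theorem meetPrime {m : C} (h : IsCompletelyMeetIrreducible m) : IsMeetPrime m :=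
  IsCompletelyJoinIrreducible.joinPrime (C := Cᵒᵈ) L.meetDense h

theorem inf_sup (x y z : C) : x ⊓ (y ⊔ z) = x ⊓ y ⊔ x ⊓ z := by
  refine le_antisymm ?_ le_inf_sup
  rw [inf_comm, ← L.le_imp_iff]
  refine sup_le ((L.le_imp_iff _ _ _).2 ?_) ((L.le_imp_iff _ _ _).2 ?_)
  · rw [inf_comm]; exact le_sup_left
  · rw [inf_comm]; exact le_sup_right

theorem sup_inf (x y z : C) : x ⊔ y ⊓ z = (x ⊔ y) ⊓ (x ⊔ z) := by
  refine le_antisymm sup_inf_le ?_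
  rw [← L.sub_le_iff]
  exact le_inf ((L.sub_le_iff _ _ _).2 inf_le_left) ((L.sub_le_iff _ _ _).2 inf_le_right)

/-- Expand `x` as a join of irreducibles, distribute `dia` over it, and let primeness of `j` pick
one. -/
theorem exists_dia {j x : C} (hj : IsCompletelyJoinIrreducible j) (h : j ≤ dia x) :
    ∃ i, IsCompletelyJoinIrreducible i ∧ i ≤ x ∧ j ≤ dia i := by
  rw [L.joinDense.eq_sSup x, L.perfect.dia_sSup] at h
  obtain ⟨_, ⟨i, hi, rfl⟩, hji⟩ := L.joinPrime hj _ h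
  exact ⟨i, hi.1, hi.2, hji⟩

theorem exists_box {m x : C} (hm : IsCompletelyMeetIrreducible m) (h : box x ≤ m) :
    ∃ n, IsCompletelyMeetIrreducible n ∧ x ≤ n ∧ box n ≤ m := by
  rw [L.perfect.meet_dense x, L.perfect.box_sInf] at h
  obtain ⟨_, ⟨n, hn, rfl⟩, hnm⟩ := L.meetPrime hm _ h
  exact ⟨n, hn.1, hn.2, hnm⟩

/-- The meet of all implications from a join-irreducible `j ≤ x` to a meet-irreducible `n ≥ y` is at
most the implication from `x` to `y`, hence below `m`; primeness of `m` picks one of them. -/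
theorem exists_imp {m x y : C} (hm : IsCompletelyMeetIrreducible m)
    (h : sSup {c | c ⊓ x ≤ y} ≤ m) :
    ∃ j n, IsCompletelyJoinIrreducible j ∧ IsCompletelyMeetIrreducible n ∧ j ≤ x ∧ y ≤ n ∧
      sSup {c | c ⊓ j ≤ n} ≤ m := by
  have hle : sInf {z | ∃ j n, IsCompletelyJoinIrreducible j ∧ IsCompletelyMeetIrreducible n ∧
      j ≤ x ∧ y ≤ n ∧ z = sSup {c | c ⊓ j ≤ n}} ≤ m := by
    refine le_trans ?_ h
    rw [L.le_imp_iff, inf_comm, ← L.le_imp_iff, L.joinDense.eq_sSup x]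
    refine sSup_le fun j hj => ?_
    rw [L.le_imp_iff, L.perfect.meet_dense y]
    refine le_sInf fun n hn => ?_
    rw [inf_comm, ← L.le_imp_iff]
    refine sInf_le ⟨j, n, hj.1, hn.1, ?_, ?_, rfl⟩
    · rw [← L.joinDense.eq_sSup]; exact hj.2
    · rw [← L.perfect.meet_dense]; exact hn.2
  obtain ⟨_, ⟨j, n, hj, hn, hjx, hyn, rfl⟩, hle⟩ := L.meetPrime hm _ hle
  exact ⟨j, n, hj, hn, hjx, hyn, hle⟩

theorem exists_sub {i x y : C} (hi : IsCompletelyJoinIrreducible i)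
    (h : i ≤ sInf {c | x ≤ y ⊔ c}) :
    ∃ j n, IsCompletelyJoinIrreducible j ∧ IsCompletelyMeetIrreducible n ∧ j ≤ x ∧ y ≤ n ∧
      i ≤ sInf {c | j ≤ n ⊔ c} := by
  have hle : i ≤ sSup {z | ∃ j n, IsCompletelyJoinIrreducible j ∧ IsCompletelyMeetIrreducible n ∧
      j ≤ x ∧ y ≤ n ∧ z = sInf {c | j ≤ n ⊔ c}} := by
    refine le_trans h ?_
    rw [L.sub_le_iff, sup_comm, ← L.sub_le_iff, L.perfect.meet_dense y]
    refine le_sInf fun n hn => ?_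
    rw [L.sub_le_iff, L.joinDense.eq_sSup x]
    refine sSup_le fun j hj => ?_
    rw [sup_comm, ← L.sub_le_iff]
    refine le_sSup ⟨j, n, hj.1, hn.1, ?_, ?_, rfl⟩
    · rw [← L.joinDense.eq_sSup]; exact hj.2
    · rw [← L.perfect.meet_dense]; exact hn.2
  obtain ⟨_, ⟨j, n, hj, hn, hjx, hyn, rfl⟩, hle⟩ := L.joinPrime hi _ hle
  exact ⟨j, n, hj, hn, hjx, hyn, hle⟩

end PerfectLaws

/-! ### Approximation of fixed points -/

/-- The tuple with `j` at place `k` and `⊥` (`⊤`, where the order is reversed) elsewhere. -/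
def singleTuple {n : ℕ} (τ : Fin n → Bool) (k : Fin n) (j : C) : Fin n → C :=
  fun l => if l = k then j else if τ l then ⊥ else ⊤

/-- The two tuples differ only in the fixed point variable, so their join in the order given by `τ`
is the larger one. -/
theorem joinPreserving_mono {n : ℕ} {τ : Fin n → Bool} {G : (Fin (n + 1) → C) → C}
    (hG : ∀ S, G (joinOrd τ S) = sSup (G '' S)) {a b : C} (hab : a ≤ b) (x : Fin n → C) :
    G (extend a x) ≤ G (extend b x) := by
  have h := hG {extend a x, extend b x}
  have hj : joinOrd τ {extend a x, extend b x} = extend b x := by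
    funext i
    refine Fin.cases ?_ (fun k => ?_) i
    · change sSup ((fun x => x 0) '' {extend a x, extend b x}) = b
      rw [Set.image_pair, sSup_pair]
      exact sup_eq_right.2 hab
    · change (if τ k then sSup ((fun x => x k.succ) '' {extend a x, extend b x})
        else sInf ((fun x => x k.succ) '' {extend a x, extend b x})) = x k
      rw [Set.image_pair, sSup_pair, sInf_pair]
      split_ifs
      · exact sup_idem _
      · exact inf_idem _
  rw [hj, Set.image_pair, sSup_pair] at h
  exact h ▸ le_sup_left

/-- The least fixed point at `x` is at most the join of the least fixed points at tuples
concentrated in one place. Indeed, pairing each such tuple with its own fixed point and joining all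
pairs gives `x` in the occurring places and the join of the fixed points in place `0`; as `G`
preserves this join, the latter is a pre-fixed point at `x`. Primeness of `i` then selects one
tuple. If no place occurs the join is empty, and no prime lies below it. -/
theorem exists_singleTuple (hC : JoinPrimeDense C) (hC' : JoinPrimeDense Cᵒᵈ) {n : ℕ}
    {τ : Fin n → Bool} {G : (Fin (n + 1) → C) → C}
    (hG : ∀ S, G (joinOrd τ S) = sSup (G '' S)) {occ : Fin n → Prop}
    (hocc : ∀ c x x', (∀ k, occ k → x k = x' k) → G (extend c x) = G (extend c x'))
    {i : C} (hi : IsJoinPrime i) {x : Fin n → C} (h : i ≤ sInf {c | G (extend c x) ≤ c}) :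
    ∃ k, occ k ∧ ∃ j, (if τ k then IsCompletelyJoinIrreducible j ∧ j ≤ x k else
      IsCompletelyMeetIrreducible j ∧ x k ≤ j) ∧
      i ≤ sInf {c | G (extend c (singleTuple τ k j)) ≤ c} := by
  let F : (Fin n → C) → C := fun x => sInf {c | G (extend c x) ≤ c}
  have hF : ∀ x, G (extend (F x) x) ≤ F x := fun x =>
    le_sInf fun c hc => (joinPreserving_mono hG (sInf_le hc) x).trans hc
  let R : Fin n → C → Prop := fun k j => if τ k then IsCompletelyJoinIrreducible j ∧ j ≤ x k else
      IsCompletelyMeetIrreducible j ∧ x k ≤ j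
  let S : Set (Fin (n + 1) → C) := {s | ∃ k j, occ k ∧ R k j ∧
    s = extend (F (singleTuple τ k j)) (singleTuple τ k j)}
  -- Place `k` of the join collects the irreducibles approximating `x k`, from the tuples
  -- concentrated at `k`; every other tuple contributes the neutral constant for `τ k`. At places
  -- that do not occur this may fail, and `hocc` makes that harmless.
  have hx : ∀ k, occ k → x k = joinOrd τ S k.succ := by
    intro k hk
    change x k = if τ k then sSup ((fun s => s k.succ) '' S) else sInf ((fun s => s k.succ) '' S)
    by_cases hτ : τ k = true
    · rw [if_pos hτ]
      apply le_antisymm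
      · refine le_of_eq_of_le (hC.eq_sSup (x k)) (sSup_le fun j hj => le_sSup ?_)
        refine ⟨_, ⟨k, j, hk, ?_, rfl⟩, ?_⟩
        · simp only [R, if_pos hτ]
          exact hj
        · change singleTuple τ k j k = j
          simp [singleTuple]
      · apply sSup_le
        rintro _ ⟨_, ⟨l, j, _, hR, rfl⟩, rfl⟩
        change singleTuple τ l j k ≤ x k
        by_cases hkl : k = l
        · subst hkl
          simp only [R, if_pos hτ] at hR
          simpa [singleTuple] using hR.2
        · simp [singleTuple, hkl, hτ]
    · rw [if_neg hτ]
      apply le_antisymm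
      · apply le_sInf
        rintro _ ⟨_, ⟨l, j, _, hR, rfl⟩, rfl⟩
        change x k ≤ singleTuple τ l j k
        by_cases hkl : k = l
        · subst hkl
          simp only [R, if_neg hτ] at hR
          simpa [singleTuple] using hR.2
        · simp [singleTuple, hkl, hτ]
      · have heq : x k = sInf {m | IsCompletelyMeetIrreducible m ∧ x k ≤ m} := hC'.eq_sSup (x k)
        refine le_of_le_of_eq (le_sInf fun j hj => sInf_le ?_) heq.symm
        refine ⟨_, ⟨k, j, hk, ?_, rfl⟩, ?_⟩
        · simp only [R, if_neg hτ]
          exact hj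
        · change singleTuple τ k j k = j
          simp [singleTuple]
  have hle : G (extend (sSup ((fun s => s 0) '' S)) x) ≤ sSup ((fun s => s 0) '' S) := by
    rw [hocc _ x (fun k => joinOrd τ S k.succ) hx]
    change G (joinOrd τ S) ≤ _
    rw [hG]
    apply sSup_le
    rintro _ ⟨s, hs, rfl⟩
    refine le_trans ?_ (le_sSup ⟨s, hs, rfl⟩)
    obtain ⟨k, j, _, _, rfl⟩ := hs
    exact hF _
  obtain ⟨_, ⟨_, ⟨k, j, hk, hR, rfl⟩, rfl⟩, hij⟩ := hi _ (h.trans (sInf_le hle))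
  exact ⟨k, hk, j, hR, hij⟩

/-! ### Validity of quasi-inequalities -/

def Holds (K : Set C) (box dia : C → C) (V : Assignment C) (I : Ineq Bool) : Prop :=
  evalIn K box dia V I.lhs Fin.elim0 ≤ evalIn K box dia V I.rhs Fin.elim0

/-- Validity of a quasi-inequality when propositional variables take values in `K` and fixed points
are computed in `K`. -/
def ValidIn (K : Set C) (box dia : C → C) (Q : QIneq) : Prop :=
  ∀ V : Assignment C, V.Respects → (∀ p, V.var p ∈ K) → (∀ I ∈ Q.ants, Holds K box dia V I) →
    V.nom Q.i ≤ V.cnom Q.m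

def GoodIneq (I : Ineq Bool) : Prop := Good false I.lhs ∧ Good true I.rhs

variable {K : Set C} (L : PerfectLaws box dia)
include L

theorem evalIn_mu_le_of_tuple {n : ℕ} {τ : Fin n → Bool} {b : Bool} {ψ : Term Bool (n + 1)}
    (hψ : ∀ k, ψ.FVarSign k.succ (τ k)) {x y : Fin n → C} {V : Assignment C}
    (h : ∀ k, if τ k then x k ≤ y k else y k ≤ x k) :
    evalIn K box dia V (.mu b ψ) x ≤ evalIn K box dia V (.mu b ψ) y ∧
      evalIn K box dia V (.nu b ψ) x ≤ evalIn K box dia V (.nu b ψ) y := by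
  have h1 : ∀ k, ¬ ψ.FVarSign k.succ false → x k ≤ y k := by
    intro k hk
    have hτ : τ k = true := by
      by_contra hτ
      exact hk (by simpa [hτ] using hψ k)
    simpa [hτ] using h k
  have h2 : ∀ k, ¬ ψ.FVarSign k.succ true → y k ≤ x k := by
    intro k hk
    have hτ : τ k = false := by
      by_contra hτ
      exact hk (by simpa [hτ] using hψ k)
    simpa [hτ] using h k
  exact ⟨evalIn_mono L.perfect.box_mono L.perfect.dia_mono ⟨fun _ _ => le_rfl, fun _ _ => le_rfl,
    h1, h2, fun _ _ => rfl, fun _ _ => rfl⟩,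
    evalIn_mono L.perfect.box_mono L.perfect.dia_mono ⟨fun _ _ => le_rfl, fun _ _ => le_rfl,
    h1, h2, fun _ _ => rfl, fun _ _ => rfl⟩⟩

/-- The premise of a rule follows from each of its alternative conclusions. -/
theorem Rule.holds {FN FC : ℕ → Prop} {I : Ineq Bool} {D : List (List (Ineq Bool))}
    (h : Rule.{v} FN FC I D) {V : Assignment C} {Is : List (Ineq Bool)} (hIs : Is ∈ D)
    (H : ∀ J ∈ Is, Holds K box dia V J) : Holds K box dia V I := by
  have hbox := L.perfect.box_mono
  have hdia := L.perfect.dia_mono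
  cases h with
  | subLR χ ψ φ =>
    simp only [List.mem_singleton] at hIs
    subst hIs
    exact (L.sub_le_iff _ _ _).2 (H _ List.mem_cons_self)
  | impRR φ χ ψ =>
    simp only [List.mem_singleton] at hIs
    subst hIs
    exact (L.le_imp_iff _ _ _).2 (H _ List.mem_cons_self)
  | andLR χ ψ φ =>
    simp only [List.mem_singleton] at hIs
    subst hIs
    exact (L.le_imp_iff _ _ _).1 (H _ List.mem_cons_self)
  | andLR_comm χ ψ φ =>
    simp only [List.mem_singleton] at hIs
    subst hIs
    exact (inf_comm _ _).trans_le ((L.le_imp_iff _ _ _).1 (H _ List.mem_cons_self))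
  | orRR φ χ ψ =>
    simp only [List.mem_singleton] at hIs
    subst hIs
    exact (L.sub_le_iff _ _ _).1 (H _ List.mem_cons_self)
  | orRR_comm φ χ ψ =>
    simp only [List.mem_singleton] at hIs
    subst hIs
    exact ((L.sub_le_iff _ _ _).1 (H _ List.mem_cons_self)).trans_eq (sup_comm _ _)
  | orLA φ χ ψ =>
    simp only [List.mem_singleton] at hIs
    subst hIs
    exact sup_le (H ⟨φ, ψ⟩ (by simp)) (H ⟨χ, ψ⟩ (by simp))
  | andRA ψ φ χ =>
    simp only [List.mem_singleton] at hIs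
    subst hIs
    exact le_inf (H ⟨ψ, φ⟩ (by simp)) (H ⟨ψ, χ⟩ (by simp))
  | diaLA φ ψ =>
    simp only [List.mem_singleton] at hIs
    subst hIs
    exact (L.perfect.le_bbox_iff _ _).1 (H _ List.mem_cons_self)
  | boxRA φ ψ =>
    simp only [List.mem_singleton] at hIs
    subst hIs
    exact (L.perfect.bdia_le_iff _ _).1 (H _ List.mem_cons_self)
  | boxAppr ψ m n hn =>
    simp only [List.mem_singleton] at hIs
    subst hIs
    exact le_trans (hbox (H ⟨ψ, .cnom n⟩ (by simp))) (H ⟨.box (.cnom n), .cnom m⟩ (by simp))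
  | diaAppr ψ j i hi =>
    simp only [List.mem_singleton] at hIs
    subst hIs
    exact le_trans (H ⟨.nom j, .dia (.nom i)⟩ (by simp)) (hdia (H ⟨.nom i, ψ⟩ (by simp)))
  | impAppr χ φ m j n hj hn =>
    simp only [List.mem_singleton] at hIs
    subst hIs
    exact le_trans (imp_mono (H ⟨.nom j, χ⟩ (by simp)) (H ⟨φ, .cnom n⟩ (by simp)))
      (H ⟨.imp (.nom j) (.cnom n), .cnom m⟩ (by simp))
  | subAppr χ φ i j n hj hn =>
    simp only [List.mem_singleton] at hIs
    subst hIs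
    exact le_trans (H ⟨.nom i, .sub (.nom j) (.cnom n)⟩ (by simp))
      (sub_mono (H ⟨.nom j, χ⟩ (by simp)) (H ⟨φ, .cnom n⟩ (by simp)))
  | muAppr τ b ψ φ i c hpure hsign hJP hc =>
    obtain ⟨k, rfl⟩ := (List.mem_ofFn' _ _).1 hIs
    have h1 : evalIn K box dia V (.nom i) Fin.elim0 ≤ _ := H ⟨.nom i, _⟩ List.mem_cons_self
    have h2 := H _ (List.mem_cons_of_mem _ List.mem_cons_self)
    refine h1.trans ?_
    rw [evalIn_subst, evalIn_subst, evalIn_handle]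
    -- In this direction the rule needs only the signs of `ψ`: place `k` is compared by the second
    -- new inequality, the other places carry `⊥` or `⊤`.
    refine (evalIn_mu_le_of_tuple L hsign fun l => ?_).1
    by_cases hl : l = k
    · subst hl
      by_cases hτ : τ l = true
      · simp only [hτ, if_true] at h2 ⊢
        simpa [Holds, nomTuple, hτ] using h2
      · simp only [hτ] at h2 ⊢
        simpa [Holds, nomTuple, hτ] using h2
    · by_cases hτ : τ l = true
      · simp [nomTuple, hτ, hl, evalIn]
      · simp [nomTuple, hτ, hl, evalIn]
  | nuAppr τ b φ ψ m c hpure hsign hJP hc =>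
    obtain ⟨k, rfl⟩ := (List.mem_ofFn' _ _).1 hIs
    have h1 : _ ≤ evalIn K box dia V (.cnom m) Fin.elim0 := H ⟨_, .cnom m⟩ List.mem_cons_self
    have h2 := H _ (List.mem_cons_of_mem _ List.mem_cons_self)
    refine le_trans ?_ h1
    rw [evalIn_subst, evalIn_subst, evalIn_handle]
    refine (evalIn_mu_le_of_tuple L hsign fun l => ?_).2
    by_cases hl : l = k
    · subst hl
      by_cases hτ : τ l = true
      · simp only [hτ, if_true] at h2 ⊢
        simpa [Holds, cnomTuple, hτ] using h2
      · simp only [hτ] at h2 ⊢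
        simpa [Holds, cnomTuple, hτ] using h2
    · by_cases hτ : τ l = true
      · simp [cnomTuple, hτ, hl, evalIn]
      · simp [cnomTuple, hτ, hl, evalIn]

end Rules

/-! ### From the conclusions of a rule to its premise, with ordinary fixed points -/

section Std

variable {C : Type v}

def Assignment.setNom (V : Assignment C) (j : ℕ) (x : C) : Assignment C :=
  { V with nom := Function.update V.nom j x }

def Assignment.setCnom (V : Assignment C) (m : ℕ) (x : C) : Assignment C :=
  { V with cnom := Function.update V.cnom m x }

/-- The assignments differ at most at the nominals in `FN` and the co-nominals in `FC`. -/
structure Variant (FN FC : ℕ → Prop) (V V' : Assignment C) : Prop where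
  var_eq : V'.var = V.var
  nom_eq : ∀ j, ¬ FN j → V'.nom j = V.nom j
  cnom_eq : ∀ m, ¬ FC m → V'.cnom m = V.cnom m

theorem Variant.refl (FN FC : ℕ → Prop) (V : Assignment C) : Variant FN FC V V :=
  ⟨rfl, fun _ _ => rfl, fun _ _ => rfl⟩

theorem Variant.setNom {FN FC : ℕ → Prop} {V V' : Assignment C} (h : Variant FN FC V V') {j : ℕ}
    (hj : FN j) (x : C) : Variant FN FC V (V'.setNom j x) :=
  ⟨h.var_eq, fun i hi => by
    have hij : i ≠ j := fun hij => hi (hij ▸ hj)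
    simpa [Assignment.setNom, hij] using h.nom_eq i hi, h.cnom_eq⟩

theorem Variant.setCnom {FN FC : ℕ → Prop} {V V' : Assignment C} (h : Variant FN FC V V') {m : ℕ}
    (hm : FC m) (x : C) : Variant FN FC V (V'.setCnom m x) :=
  ⟨h.var_eq, h.nom_eq, fun i hi => by
    have him : i ≠ m := fun him => hi (him ▸ hm)
    simpa [Assignment.setCnom, him] using h.cnom_eq i hi⟩

variable [CompleteLattice C] {box dia : C → C}

theorem Assignment.Respects.setNom {V : Assignment C} (hV : V.Respects) (j : ℕ) {x : C}
    (hx : IsCompletelyJoinIrreducible x) : (V.setNom j x).Respects := by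
  refine ⟨fun i => ?_, hV.2⟩
  by_cases h : i = j
  · subst h
    simpa [Assignment.setNom] using hx
  · simpa [Assignment.setNom, h] using hV.1 i

theorem Assignment.Respects.setCnom {V : Assignment C} (hV : V.Respects) (m : ℕ) {x : C}
    (hx : IsCompletelyMeetIrreducible x) : (V.setCnom m x).Respects := by
  refine ⟨hV.1, fun i => ?_⟩
  by_cases h : i = m
  · subst h
    simpa [Assignment.setCnom] using hx
  · simpa [Assignment.setCnom, h] using hV.2 i

theorem Variant.evalIn_eq (hP : IsPerfect box dia) {FN FC : ℕ → Prop} {V V' : Assignment C}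
    (h : Variant FN FC V V') {K : Set C} {β : Type} {n : ℕ} {t : Term β n}
    (hN : ∀ j, FN j → t.NomFree j) (hC : ∀ m, FC m → t.CnomFree m) (env : Fin n → C) :
    evalIn K box dia V' t env = evalIn K box dia V t env :=
  evalIn_congr hP.box_mono hP.dia_mono (fun _ _ => by rw [h.var_eq]) (fun _ _ => rfl)
    (fun j hj => h.nom_eq j (mt (hN j) hj)) (fun m hm => h.cnom_eq m (mt (hC m) hm))

/-- The tuple of values of `nomTuple`. -/
theorem evalIn_nomTuple {K : Set C} {V : Assignment C} {n : ℕ} {τ : Fin n → Bool} {k : Fin n}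
    {c : ℕ} {x : C} (hx : (if τ k then V.nom c else V.cnom c) = x) :
    (fun l => evalIn K box dia V (nomTuple τ k c l) Fin.elim0) = singleTuple τ k x := by
  subst hx
  funext l
  by_cases hl : l = k
  · subst hl
    by_cases hτ : τ l = true <;> simp [nomTuple, singleTuple, hτ, evalIn]
  · by_cases hτ : τ l = true <;> simp [nomTuple, singleTuple, hτ, hl, evalIn]

/-- The tuple of values of `cnomTuple`. -/
theorem evalIn_cnomTuple {K : Set C} {V : Assignment C} {n : ℕ} {τ : Fin n → Bool} {k : Fin n}
    {c : ℕ} {x : C} (hx : (if τ k then V.cnom c else V.nom c) = x) :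
    (fun l => evalIn K box dia V (cnomTuple τ k c l) Fin.elim0) =
      singleTuple (C := Cᵒᵈ) τ k x := by
  subst hx
  funext l
  by_cases hl : l = k
  · subst hl
    by_cases hτ : τ l = true <;> simp [cnomTuple, singleTuple, hτ, evalIn]
  · by_cases hτ : τ l = true
    · simp only [cnomTuple, singleTuple, hτ, hl, evalIn, if_true, if_false]
      rfl
    · simp only [cnomTuple, singleTuple, hτ, hl, if_false]
      rfl

theorem good_nomTuple {n : ℕ} (τ : Fin n → Bool) (k : Fin n) (c : ℕ) (l : Fin n) (s : Bool) :
    Good s (nomTuple τ k c l) := by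
  unfold nomTuple
  split_ifs <;> exact True.intro

theorem good_cnomTuple {n : ℕ} (τ : Fin n → Bool) (k : Fin n) (c : ℕ) (l : Fin n) (s : Bool) :
    Good s (cnomTuple τ k c l) := by
  unfold cnomTuple
  split_ifs <;> exact True.intro

variable (L : PerfectLaws box dia)
include L

/-- Given `hsign`, the negated sign condition says that placeholder `k` really occurs in `ψ`. This
makes the term put in its place visible in the premise, so that its freshness and its `Good`
property can be inherited from there. -/
theorem exists_nominal_mu {n : ℕ} {τ : Fin n → Bool} {ψ : Term Bool (n + 1)}
    (hsign : ∀ k, ψ.FVarSign k.succ (τ k)) (hJP : JoinPreserving.{v} ψ τ) {V : Assignment C}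
    (hV : V.Respects) {i : C} (hi : IsCompletelyJoinIrreducible i) {b : Bool} {x : Fin n → C}
    (h : i ≤ evalIn Set.univ box dia V (.mu b ψ) x) :
    ∃ k, ¬ ψ.FVarSign k.succ (!(τ k)) ∧ ∃ j, (if τ k then IsCompletelyJoinIrreducible j ∧ j ≤ x k
      else IsCompletelyMeetIrreducible j ∧ x k ≤ j) ∧
      i ≤ evalIn Set.univ box dia V (.mu b ψ) (singleTuple τ k j) := by
  simp only [evalIn, Set.mem_univ, true_and] at h ⊢
  refine exists_singleTuple L.joinDense L.meetDense (G := evalIn Set.univ box dia V ψ)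
    (fun S => ?_) (fun c x x' hx => ?_) (L.joinPrime hi) h
  · have := hJP C box dia L.perfect V hV S
    have heq : evalIn Set.univ box dia V ψ = eval box dia V ψ := funext (evalIn_univ V ψ)
    rw [heq]
    exact this
  · refine evalIn_congr L.perfect.box_mono L.perfect.dia_mono (fun _ _ => rfl) ?_ (fun _ _ => rfl)
      (fun _ _ => rfl)
    intro l
    refine Fin.cases (fun _ => rfl) (fun k hk => hx k fun hk' => hk ?_) l
    have := hsign k
    cases hτ : τ k <;> simp_all

theorem exists_conominal_nu {n : ℕ} {τ : Fin n → Bool} {φ : Term Bool (n + 1)}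
    (hsign : ∀ k, φ.FVarSign k.succ (τ k)) (hMP : MeetPreserving.{v} φ τ) {V : Assignment C}
    (hV : V.Respects) {m : C} (hm : IsCompletelyMeetIrreducible m) {b : Bool} {x : Fin n → C}
    (h : evalIn Set.univ box dia V (.nu b φ) x ≤ m) :
    ∃ k, ¬ φ.FVarSign k.succ (!(τ k)) ∧ ∃ j, (if τ k then IsCompletelyMeetIrreducible j ∧ x k ≤ j
      else IsCompletelyJoinIrreducible j ∧ j ≤ x k) ∧
      evalIn Set.univ box dia V (.nu b φ) (singleTuple (C := Cᵒᵈ) τ k j) ≤ m := by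
  simp only [evalIn, Set.mem_univ, true_and] at h ⊢
  refine exists_singleTuple (C := Cᵒᵈ) L.meetDense L.joinDense
    (G := evalIn Set.univ box dia V φ)
    (fun S => ?_) (fun c x x' hx => ?_) (L.meetPrime hm) h
  · have := hMP C box dia L.perfect V hV S
    have heq : evalIn Set.univ box dia V φ = eval box dia V φ := funext (evalIn_univ V φ)
    rw [heq]
    exact this
  · refine evalIn_congr L.perfect.box_mono L.perfect.dia_mono (fun _ _ => rfl) ?_ (fun _ _ => rfl)
      (fun _ _ => rfl)
    intro l
    refine Fin.cases (fun _ => rfl) (fun k hk => hx k fun hk' => hk ?_) l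
    have := hsign k
    cases hτ : τ k <;> simp_all

/-- If the premise of a rule holds, some alternative conclusion holds after a suitable choice of
the fresh nominals and co-nominals. -/
theorem Rule.exists_holds {FN FC : ℕ → Prop} {I : Ineq Bool} {D : List (List (Ineq Bool))}
    (h : Rule.{v} FN FC I D) (hN : ∀ j, FN j → I.lhs.NomFree j ∧ I.rhs.NomFree j)
    (hC : ∀ m, FC m → I.lhs.CnomFree m ∧ I.rhs.CnomFree m) {V : Assignment C} (hV : V.Respects)
    (hI : Holds Set.univ box dia V I) (hg : GoodIneq I) :
    ∃ Is ∈ D, (∀ J ∈ Is, GoodIneq J) ∧ ∃ V' : Assignment C, V'.Respects ∧ Variant FN FC V V' ∧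
      ∀ J ∈ Is, Holds Set.univ box dia V' J := by
  have hP := L.perfect
  obtain ⟨hg1, hg2⟩ := hg
  cases h with
  | subLR χ ψ φ =>
    refine ⟨_, List.mem_cons_self, ?_, V, hV, .refl _ _ _, ?_⟩ <;> rw [List.forall_mem_singleton]
    · exact ⟨hg1.1, hg1.2, hg2⟩
    · exact (L.sub_le_iff _ _ _).1 hI
  | impRR φ χ ψ =>
    refine ⟨_, List.mem_cons_self, ?_, V, hV, .refl _ _ _, ?_⟩ <;> rw [List.forall_mem_singleton]
    · exact ⟨⟨hg1, hg2.1⟩, hg2.2⟩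
    · exact (L.le_imp_iff _ _ _).1 hI
  | andLR χ ψ φ =>
    refine ⟨_, List.mem_cons_self, ?_, V, hV, .refl _ _ _, ?_⟩ <;> rw [List.forall_mem_singleton]
    · exact ⟨hg1.1, hg1.2, hg2⟩
    · exact (L.le_imp_iff _ _ _).2 hI
  | andLR_comm χ ψ φ =>
    refine ⟨_, List.mem_cons_self, ?_, V, hV, .refl _ _ _, ?_⟩ <;> rw [List.forall_mem_singleton]
    · exact ⟨hg1.2, hg1.1, hg2⟩
    · exact (L.le_imp_iff _ _ _).2 ((inf_comm _ _).trans_le hI)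
  | orRR φ χ ψ =>
    refine ⟨_, List.mem_cons_self, ?_, V, hV, .refl _ _ _, ?_⟩ <;> rw [List.forall_mem_singleton]
    · exact ⟨⟨hg1, hg2.1⟩, hg2.2⟩
    · exact (L.sub_le_iff _ _ _).2 hI
  | orRR_comm φ χ ψ =>
    refine ⟨_, List.mem_cons_self, ?_, V, hV, .refl _ _ _, ?_⟩ <;> rw [List.forall_mem_singleton]
    · exact ⟨⟨hg1, hg2.2⟩, hg2.1⟩
    · exact (L.sub_le_iff _ _ _).2 (hI.trans_eq (sup_comm _ _))
  | orLA φ χ ψ =>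
    refine ⟨_, List.mem_cons_self, ?_, V, hV, .refl _ _ _, ?_⟩ <;>
      rw [List.forall_mem_cons, List.forall_mem_singleton]
    · exact ⟨⟨hg1.1, hg2⟩, hg1.2, hg2⟩
    · exact ⟨le_trans le_sup_left hI, le_trans le_sup_right hI⟩
  | andRA ψ φ χ =>
    refine ⟨_, List.mem_cons_self, ?_, V, hV, .refl _ _ _, ?_⟩ <;>
      rw [List.forall_mem_cons, List.forall_mem_singleton]
    · exact ⟨⟨hg1, hg2.1⟩, hg1, hg2.2⟩
    · exact ⟨le_trans hI inf_le_left, le_trans hI inf_le_right⟩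
  | diaLA φ ψ =>
    refine ⟨_, List.mem_cons_self, ?_, V, hV, .refl _ _ _, ?_⟩ <;> rw [List.forall_mem_singleton]
    · exact ⟨hg1, hg2⟩
    · exact (hP.le_bbox_iff _ _).2 hI
  | boxRA φ ψ =>
    refine ⟨_, List.mem_cons_self, ?_, V, hV, .refl _ _ _, ?_⟩ <;> rw [List.forall_mem_singleton]
    · exact ⟨hg1, hg2⟩
    · exact (hP.bdia_le_iff _ _).2 hI
  | boxAppr ψ m n hn =>
    obtain ⟨x, hx, hψx, hxm⟩ := L.exists_box (hV.2 m) hI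
    have hvar := (Variant.refl FN FC V).setCnom hn x
    have hm : (V.setCnom n x).cnom m = V.cnom m := Function.update_of_ne (hC n hn).2 _ _
    have hψ := hvar.evalIn_eq hP (K := Set.univ) (t := ψ) (fun j hj => (hN j hj).1)
      (fun j hj => (hC j hj).1) Fin.elim0
    have hx' : (V.setCnom n x).cnom n = x := Function.update_self _ _ _
    refine ⟨_, List.mem_cons_self, ?_, _, hV.setCnom n hx, hvar, ?_⟩ <;>
      rw [List.forall_mem_cons, List.forall_mem_singleton]
    · exact ⟨⟨True.intro, True.intro⟩, hg1, True.intro⟩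
    · simp only [Holds, evalIn, hx', hm, hψ]
      exact ⟨hxm, hψx⟩
  | diaAppr ψ j i hi =>
    obtain ⟨x, hx, hxψ, hjx⟩ := L.exists_dia (hV.1 j) hI
    have hvar := (Variant.refl FN FC V).setNom hi x
    have hj : (V.setNom i x).nom j = V.nom j := Function.update_of_ne (hN i hi).1 _ _
    have hψ := hvar.evalIn_eq hP (K := Set.univ) (t := ψ) (fun j hj => (hN j hj).2)
      (fun j hj => (hC j hj).2) Fin.elim0
    have hx' : (V.setNom i x).nom i = x := Function.update_self _ _ _
    refine ⟨_, List.mem_cons_self, ?_, _, hV.setNom i hx, hvar, ?_⟩ <;>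
      rw [List.forall_mem_cons, List.forall_mem_singleton]
    · exact ⟨⟨True.intro, True.intro⟩, True.intro, hg2⟩
    · simp only [Holds, evalIn, hx', hj, hψ]
      exact ⟨hjx, hxψ⟩
  | impAppr χ φ m j n hj hn =>
    obtain ⟨x, y, hx, hy, hxχ, hφy, hle⟩ := L.exists_imp (hV.2 m) hI
    have hvar := ((Variant.refl FN FC V).setNom hj x).setCnom hn y
    have hm : ((V.setNom j x).setCnom n y).cnom m = V.cnom m :=
      Function.update_of_ne (hC n hn).2 _ _
    have hφ := hvar.evalIn_eq hP (K := Set.univ) (t := φ) (fun j hj => (hN j hj).1.2)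
      (fun j hj => (hC j hj).1.2) Fin.elim0
    have hχ := hvar.evalIn_eq hP (K := Set.univ) (t := χ) (fun j hj => (hN j hj).1.1)
      (fun j hj => (hC j hj).1.1) Fin.elim0
    have hx' : ((V.setNom j x).setCnom n y).nom j = x := Function.update_self _ _ _
    have hy' : ((V.setNom j x).setCnom n y).cnom n = y := Function.update_self _ _ _
    refine ⟨_, List.mem_cons_self, ?_, _, (hV.setNom j hx).setCnom n hy, hvar, ?_⟩ <;>
      rw [List.forall_mem_cons, List.forall_mem_cons, List.forall_mem_singleton]
    · exact ⟨⟨⟨True.intro, True.intro⟩, True.intro⟩, ⟨True.intro, hg1.1⟩, hg1.2, True.intro⟩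
    · simp only [Holds, evalIn, hx', hy', hm, hφ, hχ]
      exact ⟨hle, hxχ, hφy⟩
  | subAppr χ φ i j n hj hn =>
    obtain ⟨x, y, hx, hy, hxχ, hφy, hle⟩ := L.exists_sub (hV.1 i) hI
    have hvar := ((Variant.refl FN FC V).setNom hj x).setCnom hn y
    have hm : ((V.setNom j x).setCnom n y).nom i = V.nom i :=
      Function.update_of_ne (hN j hj).1 _ _
    have hφ := hvar.evalIn_eq hP (K := Set.univ) (t := φ) (fun j hj => (hN j hj).2.2)
      (fun j hj => (hC j hj).2.2) Fin.elim0
    have hχ := hvar.evalIn_eq hP (K := Set.univ) (t := χ) (fun j hj => (hN j hj).2.1)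
      (fun j hj => (hC j hj).2.1) Fin.elim0
    have hx' : ((V.setNom j x).setCnom n y).nom j = x := Function.update_self _ _ _
    have hy' : ((V.setNom j x).setCnom n y).cnom n = y := Function.update_self _ _ _
    refine ⟨_, List.mem_cons_self, ?_, _, (hV.setNom j hx).setCnom n hy, hvar, ?_⟩ <;>
      rw [List.forall_mem_cons, List.forall_mem_cons, List.forall_mem_singleton]
    · exact ⟨⟨True.intro, True.intro, True.intro⟩, ⟨True.intro, hg2.1⟩, hg2.2, True.intro⟩
    · simp only [Holds, evalIn, hx', hy', hm, hφ, hχ]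
      exact ⟨hle, hxχ, hφy⟩
  | muAppr τ b ψ φ i c hpure hsign hJP hc =>
    have hI' : V.nom i ≤ evalIn Set.univ box dia V ((Term.mu b ψ).subst φ) Fin.elim0 := hI
    rw [evalIn_subst] at hI'
    obtain ⟨k, hk, x, hx, hle⟩ := exists_nominal_mu L hsign hJP hV (hV.1 i) hI'
    have hg' : Good true (((Term.mu b ψ).handle true).subst (nomTuple τ k (c k))) :=
      Good.subst (good_nomTuple τ k (c k)) (Good.of_subst hg2).handle
    have hk' : ¬ (Term.mu b ψ).FVarSign k (!(τ k)) := hk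
    refine ⟨_, (List.mem_ofFn' _ _).2 ⟨k, rfl⟩, ?_, ?_⟩
    · rw [List.forall_mem_cons, List.forall_mem_singleton]
      refine ⟨⟨True.intro, hg'⟩, ?_⟩
      cases hτ : τ k
      · have := Good.of_subst_occ hk' hg2
        rw [hτ] at this
        exact ⟨this, True.intro⟩
      · have := Good.of_subst_occ hk' hg2
        rw [hτ] at this
        exact ⟨True.intro, this⟩
    · have hev : ∀ {V' : Assignment C}, Variant FN FC V V' → ∀ y,
          evalIn Set.univ box dia V' (.mu b ψ) y = evalIn Set.univ box dia V (.mu b ψ) y :=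
        fun hvar y => hvar.evalIn_eq hP (fun j hj => Term.NomFree.of_subst (hN j hj).2)
          (fun j hj => Term.CnomFree.of_subst (hC j hj).2) y
      have hev' : ∀ {V' : Assignment C}, Variant FN FC V V' →
          evalIn Set.univ box dia V' (φ k) Fin.elim0 = evalIn Set.univ box dia V (φ k) Fin.elim0 :=
        fun hvar => hvar.evalIn_eq hP (fun j hj => Term.NomFree.of_subst_occ hk' (hN j hj).2)
          (fun j hj => Term.CnomFree.of_subst_occ hk' (hC j hj).2) _
      have hck := hc k
      cases hτ : τ k
      · rw [hτ] at hx hck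
        have hvar := (Variant.refl FN FC V).setCnom hck x
        refine ⟨V.setCnom (c k) x, hV.setCnom _ hx.1, hvar, ?_⟩
        rw [List.forall_mem_cons, List.forall_mem_singleton]
        have hx' : (V.setCnom (c k) x).cnom (c k) = x := Function.update_self _ _ _
        constructor
        · change V.nom i ≤ evalIn _ _ _ _ _ _
          rw [evalIn_subst, evalIn_handle, evalIn_nomTuple (x := x) (by simpa [hτ] using hx'),
            hev hvar]
          exact hle
        · rw [if_neg (by simp [hτ])]
          exact (hev' hvar).trans_le (hx.2.trans_eq hx'.symm)
      · rw [hτ] at hx hck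
        have hvar := (Variant.refl FN FC V).setNom hck x
        refine ⟨V.setNom (c k) x, hV.setNom _ hx.1, hvar, ?_⟩
        rw [List.forall_mem_cons, List.forall_mem_singleton]
        have hx' : (V.setNom (c k) x).nom (c k) = x := Function.update_self _ _ _
        have hi' : (V.setNom (c k) x).nom i = V.nom i := Function.update_of_ne (hN _ hck).1 _ _
        constructor
        · change (V.setNom (c k) x).nom i ≤ evalIn _ _ _ _ _ _
          rw [evalIn_subst, evalIn_handle, evalIn_nomTuple (x := x) (by simpa [hτ] using hx'),
            hev hvar, hi']
          exact hle
        · rw [if_pos hτ]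
          exact (hx'.trans_le hx.2).trans_eq (hev' hvar).symm
  | nuAppr τ b φ ψ m c hpure hsign hMP hc =>
    have hI' : evalIn Set.univ box dia V ((Term.nu b φ).subst ψ) Fin.elim0 ≤ V.cnom m := hI
    rw [evalIn_subst] at hI'
    obtain ⟨k, hk, x, hx, hle⟩ := exists_conominal_nu L hsign hMP hV (hV.2 m) hI'
    have hg' : Good false (((Term.nu b φ).handle false).subst (cnomTuple τ k (c k))) :=
      Good.subst (good_cnomTuple τ k (c k)) (Good.of_subst hg1).handle
    have hk' : ¬ (Term.nu b φ).FVarSign k (!(τ k)) := hk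
    refine ⟨_, (List.mem_ofFn' _ _).2 ⟨k, rfl⟩, ?_, ?_⟩
    · rw [List.forall_mem_cons, List.forall_mem_singleton]
      refine ⟨⟨hg', True.intro⟩, ?_⟩
      cases hτ : τ k
      · have := Good.of_subst_occ hk' hg1
        rw [hτ] at this
        exact ⟨True.intro, this⟩
      · have := Good.of_subst_occ hk' hg1
        rw [hτ] at this
        exact ⟨this, True.intro⟩
    · have hev : ∀ {V' : Assignment C}, Variant FN FC V V' → ∀ y,
          evalIn Set.univ box dia V' (.nu b φ) y = evalIn Set.univ box dia V (.nu b φ) y :=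
        fun hvar y => hvar.evalIn_eq hP (fun j hj => Term.NomFree.of_subst (hN j hj).1)
          (fun j hj => Term.CnomFree.of_subst (hC j hj).1) y
      have hev' : ∀ {V' : Assignment C}, Variant FN FC V V' →
          evalIn Set.univ box dia V' (ψ k) Fin.elim0 = evalIn Set.univ box dia V (ψ k) Fin.elim0 :=
        fun hvar => hvar.evalIn_eq hP (fun j hj => Term.NomFree.of_subst_occ hk' (hN j hj).1)
          (fun j hj => Term.CnomFree.of_subst_occ hk' (hC j hj).1) _
      have hck := hc k
      cases hτ : τ k
      · rw [hτ] at hx hck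
        have hvar := (Variant.refl FN FC V).setNom hck x
        refine ⟨V.setNom (c k) x, hV.setNom _ hx.1, hvar, ?_⟩
        rw [List.forall_mem_cons, List.forall_mem_singleton]
        have hx' : (V.setNom (c k) x).nom (c k) = x := Function.update_self _ _ _
        constructor
        · change evalIn _ _ _ _ _ _ ≤ V.cnom m
          rw [evalIn_subst, evalIn_handle, hev hvar]
          refine le_trans (le_of_eq (congrArg _ (evalIn_cnomTuple (x := x) ?_))) hle
          simpa [hτ] using hx'
        · rw [if_neg (by simp [hτ])]
          exact (hx'.trans_le hx.2).trans_eq (hev' hvar).symm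
      · rw [hτ] at hx hck
        have hvar := (Variant.refl FN FC V).setCnom hck x
        refine ⟨V.setCnom (c k) x, hV.setCnom _ hx.1, hvar, ?_⟩
        rw [List.forall_mem_cons, List.forall_mem_singleton]
        have hx' : (V.setCnom (c k) x).cnom (c k) = x := Function.update_self _ _ _
        have hi' : (V.setCnom (c k) x).cnom m = V.cnom m :=
          Function.update_of_ne (hC _ hck).2 _ _
        constructor
        · change evalIn _ _ _ _ _ _ ≤ (V.setCnom (c k) x).cnom m
          rw [evalIn_subst, evalIn_handle, hev hvar, hi']
          refine le_trans (le_of_eq (congrArg _ (evalIn_cnomTuple (x := x) ?_))) hle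
          simpa [hτ] using hx'
        · rw [if_pos hτ]
          exact (hev' hvar).trans_le (hx.2.trans_eq hx'.symm)

end Std

/-! ### Rules on quasi-inequalities, with ordinary fixed points -/

section QStd

variable {C : Type v} [CompleteLattice C] {K : Set C} {box dia : C → C}

theorem le_bigOr (V : Assignment C) {l : List (Term Bool 0)} {α : Term Bool 0} (h : α ∈ l) :
    evalIn K box dia V α Fin.elim0 ≤ evalIn K box dia V (bigOr l) Fin.elim0 := by
  induction l using bigOr.induct with
  | case1 => simp at h
  | case2 a =>
    rw [List.mem_singleton] at h
    subst h
    exact le_rfl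
  | case3 a b l ih =>
    rcases List.mem_cons.1 h with rfl | h
    · exact le_sup_left
    · exact (ih h).trans le_sup_right

theorem bigOr_le (V : Assignment C) {l : List (Term Bool 0)} {x : C}
    (h : ∀ α ∈ l, evalIn K box dia V α Fin.elim0 ≤ x) :
    evalIn K box dia V (bigOr l) Fin.elim0 ≤ x := by
  induction l using bigOr.induct with
  | case1 => exact bot_le
  | case2 a => exact h a (by simp)
  | case3 a b l ih => exact sup_le (h a (by simp)) (ih fun α hα => h α (List.mem_cons_of_mem _ hα))

theorem bigAnd_le (V : Assignment C) {l : List (Term Bool 0)} {α : Term Bool 0} (h : α ∈ l) :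
    evalIn K box dia V (bigAnd l) Fin.elim0 ≤ evalIn K box dia V α Fin.elim0 := by
  induction l using bigAnd.induct with
  | case1 => simp at h
  | case2 a =>
    rw [List.mem_singleton] at h
    subst h
    exact le_rfl
  | case3 a b l ih =>
    rcases List.mem_cons.1 h with rfl | h
    · exact inf_le_left
    · exact inf_le_right.trans (ih h)

theorem le_bigAnd (V : Assignment C) {l : List (Term Bool 0)} {x : C}
    (h : ∀ α ∈ l, x ≤ evalIn K box dia V α Fin.elim0) :
    x ≤ evalIn K box dia V (bigAnd l) Fin.elim0 := by
  induction l using bigAnd.induct with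
  | case1 => exact le_top
  | case2 a => exact h a (by simp)
  | case3 a b l ih => exact le_inf (h a (by simp)) (ih fun α hα => h α (List.mem_cons_of_mem _ hα))

theorem good_bigOr {s : Bool} {l : List (Term Bool 0)} (h : ∀ α ∈ l, Good s α) :
    Good s (bigOr l) := by
  induction l using bigOr.induct with
  | case1 => exact True.intro
  | case2 a => exact h a (by simp)
  | case3 a b l ih => exact ⟨h a (by simp), ih fun α hα => h α (List.mem_cons_of_mem _ hα)⟩

theorem good_bigAnd {s : Bool} {l : List (Term Bool 0)} (h : ∀ α ∈ l, Good s α) :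
    Good s (bigAnd l) := by
  induction l using bigAnd.induct with
  | case1 => exact True.intro
  | case2 a => exact h a (by simp)
  | case3 a b l ih => exact ⟨h a (by simp), ih fun α hα => h α (List.mem_cons_of_mem _ hα)⟩

theorem syn_bigOr {s : Bool} {l : List (Term Bool 0)} (h : ∀ α ∈ l, α.Syn s) : (bigOr l).Syn s := by
  induction l using bigOr.induct with
  | case1 => exact True.intro
  | case2 a => exact h a (by simp)
  | case3 a b l ih => exact ⟨h a (by simp), ih fun α hα => h α (List.mem_cons_of_mem _ hα)⟩

theorem syn_bigAnd {s : Bool} {l : List (Term Bool 0)} (h : ∀ α ∈ l, α.Syn s) :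
    (bigAnd l).Syn s := by
  induction l using bigAnd.induct with
  | case1 => exact True.intro
  | case2 a => exact h a (by simp)
  | case3 a b l ih => exact ⟨h a (by simp), ih fun α hα => h α (List.mem_cons_of_mem _ hα)⟩

theorem varFree_bigOr {p : ℕ} {l : List (Term Bool 0)} (h : ∀ α ∈ l, α.VarFree p) :
    (bigOr l).VarFree p := by
  induction l using bigOr.induct with
  | case1 => exact True.intro
  | case2 a => exact h a (by simp)
  | case3 a b l ih => exact ⟨h a (by simp), ih fun α hα => h α (List.mem_cons_of_mem _ hα)⟩

theorem varFree_bigAnd {p : ℕ} {l : List (Term Bool 0)} (h : ∀ α ∈ l, α.VarFree p) :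
    (bigAnd l).VarFree p := by
  induction l using bigAnd.induct with
  | case1 => exact True.intro
  | case2 a => exact h a (by simp)
  | case3 a b l ih => exact ⟨h a (by simp), ih fun α hα => h α (List.mem_cons_of_mem _ hα)⟩

/-! ### Changing the value of one propositional variable. -/

theorem Assignment.setVar_self {X : Type v} (V : Assignment X) (p : ℕ) : V.setVar p (V.var p) = V := by
  simp [Assignment.setVar]

theorem Assignment.Respects.setVar {V : Assignment C} (hV : V.Respects) (p : ℕ) (x : C) :
    (V.setVar p x).Respects := hV

theorem Assignment.setVar_mem {X : Type v} {K : Set X} {V : Assignment X}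
    (hV : ∀ q, V.var q ∈ K) (p : ℕ) {x : X} (hx : x ∈ K) (q : ℕ) : (V.setVar p x).var q ∈ K := by
  by_cases h : q = p
  · subst h
    simpa [Assignment.setVar] using hx
  · simpa [Assignment.setVar, h] using hV q

variable {β : Type}

theorem evalIn_setVar_mono (hP : IsPerfect box dia) {V : Assignment C} {p : ℕ} {x y : C}
    (hxy : x ≤ y) {n : ℕ} {t : Term β n} (ht : t.VarSign p true) (env : Fin n → C) :
    evalIn K box dia (V.setVar p x) t env ≤ evalIn K box dia (V.setVar p y) t env := by
  refine evalIn_mono hP.box_mono hP.dia_mono ⟨fun q _ => ?_, fun q hq => ?_, fun _ _ => le_rfl,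
    fun _ _ => le_rfl, fun _ _ => rfl, fun _ _ => rfl⟩
  · by_cases h : q = p
    · subst h
      simpa [Assignment.setVar] using hxy
    · simp [Assignment.setVar, h]
  · have h : q ≠ p := fun h => hq (h ▸ ht)
    simp [Assignment.setVar, h]

theorem evalIn_setVar_anti (hP : IsPerfect box dia) {V : Assignment C} {p : ℕ} {x y : C}
    (hxy : x ≤ y) {n : ℕ} {t : Term β n} (ht : t.VarSign p false) (env : Fin n → C) :
    evalIn K box dia (V.setVar p y) t env ≤ evalIn K box dia (V.setVar p x) t env := by
  refine evalIn_mono hP.box_mono hP.dia_mono ⟨fun q hq => ?_, fun q _ => ?_, fun _ _ => le_rfl,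
    fun _ _ => le_rfl, fun _ _ => rfl, fun _ _ => rfl⟩
  · have h : q ≠ p := fun h => hq (h ▸ ht)
    simp [Assignment.setVar, h]
  · by_cases h : q = p
    · subst h
      simpa [Assignment.setVar] using hxy
    · simp [Assignment.setVar, h]

theorem evalIn_setVar_of_varFree (hP : IsPerfect box dia) {V : Assignment C} {p : ℕ} {x : C}
    {n : ℕ} {t : Term β n} (ht : t.VarFree p) (env : Fin n → C) :
    evalIn K box dia (V.setVar p x) t env = evalIn K box dia V t env := by
  refine evalIn_congr hP.box_mono hP.dia_mono (fun q hq => ?_) (fun _ _ => rfl) (fun _ _ => rfl)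
    (fun _ _ => rfl)
  have h : q ≠ p := fun h => hq (h ▸ ht)
  simp [Assignment.setVar, h]

def GoodQ (Q : QIneq) : Prop := ∀ I ∈ Q.ants, GoodIneq I

theorem validIn_firstApprox_iff {i m : ℕ} {I : Ineq Unit} :
    ValidIn K box dia (firstApprox i m I) ↔ ∀ V : Assignment C, V.Respects → (∀ p, V.var p ∈ K) →
      V.nom i ≤ evalIn K box dia V I.lhs Fin.elim0 →
      evalIn K box dia V I.rhs Fin.elim0 ≤ V.cnom m → V.nom i ≤ V.cnom m := by
  simp only [ValidIn, firstApprox, List.forall_mem_cons, Holds, evalIn_star, evalIn]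
  simp

variable (L : PerfectLaws box dia)
include L

/-- An assignment satisfying the premise's antecedent is turned into one satisfying the antecedent
of some conclusion, without touching the nominal and co-nominal of the consequent. The `Good`
invariant is passed along, so validity of conclusions is needed only for good ones. -/
theorem QRule.validIn_univ {Q : QIneq} {Qs : List QIneq} (h : QRule.{v} Q Qs) (hg : GoodQ Q)
    (H : ∀ Q' ∈ Qs, GoodQ Q' → ValidIn Set.univ box dia Q') : ValidIn Set.univ box dia Q := by
  have hP := L.perfect
  intro V hV _ hants
  cases h with
  | single l₁ l₂ I i m D hr =>
    have hI : I ∈ l₁ ++ I :: l₂ := by simp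
    obtain ⟨Is, hIs, hgood, V', hV', hvar, hholds⟩ := hr.exists_holds L (fun j hj => hj.2 I hI)
      (fun m hm => hm.2 I hI) hV (hants I hI) (hg I hI)
    have hle := H ⟨l₁ ++ Is ++ l₂, i, m⟩ (List.mem_map.2 ⟨Is, hIs, rfl⟩) ?_ V' hV'
      (fun _ => Set.mem_univ _) ?_
    · rw [hvar.nom_eq i fun hi => hi.1 rfl, hvar.cnom_eq m fun hm => hm.1 rfl] at hle
      exact hle
    · intro J hJ
      rcases List.mem_append.1 hJ with hJ | hJ
      · rcases List.mem_append.1 hJ with hJ | hJ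
        · exact hg J (by simp [hJ])
        · exact hgood J hJ
      · exact hg J (by simp [hJ])
    · have hother : ∀ J ∈ l₁ ++ I :: l₂, Holds Set.univ box dia V' J := by
        intro J hJ
        unfold Holds
        rw [hvar.evalIn_eq hP (fun j hj => (hj.2 J hJ).1) (fun j hj => (hj.2 J hJ).1),
          hvar.evalIn_eq hP (fun j hj => (hj.2 J hJ).2) (fun j hj => (hj.2 J hJ).2)]
        exact hants J hJ
      intro J hJ
      rcases List.mem_append.1 hJ with hJ | hJ
      · rcases List.mem_append.1 hJ with hJ | hJ
        · exact hother J (by simp [hJ])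
        · exact hholds J hJ
      · exact hother J (by simp [hJ])
  | rightAckermann p αs Bs rest ants i m hperm hα hB hrest =>
    have hmem : ∀ J, J ∈ ants ↔ J ∈ αs.map (fun α => (⟨α, .var p⟩ : Ineq Bool)) ++ Bs ++ rest :=
      fun J => hperm.mem_iff
    have hgα : ∀ α ∈ αs, Good false α := fun α hα => (hg ⟨α, .var p⟩ ((hmem _).2 (by simp [hα]))).1
    have hle : evalIn Set.univ box dia V (bigOr αs) Fin.elim0 ≤ V.var p :=
      bigOr_le V fun α hα => hants ⟨α, .var p⟩ ((hmem _).2 (by simp [hα]))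
    -- The assignment is kept. The join of the `αs` is below the value of `p`, and lowering `p`
    -- shrinks the left and enlarges the right side of each inequality in `Bs`. No closed or open
    -- terms are needed here.
    refine H _ List.mem_cons_self ?_ V hV (fun _ => Set.mem_univ _) ?_
    · intro J hJ
      rcases List.mem_append.1 hJ with hJ | hJ
      · obtain ⟨I, hI, rfl⟩ := List.mem_map.1 hJ
        have hgI := hg I ((hmem _).2 (by simp [hI]))
        exact ⟨hgI.1.substVar (hB I hI).1 (good_bigOr hgα),
          hgI.2.substVar (hB I hI).2.2.1 (good_bigOr hgα)⟩
      · exact hg J ((hmem _).2 (by simp [hJ]))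
    · intro J hJ
      rcases List.mem_append.1 hJ with hJ | hJ
      · obtain ⟨I, hI, rfl⟩ := List.mem_map.1 hJ
        have hI' := hants I ((hmem _).2 (by simp [hI]))
        unfold Holds at hI' ⊢
        rw [← V.setVar_self p] at hI'
        rw [Ineq.substVar, evalIn_substVar, evalIn_substVar]
        exact (evalIn_setVar_mono hP hle (hB I hI).1 _).trans
          (hI'.trans (evalIn_setVar_anti hP hle (hB I hI).2.2.1 _))
      · exact hants J ((hmem _).2 (by simp [hJ]))
  | leftAckermann p αs Bs rest ants i m hperm hα hB hrest =>
    have hmem : ∀ J, J ∈ ants ↔ J ∈ αs.map (fun α => (⟨.var p, α⟩ : Ineq Bool)) ++ Bs ++ rest :=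
      fun J => hperm.mem_iff
    have hgα : ∀ α ∈ αs, Good true α := fun α hα => (hg ⟨.var p, α⟩ ((hmem _).2 (by simp [hα]))).2
    have hle : V.var p ≤ evalIn Set.univ box dia V (bigAnd αs) Fin.elim0 :=
      le_bigAnd V fun α hα => hants ⟨.var p, α⟩ ((hmem _).2 (by simp [hα]))
    refine H _ List.mem_cons_self ?_ V hV (fun _ => Set.mem_univ _) ?_
    · intro J hJ
      rcases List.mem_append.1 hJ with hJ | hJ
      · obtain ⟨I, hI, rfl⟩ := List.mem_map.1 hJ
        have hgI := hg I ((hmem _).2 (by simp [hI]))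
        exact ⟨hgI.1.substVar (hB I hI).1 (good_bigAnd hgα),
          hgI.2.substVar (hB I hI).2.2.1 (good_bigAnd hgα)⟩
      · exact hg J ((hmem _).2 (by simp [hJ]))
    · intro J hJ
      rcases List.mem_append.1 hJ with hJ | hJ
      · obtain ⟨I, hI, rfl⟩ := List.mem_map.1 hJ
        have hI' := hants I ((hmem _).2 (by simp [hI]))
        unfold Holds at hI' ⊢
        rw [← V.setVar_self p] at hI'
        rw [Ineq.substVar, evalIn_substVar, evalIn_substVar]
        exact (evalIn_setVar_anti hP hle (hB I hI).1 _).trans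
          (hI'.trans (evalIn_setVar_mono hP hle (hB I hI).2.2.1 _))
      · exact hants J ((hmem _).2 (by simp [hJ]))

/-- A pure quasi-inequality all whose binders have been handled. -/
theorem validIn_univ_of_pure {Q : QIneq} (hK : K.Nonempty) (hg : GoodQ Q)
    (hpure : ∀ I ∈ Q.ants, I.lhs.Pure ∧ I.rhs.Pure)
    (hh : ∀ I ∈ Q.ants, I.lhs.AllHandled ∧ I.rhs.AllHandled) (h : ValidIn K box dia Q) :
    ValidIn Set.univ box dia Q := by
  have hP := L.perfect
  intro V hV _ hants
  obtain ⟨x, hx⟩ := hK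
  -- Restricted validity speaks only of variables valued in `K`; as none occurs, a constant value
  -- will do.
  refine h { V with var := fun _ => x } hV (fun _ => hx) fun I hI => ?_
  have heq : ∀ t : Term Bool 0, t.Pure →
      evalIn K box dia { V with var := fun _ => x } t Fin.elim0 = evalIn K box dia V t Fin.elim0 :=
    fun t ht => evalIn_congr hP.box_mono hP.dia_mono (fun p hp => absurd (ht p) hp) (fun _ _ => rfl)
      (fun _ _ => rfl) (fun _ _ => rfl)
  unfold Holds
  rw [heq _ (hpure I hI).1, heq _ (hpure I hI).2]
  -- Restricted left side ≤ ordinary left side ≤ ordinary right side ≤ restricted right side.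
  exact ((eval_le_evalIn hP.box_mono hP.dia_mono V (hh I hI).1 _).2 (hg I hI).1).trans
    ((hants I hI).trans ((eval_le_evalIn hP.box_mono hP.dia_mono V (hh I hI).2 _).1 (hg I hI).2))

/-! ### Preprocessing -/

theorem Distr.evalIn_eq {s : Bool} {n : ℕ} {t t' : Term Unit n} (h : Distr s t t')
    (V : Assignment C) (env : Fin n → C) :
    evalIn K box dia V t env = evalIn K box dia V t' env := by
  induction h with
  | dia_or a b => exact L.perfect.dia_sup _ _
  | or_and a b c =>
    change (_ ⊔ _) ⊓ _ = (_ ⊓ _) ⊔ (_ ⊓ _)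
    rw [inf_comm, L.inf_sup, inf_comm, inf_comm (evalIn K box dia V c env)]
  | and_or a b c => exact L.inf_sup _ _ _
  | box_and a b => exact L.perfect.box_inf _ _
  | and_orN a b c =>
    change (_ ⊓ _) ⊔ _ = (_ ⊔ _) ⊓ (_ ⊔ _)
    rw [sup_comm, L.sup_inf, sup_comm, sup_comm (evalIn K box dia V c env)]
  | or_andN a b c => exact L.sup_inf _ _ _
  | _ => simp_all [evalIn]

/-- In this direction variable elimination is plain instantiation, which is why `⊥` and `⊤` must
belong to `K`. -/
theorem PreRule.validIn {I : Ineq Unit} {Is : List (Ineq Unit)} (h : PreRule I Is)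
    (hbot : ⊥ ∈ K) (htop : ⊤ ∈ K) {i m : ℕ} (H : ValidIn K box dia (firstApprox i m I)) :
    ∀ J ∈ Is, ValidIn K box dia (firstApprox i m J) := by
  simp only [validIn_firstApprox_iff] at H ⊢
  cases h with
  | distrL ψ hd =>
    rw [List.forall_mem_singleton]
    intro V hV hK h1 h2
    exact H V hV hK ((hd.evalIn_eq L V _).symm ▸ h1) h2
  | distrR φ hd =>
    rw [List.forall_mem_singleton]
    intro V hV hK h1 h2
    exact H V hV hK h1 ((hd.evalIn_eq L V _).symm ▸ h2)
  | orLA α β γ =>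
    rw [List.forall_mem_cons, List.forall_mem_singleton]
    exact ⟨fun V hV hK h1 h2 => H V hV hK (h1.trans le_sup_left) h2,
      fun V hV hK h1 h2 => H V hV hK (h1.trans le_sup_right) h2⟩
  | andRA α β γ =>
    rw [List.forall_mem_cons, List.forall_mem_singleton]
    exact ⟨fun V hV hK h1 h2 => H V hV hK h1 (le_trans inf_le_left h2),
      fun V hV hK h1 h2 => H V hV hK h1 (le_trans inf_le_right h2)⟩
  | elimBot p α β hα hβ =>
    rw [List.forall_mem_singleton]
    intro V hV hK h1 h2
    rw [evalIn_substVar] at h1 h2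
    exact H (V.setVar p ⊥) (hV.setVar p _) (Assignment.setVar_mem hK p hbot) h1 h2
  | elimTop p α β hα hβ =>
    rw [List.forall_mem_singleton]
    intro V hV hK h1 h2
    rw [evalIn_substVar] at h1 h2
    exact H (V.setVar p ⊤) (hV.setVar p _) (Assignment.setVar_mem hK p htop) h1 h2

/-- Splitting is reversed by primeness of the nominal and the co-nominal, and variable elimination
by the signs, since `⊥` or `⊤` is the extreme case of the inequality. -/
theorem PreRule.validIn_univ {I : Ineq Unit} {Is : List (Ineq Unit)} (h : PreRule I Is)
    {i m : ℕ} (H : ∀ J ∈ Is, ValidIn Set.univ box dia (firstApprox i m J)) :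
    ValidIn Set.univ box dia (firstApprox i m I) := by
  have hP := L.perfect
  simp only [validIn_firstApprox_iff] at H ⊢
  intro V hV hK h1 h2
  cases h with
  | distrL ψ hd =>
    rw [List.forall_mem_singleton] at H
    exact H V hV hK (hd.evalIn_eq L V _ ▸ h1) h2
  | distrR φ hd =>
    rw [List.forall_mem_singleton] at H
    exact H V hV hK h1 (hd.evalIn_eq L V _ ▸ h2)
  | orLA α β γ =>
    rw [List.forall_mem_cons, List.forall_mem_singleton] at H
    have h1' : V.nom i ≤ sSup {evalIn Set.univ box dia V α Fin.elim0,
        evalIn Set.univ box dia V β Fin.elim0} := by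
      rw [sSup_pair]
      exact h1
    obtain ⟨_, rfl | rfl, hx⟩ := L.joinPrime (hV.1 i) _ h1'
    · exact H.1 V hV hK hx h2
    · exact H.2 V hV hK hx h2
  | andRA α β γ =>
    rw [List.forall_mem_cons, List.forall_mem_singleton] at H
    have h2' : sInf {evalIn Set.univ box dia V β Fin.elim0,
        evalIn Set.univ box dia V γ Fin.elim0} ≤ V.cnom m := by
      rw [sInf_pair]
      exact h2
    obtain ⟨_, rfl | rfl, hx⟩ := L.meetPrime (hV.2 m) _ h2'
    · exact H.1 V hV hK h1 hx
    · exact H.2 V hV hK h1 hx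
  | elimBot p α β hα hβ =>
    rw [List.forall_mem_singleton] at H
    rw [← V.setVar_self p] at h1 h2
    refine H V hV hK ?_ ?_
    · rw [evalIn_substVar]
      exact le_trans h1 (evalIn_setVar_anti hP bot_le hα _)
    · rw [evalIn_substVar]
      exact le_trans (evalIn_setVar_mono hP bot_le hβ _) h2
  | elimTop p α β hα hβ =>
    rw [List.forall_mem_singleton] at H
    rw [← V.setVar_self p] at h1 h2
    refine H V hV hK ?_ ?_
    · rw [evalIn_substVar]
      exact le_trans h1 (evalIn_setVar_mono hP le_top hα _)
    · rw [evalIn_substVar]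
      exact le_trans (evalIn_setVar_anti hP le_top hβ _) h2

end QStd

/-! ### The topological Ackermann lemma -/

section Star

variable {A : Type u} [BiheytingAlgebra A] {C : Type v} [CompleteLattice C]
  {e : BoundedLatticeHom A C} {bx di : A → A} {box dia : C → C}

/-- By density `j` is the join of the closed elements below it, hence one of them. -/
theorem CanExt.isClosedElt_of_irreducible (he : CanExt e) {j : C}
    (hj : IsCompletelyJoinIrreducible j) : IsClosedElt e j := by
  have : j ∈ {k | IsClosedElt e k ∧ k ≤ j} := hj _ (le_antisymm
    (he.closed_dense _ _ fun k hk hkj => le_sSup ⟨hk, hkj⟩) (sSup_le fun k hk => hk.2))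
  exact this.1

theorem CanExt.isOpenElt_of_irreducible (he : CanExt e) {m : C}
    (hm : IsCompletelyMeetIrreducible m) : IsOpenElt e m :=
  he.dual.isClosedElt_of_irreducible hm

theorem map_extend (e : BoundedLatticeHom A C) {n : ℕ} (a : A) (env : Fin n → A) :
    extend (e a) (fun i => e (env i)) = fun i => e (extend a env i) := by
  funext i
  exact Fin.cases rfl (fun _ => rfl) i

/-- Syntactically closed (open) terms have closed (open) values and preserve limits in the
propositional variable `p`; `r = true` (`r = false`) if the value of `p` is a closed (an open)
limit. -/
theorem evalIn_lim (he : CanExt e) (hbox : IsBoxExt e bx box)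
    (hdia : IsBoxExt (A := Aᵒᵈ) (C := Cᵒᵈ) e.dual di dia) (L : PerfectLaws box dia)
    {D : Type w} [Preorder D] [IsDirectedOrder D] [Nonempty D] {V : Assignment C}
    (hV : V.Respects) {p : ℕ} (hvar : ∀ q, q ≠ p → V.var q ∈ Set.range e) {x : C} {y : D → C}
    {r : Bool} (hp : if r then ClosedLim e x y else OpenLim e x y) {n : ℕ} (t : Term Bool n)
    (env : Fin n → A) :
    (t.Syn false → t.VarSign p r →
      ClosedLim e (evalIn (Set.range e) box dia (V.setVar p x) t (fun i => e (env i)))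
        (fun d => evalIn (Set.range e) box dia (V.setVar p (y d)) t (fun i => e (env i)))) ∧
    (t.Syn true → t.VarSign p (!r) →
      OpenLim e (evalIn (Set.range e) box dia (V.setVar p x) t (fun i => e (env i)))
        (fun d => evalIn (Set.range e) box dia (V.setVar p (y d)) t (fun i => e (env i)))) := by
  have hcl : ∀ a, ClosedLim e (e a) (fun _ : D => e a) := fun a =>
    ClosedLim.const he (isClosedElt_map e a)
  have hop : ∀ a, OpenLim e (e a) (fun _ : D => e a) := fun a =>
    OpenLim.const he (isOpenElt_map e a)
  have hI := L.le_imp_iff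
  have hS := L.sub_le_iff
  induction t with
  | bot =>
    simp only [evalIn]
    rw [← map_bot e]
    exact ⟨fun _ _ => hcl _, fun _ _ => hop _⟩
  | top =>
    simp only [evalIn]
    rw [← map_top e]
    exact ⟨fun _ _ => hcl _, fun _ _ => hop _⟩
  | var q =>
    by_cases hq : q = p
    · subst hq
      simp only [evalIn, Assignment.setVar, Function.update_self]
      refine ⟨fun _ h => ?_, fun _ h => ?_⟩
      · have hr : r = true := h rfl
        simpa [hr] using hp
      · have hr : r = false := by simpa using h rfl
        simpa [hr] using hp
    · simp only [evalIn, Assignment.setVar, Function.update_of_ne hq]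
      obtain ⟨a, ha⟩ := hvar q hq
      rw [← ha]
      exact ⟨fun _ _ => hcl a, fun _ _ => hop a⟩
  | fvar i => exact ⟨fun _ _ => hcl _, fun _ _ => hop _⟩
  | nom j =>
    refine ⟨fun _ _ => ClosedLim.const he (he.isClosedElt_of_irreducible (hV.1 j)), fun h => ?_⟩
    exact absurd h (by simp [Term.Syn])
  | cnom m =>
    refine ⟨fun h => absurd h (by simp [Term.Syn]), fun _ _ => ?_⟩
    exact OpenLim.const he (he.isOpenElt_of_irreducible (hV.2 m))
  | and s t ihs iht =>
    exact ⟨fun h h' => ((ihs env).1 h.1 h'.1).inf he ((iht env).1 h.2 h'.2),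
      fun h h' => ((ihs env).2 h.1 h'.1).inf ((iht env).2 h.2 h'.2)⟩
  | or s t ihs iht =>
    exact ⟨fun h h' => ((ihs env).1 h.1 h'.1).sup ((iht env).1 h.2 h'.2),
      fun h h' => ((ihs env).2 h.1 h'.1).sup he ((iht env).2 h.2 h'.2)⟩
  | imp s t ihs iht =>
    exact ⟨fun h h' => ClosedLim.imp he hI ((ihs env).2 h.1 h'.1) ((iht env).1 h.2 h'.2),
      fun h h' => OpenLim.imp he hI ((ihs env).1 h.1 (Bool.not_not r ▸ h'.1))
        ((iht env).2 h.2 h'.2)⟩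
  | sub s t ihs iht =>
    exact ⟨fun h h' => ClosedLim.sub he hS ((ihs env).1 h.1 h'.1) ((iht env).2 h.2 h'.2),
      fun h h' => OpenLim.sub he hS ((ihs env).2 h.1 h'.1)
        ((iht env).1 h.2 (Bool.not_not r ▸ h'.2))⟩
  | dia t ih =>
    exact ⟨fun h h' => ((ih env).1 h h').dia he hdia, fun h h' => ((ih env).2 h h').dia he hdia⟩
  | box t ih =>
    exact ⟨fun h h' => ((ih env).1 h h').box he hbox, fun h h' => ((ih env).2 h h').box he hbox⟩
  | bdia t ih =>
    exact ⟨fun h h' => ((ih env).1 h.2 h').bdia he hbox, fun h => absurd h.1 (by simp)⟩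
  | bbox t ih =>
    exact ⟨fun h => absurd h.1 (by simp), fun h h' => ((ih env).2 h.2 h').bbox he hdia⟩
  | mu b t ih =>
    refine ⟨fun h h' => ?_, fun h => absurd h.1 (by simp)⟩
    -- The restricted binder evaluates its body only at elements of `A`, so the induction hypothesis
    -- for environments in `A` suffices.
    exact ClosedLim.mu he
      (X := fun c => evalIn (Set.range e) box dia (V.setVar p x) t (extend c fun i => e (env i)))
      (F := fun d c =>
        evalIn (Set.range e) box dia (V.setVar p (y d)) t (extend c fun i => e (env i)))
      fun a => by simpa only [map_extend] using (ih (extend a env)).1 h.2 h'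
  | nu b t ih =>
    refine ⟨fun h => absurd h.1 (by simp), fun h h' => ?_⟩
    exact OpenLim.nu he
      (X := fun c => evalIn (Set.range e) box dia (V.setVar p x) t (extend c fun i => e (env i)))
      (F := fun d c =>
        evalIn (Set.range e) box dia (V.setVar p (y d)) t (extend c fun i => e (env i)))
      fun a => by simpa only [map_extend] using (ih (extend a env)).2 h.2 h'

theorem exists_forall_of_directed {D : Type w} [Preorder D] [IsDirectedOrder D] [Nonempty D]
    {ι : Type*} {P : ι → D → Prop} (hmono : ∀ i d d', d ≤ d' → P i d → P i d') (l : List ι)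
    (h : ∀ i ∈ l, ∃ d, P i d) : ∃ d, ∀ i ∈ l, P i d := by
  induction l with
  | nil => exact ⟨Classical.arbitrary D, by simp⟩
  | cons i l ih =>
    obtain ⟨d₁, h₁⟩ := h i (by simp)
    obtain ⟨d₂, h₂⟩ := ih fun j hj => h j (by simp [hj])
    obtain ⟨d, hd₁, hd₂⟩ := exists_ge_ge d₁ d₂
    refine ⟨d, fun j hj => ?_⟩
    rcases List.mem_cons.1 hj with rfl | hj
    · exact hmono _ _ _ hd₁ h₁
    · exact hmono _ _ _ hd₂ (h₂ j hj)

variable (he : CanExt e) (hbox : IsBoxExt e bx box)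
  (hdia : IsBoxExt (A := Aᵒᵈ) (C := Cᵒᵈ) e.dual di dia) (L : PerfectLaws box dia)
include he hbox hdia L

/-- If finitely many inequalities between closed and open terms hold in the limit, then they hold
at some member of the family. -/
theorem exists_holds_of_lim {D : Type w} [Preorder D] [IsDirectedOrder D] [Nonempty D]
    {V : Assignment C} (hV : V.Respects) {p : ℕ} (hvar : ∀ q, q ≠ p → V.var q ∈ Set.range e)
    {x : C} {y : D → C} {r : Bool} (hp : if r then ClosedLim e x y else OpenLim e x y)
    (Bs : List (Ineq Bool))
    (hB : ∀ I ∈ Bs, I.lhs.VarSign p r ∧ I.lhs.SynClosed ∧ I.rhs.VarSign p (!r) ∧ I.rhs.SynOpen)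
    (h : ∀ I ∈ Bs, Holds (Set.range e) box dia (V.setVar p x) I) :
    ∃ d, ∀ I ∈ Bs, Holds (Set.range e) box dia (V.setVar p (y d)) I := by
  have henv : (fun i => e (Fin.elim0 i)) = (Fin.elim0 : Fin 0 → C) := funext fun i => i.elim0
  have hlim : ∀ I ∈ Bs,
      ClosedLim e (evalIn (Set.range e) box dia (V.setVar p x) I.lhs Fin.elim0)
        (fun d => evalIn (Set.range e) box dia (V.setVar p (y d)) I.lhs Fin.elim0) ∧
      OpenLim e (evalIn (Set.range e) box dia (V.setVar p x) I.rhs Fin.elim0)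
        (fun d => evalIn (Set.range e) box dia (V.setVar p (y d)) I.rhs Fin.elim0) := by
    intro I hI
    have h1 := (evalIn_lim he hbox hdia L hV hvar hp I.lhs Fin.elim0).1 (hB I hI).2.1 (hB I hI).1
    have h2 := (evalIn_lim he hbox hdia L hV hvar hp I.rhs Fin.elim0).2 (hB I hI).2.2.2
      (hB I hI).2.2.1
    rw [henv] at h1 h2
    exact ⟨h1, h2⟩
  have hex := exists_forall_of_directed (P := fun I d => I ∈ Bs →
    Holds (Set.range e) box dia (V.setVar p (y d)) I) ?_ Bs ?_
  · obtain ⟨d, hd⟩ := hex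
    exact ⟨d, fun I hI => hd I hI hI⟩
  · intro I d d' hd H hI
    exact ((hlim I hI).1.anti _ _ hd).trans ((H hI).trans ((hlim I hI).2.mono _ _ hd))
  · intro I hI
    obtain ⟨h1, h2⟩ := hlim I hI
    -- An element of `A` fits between the closed limit on the left and the open limit on the right;
    -- each family passes it at some stage.
    obtain ⟨a, ha, ha'⟩ := he.interpolate (h1.isClosedElt he) (h2.isOpenElt he) (h I hI)
    obtain ⟨d₁, hd₁⟩ := h1.exists_le_map ha
    obtain ⟨d₂, hd₂⟩ := h2.exists_map_le ha'
    obtain ⟨d, h₁, h₂⟩ := exists_ge_ge d₁ d₂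
    exact ⟨d, fun _ => ((h1.anti _ _ h₁).trans hd₁).trans (hd₂.trans (h2.mono _ _ h₂))⟩

/-- Values of syntactically closed and open terms. -/
theorem isClosedElt_evalIn {V : Assignment C} (hV : V.Respects)
    (hvar : ∀ q, V.var q ∈ Set.range e) {t : Term Bool 0} {p : ℕ} (hp : t.VarFree p) :
    (t.SynClosed → IsClosedElt e (evalIn (Set.range e) box dia V t Fin.elim0)) ∧
      (t.SynOpen → IsOpenElt e (evalIn (Set.range e) box dia V t Fin.elim0)) := by
  have henv : (fun i => e (Fin.elim0 i)) = (Fin.elim0 : Fin 0 → C) := funext fun i => i.elim0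
  obtain ⟨a, ha⟩ := hvar p
  -- A constant family has the value itself as limit. The variable `p` is a dummy: as it does not
  -- occur, both sign conditions hold.
  have hlim := evalIn_lim he hbox hdia L (D := Unit) hV (p := p) (fun q _ => hvar q) (x := V.var p)
    (y := fun _ => V.var p) (r := true)
    (by simpa [← ha] using ClosedLim.const he (isClosedElt_map e a)) t Fin.elim0
  rw [henv, V.setVar_self] at hlim
  exact ⟨fun h => (hlim.1 h (hp.varSign _)).isClosedElt he,
    fun h => (hlim.2 h (hp.varSign _)).isOpenElt he⟩

/-- The topological Ackermann lemma. The join of the `αs` has a closed value `k` that need not lie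
in `A`. The inequalities in `Bs` hold when `p` has value `k`, and `k` is the limit of the elements
of `A` above it, so they already hold for one such element, which is an admissible value of `p`
still above every `α`. The left rule is dual, with an open value approached from below. -/
theorem QRule.validIn_range {Q : QIneq} {Qs : List QIneq} (h : QRule.{v} Q Qs)
    (H : ValidIn (Set.range e) box dia Q) : ∀ Q' ∈ Qs, ValidIn (Set.range e) box dia Q' := by
  have hP := L.perfect
  intro Q' hQ' V hV hK hants
  cases h with
  | single l₁ l₂ I i m D hr =>
    obtain ⟨Is, hIs, rfl⟩ := List.mem_map.1 hQ'
    refine H V hV hK fun J hJ => ?_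
    rcases List.mem_append.1 hJ with hJ | hJ
    · exact hants J (by simp [hJ])
    · rcases List.mem_cons.1 hJ with rfl | hJ
      · exact hr.holds L hIs fun J hJ => hants J (by simp [hJ])
      · exact hants J (by simp [hJ])
  | rightAckermann p αs Bs rest ants i m hperm hα hB hrest =>
    rw [List.mem_singleton] at hQ'
    subst hQ'
    set k := evalIn (Set.range e) box dia V (bigOr αs) Fin.elim0 with hk
    have hkc : IsClosedElt e k :=
      (isClosedElt_evalIn he hbox hdia L hV hK (varFree_bigOr fun α h => (hα α h).1)).1
        (syn_bigOr fun α h => (hα α h).2)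
    -- The order is reversed so that moving up in `D` means descending towards `k`; directedness is
    -- closure under finite meets.
    let D := {a : A // k ≤ e a}ᵒᵈ
    have : IsDirectedOrder D := ⟨fun a b => ⟨⟨a.1 ⊓ b.1, by
      rw [map_inf]; exact le_inf a.2 b.2⟩, inf_le_left (a := a.1), inf_le_right (b := b.1)⟩⟩
    have : Nonempty D := ⟨⟨⊤, by simp⟩⟩
    obtain ⟨d, hd⟩ := exists_holds_of_lim he hbox hdia L (D := D) hV (p := p) (fun q _ => hK q)
      (x := k) (y := fun a => e a.1) (r := true)
      (by
        rw [if_pos rfl]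
        refine ⟨fun a => a.2, fun a b hab => he.mono hab, fun o ho hko => ?_⟩
        obtain ⟨a, ha, ha'⟩ := he.interpolate hkc ho hko
        exact ⟨⟨a, ha⟩, a, le_rfl, ha'⟩) Bs hB
      (fun I hI => by
        have := hants (Ineq.substVar p (bigOr αs) I)
          (List.mem_append_left _ (List.mem_map_of_mem hI))
        rwa [Holds, Ineq.substVar, evalIn_substVar, evalIn_substVar] at this)
    refine H (V.setVar p (e d.1)) (hV.setVar p _) (Assignment.setVar_mem hK p ⟨_, rfl⟩)
      fun J hJ => ?_
    have hJ' := hperm.mem_iff.1 hJ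
    rcases List.mem_append.1 hJ' with hJ' | hJ'
    · rcases List.mem_append.1 hJ' with hJ' | hJ'
      · obtain ⟨α, hαm, rfl⟩ := List.mem_map.1 hJ'
        unfold Holds
        rw [evalIn_setVar_of_varFree hP (hα α hαm).1]
        refine ((le_bigOr V hαm).trans d.2).trans_eq ?_
        simp [evalIn, Assignment.setVar]
      · exact hd J hJ'
    · unfold Holds
      rw [evalIn_setVar_of_varFree hP (hrest J hJ').1, evalIn_setVar_of_varFree hP (hrest J hJ').2]
      exact hants J (by simp [hJ'])
  | leftAckermann p αs Bs rest ants i m hperm hα hB hrest =>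
    rw [List.mem_singleton] at hQ'
    subst hQ'
    set o := evalIn (Set.range e) box dia V (bigAnd αs) Fin.elim0 with ho
    have hoc : IsOpenElt e o :=
      (isClosedElt_evalIn he hbox hdia L hV hK (varFree_bigAnd fun α h => (hα α h).1)).2
        (syn_bigAnd fun α h => (hα α h).2)
    let D := {a : A // e a ≤ o}
    have : IsDirectedOrder D := ⟨fun a b => ⟨⟨a.1 ⊔ b.1, by
      rw [map_sup]; exact sup_le a.2 b.2⟩, le_sup_left (a := a.1), le_sup_right (b := b.1)⟩⟩
    have : Nonempty D := ⟨⟨⊥, by simp⟩⟩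
    obtain ⟨d, hd⟩ := exists_holds_of_lim he hbox hdia L (D := D) hV (p := p) (fun q _ => hK q)
      (x := o) (y := fun a => e a.1) (r := false)
      (by
        rw [if_neg (by simp)]
        refine ⟨fun a => a.2, fun a b hab => he.mono hab, fun k hk hko => ?_⟩
        obtain ⟨a, ha, ha'⟩ := he.interpolate hk hoc hko
        exact ⟨⟨a, ha'⟩, a, le_rfl, ha⟩) Bs hB
      (fun I hI => by
        have := hants (Ineq.substVar p (bigAnd αs) I)
          (List.mem_append_left _ (List.mem_map_of_mem hI))
        rwa [Holds, Ineq.substVar, evalIn_substVar, evalIn_substVar] at this)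
    refine H (V.setVar p (e d.1)) (hV.setVar p _) (Assignment.setVar_mem hK p ⟨_, rfl⟩)
      fun J hJ => ?_
    have hJ' := hperm.mem_iff.1 hJ
    rcases List.mem_append.1 hJ' with hJ' | hJ'
    · rcases List.mem_append.1 hJ' with hJ' | hJ'
      · obtain ⟨α, hαm, rfl⟩ := List.mem_map.1 hJ'
        unfold Holds
        rw [evalIn_setVar_of_varFree hP (hα α hαm).1]
        refine le_of_eq_of_le ?_ (le_trans d.2 (bigAnd_le V hαm))
        simp [evalIn, Assignment.setVar]
      · exact hd J hJ'
    · unfold Holds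
      rw [evalIn_setVar_of_varFree hP (hrest J hJ').1, evalIn_setVar_of_varFree hP (hrest J hJ').2]
      exact hants J (by simp [hJ'])

end Star

/-! ### The canonical extension of a modal bi-Heyting algebra -/

section Canonical

variable {A : Type u} [ModalBiheytingAlgebra A] {C : Type v} [CompleteLattice C]
  {e : BoundedLatticeHom A C} (he : IsCanonicalExtension e)
include he

theorem IsCanonicalExtension.canExt : CanExt e where
  le_iff a b := by
    refine ⟨fun h => ?_, fun h => OrderHomClass.mono e h⟩
    rw [← inf_eq_left]
    apply he.injective
    rw [map_inf]
    exact inf_eq_left.2 h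
  closed_dense c d h := by
    obtain ⟨F, rfl⟩ := he.join_of_meets c
    apply sSup_le
    rintro _ ⟨S, hS, rfl⟩
    exact h _ ⟨S, rfl⟩ (le_sSup ⟨S, hS, rfl⟩)
  open_dense c d h := by
    obtain ⟨F, rfl⟩ := he.meet_of_joins d
    apply le_sInf
    rintro _ ⟨S, hS, rfl⟩
    exact h _ ⟨S, rfl⟩ (sInf_le ⟨S, hS, rfl⟩)
  compact := he.compact

theorem IsCanonicalExtension.isBoxExt :
    IsBoxExt e ModalBiheytingAlgebra.box (piExt e ModalBiheytingAlgebra.box) :=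
  he.canExt.isBoxExt_piMap ModalBiheytingAlgebra.box_top ModalBiheytingAlgebra.box_inf

/-- The σ-extension is the π-extension for the dual order; the two formulas differ only in the order
of the two interval bounds. -/
theorem IsCanonicalExtension.isBoxExt_dual {f : A → A} {F : C → C} (hF : F = sigmaExt e f)
    (hbot : f ⊥ = ⊥) (hsup : ∀ a b, f (a ⊔ b) = f a ⊔ f b) :
    IsBoxExt (A := Aᵒᵈ) (C := Cᵒᵈ) e.dual f F := by
  have heq : piMap (A := Aᵒᵈ) (C := Cᵒᵈ) e.dual f = F := by
    subst hF
    have hset : ∀ k w : C, ({a : A | e a ≤ w ∧ k ≤ e a} : Set A) = {a | k ≤ e a ∧ e a ≤ w} :=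
      fun k w => Set.ext fun a => and_comm
    have hval (c : C) : sSup {x : C | ∃ w, IsOpenElt e w ∧ ∃ k, IsClosedElt e k ∧ c ≤ w ∧ k ≤ c ∧
        x = sInf ((fun a => e (f a)) '' {a : A | e a ≤ w ∧ k ≤ e a})} = sigmaExt e f c := by
      refine congrArg sSup (Set.ext fun x => ⟨?_, ?_⟩)
      · rintro ⟨w, hw, k, hk, h1, h2, rfl⟩
        exact ⟨k, hk, w, hw, h2, h1, by rw [hset]⟩
      · rintro ⟨k, hk, w, hw, h2, h1, rfl⟩
        exact ⟨w, hw, k, hk, h1, h2, by rw [hset]⟩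
    exact funext hval
  rw [← heq]
  exact he.canExt.dual.isBoxExt_piMap hbot hsup

theorem IsCanonicalExtension.isDiaExt {f : A → A} {F : C → C}
    (hf : f = ModalBiheytingAlgebra.dia) (hF : F = sigmaExt e f) :
    IsBoxExt (A := Aᵒᵈ) (C := Cᵒᵈ) e.dual f F :=
  he.isBoxExt_dual hF (hf ▸ ModalBiheytingAlgebra.dia_bot) (hf ▸ ModalBiheytingAlgebra.dia_sup)

theorem IsCanonicalExtension.perfectLaws :
    PerfectLaws (piExt e ModalBiheytingAlgebra.box) (sigmaExt e ModalBiheytingAlgebra.dia) := by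
  have h1 : JoinPrimeDense C := he.canExt.joinPrime_dense
  have h2 : JoinPrimeDense Cᵒᵈ := he.canExt.dual.joinPrime_dense
  exact ⟨⟨fun _ _ f => h1.iInf_iSup f, h1.eq_sSup, h2.eq_sSup, he.isBoxExt.map_sInf he.canExt,
    (he.isDiaExt rfl rfl).map_sInf he.canExt.dual⟩, h1, h2⟩

end Canonical

/-! ### Transfinite iteration -/

section Iterate

variable {A : Type u} [PartialOrder A] [OrderBot A] {f : A → A} {g : Ordinal.{u} → A}

theorem iterate_le (hf : Monotone f) (h0 : g 0 = ⊥) (hs : ∀ α, g (Order.succ α) = f (g α))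
    (hl : ∀ l, Order.IsSuccLimit l → IsLUB (g '' Set.Iio l) (g l)) {a : A} (ha : f a ≤ a)
    (α : Ordinal.{u}) : g α ≤ a := by
  induction α using Ordinal.limitRecOn with
  | zero => exact h0 ▸ bot_le
  | add_one α ih =>
    rw [← Order.succ_eq_add_one, hs]
    exact (hf ih).trans ha
  | limit l hlim ih =>
    refine (hl l hlim).2 ?_
    rintro _ ⟨α, hα, rfl⟩
    exact ih α hα

/-- Monotonicity and `g α ≤ f (g α)` are proved in one induction, since the successor step of the
first uses the second and the limit step of the second uses monotonicity up to the limit. -/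
theorem iterate_mono (hf : Monotone f) (h0 : g 0 = ⊥) (hs : ∀ α, g (Order.succ α) = f (g α))
    (hl : ∀ l, Order.IsSuccLimit l → IsLUB (g '' Set.Iio l) (g l)) : Monotone g := by
  have key : ∀ α, g α ≤ f (g α) ∧ ∀ β ≤ α, g β ≤ g α := by
    intro α
    induction α using Ordinal.limitRecOn with
    | zero =>
      refine ⟨h0 ▸ bot_le, fun β hβ => ?_⟩
      have : β = 0 := le_antisymm hβ bot_le
      exact this ▸ le_rfl
    | add_one α ih =>
      rw [← Order.succ_eq_add_one]
      refine ⟨(hs α).symm ▸ hf ih.1, fun β hβ => ?_⟩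
      rcases hβ.eq_or_lt with rfl | hβ
      · exact le_rfl
      · exact (ih.2 β (Order.lt_succ_iff.1 hβ)).trans (hs α ▸ ih.1)
    | limit l hlim ih =>
      have hle : ∀ β ≤ l, g β ≤ g l := by
        intro β hβ
        rcases hβ.eq_or_lt with rfl | hβ
        · exact le_rfl
        · exact (hl l hlim).1 ⟨β, hβ, rfl⟩
      refine ⟨(hl l hlim).2 ?_, hle⟩
      rintro _ ⟨β, hβ, rfl⟩
      exact (ih β hβ).1.trans (hf (hle β (le_of_lt hβ)))
  exact fun β α h => (key α).2 β h

/-- The join of the transfinite iterates is the least pre-fixed point. -/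
theorem isLeast_of_iterate (hf : Monotone f) (h0 : g 0 = ⊥)
    (hs : ∀ α, g (Order.succ α) = f (g α))
    (hl : ∀ l, Order.IsSuccLimit l → IsLUB (g '' Set.Iio l) (g l)) {b : A}
    (hb : IsLUB (Set.range g) b) : IsLeast {a | f a ≤ a} b := by
  have hmono := iterate_mono hf h0 hs hl
  have hfix : ∃ α, f (g α) = g α := by
    by_contra! hne
    -- Without a repetition the iterates would embed all ordinals of the universe into the type `A`,
    -- which is too small for that.
    refine not_injective_of_ordinal g (StrictMono.injective fun α β h => ?_)
    refine lt_of_lt_of_le (lt_of_le_of_ne (hmono (Order.le_succ α)) ?_) (hmono (Order.succ_le_of_lt h))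
    rw [hs]
    exact (hne α).symm
  obtain ⟨α, hα⟩ := hfix
  have hbα : b = g α := le_antisymm
    (hb.2 (by rintro _ ⟨β, rfl⟩; exact iterate_le hf h0 hs hl hα.le β)) (hb.1 ⟨α, rfl⟩)
  refine ⟨?_, fun a ha => hbα ▸ iterate_le hf h0 hs hl ha α⟩
  rw [hbα]
  exact hα.le

end Iterate

/-! ### Values in the algebra compared with values in the canonical extension. -/

section Val

variable {A : Type u} [ModalBiheytingAlgebra A]

theorem IsMu₂.isLeast {f : A → A} (hf : Monotone f) {b : A} (h : IsMu₂ f b) :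
    IsLeast {a | f a ≤ a} b := by
  obtain ⟨g, h0, hs, hl, hb⟩ := h
  exact isLeast_of_iterate hf h0 hs hl hb

theorem IsNu₂.isGreatest {f : A → A} (hf : Monotone f) {b : A} (h : IsNu₂ f b) :
    IsGreatest {a | a ≤ f a} b := by
  obtain ⟨g, h0, hs, hl, hb⟩ := h
  have key := @isLeast_of_iterate Aᵒᵈ (OrderDual.instPartialOrder A) inferInstance f g
    (fun _ _ h => hf h) h0 hs hl b hb
  exact key

variable {C : Type v} [CompleteLattice C] {e : BoundedLatticeHom A C}

/-- A value with respect to the transfinite iterates is a value with respect to the ordinary fixed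
points, and agrees with the value in the canonical extension computed from fixed points in `A`. -/
theorem IsCanonicalExtension.val (he : IsCanonicalExtension e) {v : ℕ → A} {V : Assignment C}
    (hV : ∀ p, V.var p = e (v p)) {n : ℕ} {t : Term Unit n} (ht : IsMuTerm t) {env : Fin n → A}
    {b : A} (h : Val IsMu₂ IsNu₂ v t env b) :
    Val IsMu IsNu v t env b ∧ e b = evalIn (Set.range e) (piExt e ModalBiheytingAlgebra.box)
      (sigmaExt e ModalBiheytingAlgebra.dia) V t (fun i => e (env i)) := by
  have hC := he.canExt
  have hL := he.perfectLaws
  -- A term function on `A` inherits monotonicity from its image in the extension, where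
  -- `evalIn_mono` applies.
  have hmono : ∀ {n : ℕ} {t : Term Unit (n + 1)} {env : Fin n → A} {f : A → A},
      t.FVarSign 0 true → (∀ a, e (f a) = evalIn (Set.range e) (piExt e ModalBiheytingAlgebra.box)
      (sigmaExt e ModalBiheytingAlgebra.dia) V t (fun i => e (extend a env i))) → Monotone f := by
    intro n t env f hsign hf a a' haa
    rw [← hC.le_iff, hf, hf]
    refine evalIn_mono hL.perfect.box_mono hL.perfect.dia_mono ⟨fun _ _ => le_rfl,
      fun _ _ => le_rfl, fun i => ?_, fun i => ?_, fun _ _ => rfl, fun _ _ => rfl⟩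
    · exact Fin.cases (fun _ => hC.mono haa) (fun _ _ => le_rfl) i
    · exact Fin.cases (fun h => absurd hsign h) (fun _ _ => le_rfl) i
  induction t generalizing b with
  | bot => exact ⟨h, by rw [show b = ⊥ from h]; exact map_bot e⟩
  | top => exact ⟨h, by rw [show b = ⊤ from h]; exact map_top e⟩
  | var p => exact ⟨h, by rw [show b = v p from h]; exact (hV p).symm⟩
  | fvar i => exact ⟨h, by rw [show b = env i from h]; rfl⟩
  | nom j => exact h.elim
  | cnom m => exact h.elim
  | bdia t => exact h.elim
  | bbox t => exact h.elim
  | and s t ihs iht =>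
    obtain ⟨x, y, hx, hy, rfl⟩ := h
    obtain ⟨hx1, hx2⟩ := ihs ⟨ht.1.1, ht.2.1⟩ hx
    obtain ⟨hy1, hy2⟩ := iht ⟨ht.1.2, ht.2.2⟩ hy
    exact ⟨⟨x, y, hx1, hy1, rfl⟩, by rw [map_inf, hx2, hy2]; rfl⟩
  | or s t ihs iht =>
    obtain ⟨x, y, hx, hy, rfl⟩ := h
    obtain ⟨hx1, hx2⟩ := ihs ⟨ht.1.1, ht.2.1⟩ hx
    obtain ⟨hy1, hy2⟩ := iht ⟨ht.1.2, ht.2.2⟩ hy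
    exact ⟨⟨x, y, hx1, hy1, rfl⟩, by rw [map_sup, hx2, hy2]; rfl⟩
  | imp s t ihs iht =>
    obtain ⟨x, y, hx, hy, rfl⟩ := h
    obtain ⟨hx1, hx2⟩ := ihs ⟨ht.1.1, ht.2.1⟩ hx
    obtain ⟨hy1, hy2⟩ := iht ⟨ht.1.2, ht.2.2⟩ hy
    exact ⟨⟨x, y, hx1, hy1, rfl⟩, by rw [hC.map_himp hL.le_imp_iff, hx2, hy2]; rfl⟩
  | sub s t ihs iht =>
    obtain ⟨x, y, hx, hy, rfl⟩ := h
    obtain ⟨hx1, hx2⟩ := ihs ⟨ht.1.1, ht.2.1⟩ hx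
    obtain ⟨hy1, hy2⟩ := iht ⟨ht.1.2, ht.2.2⟩ hy
    exact ⟨⟨x, y, hx1, hy1, rfl⟩, by rw [hC.map_sdiff hL.sub_le_iff, hx2, hy2]; rfl⟩
  | dia t ih =>
    obtain ⟨x, hx, rfl⟩ := h
    obtain ⟨hx1, hx2⟩ := ih ht hx
    refine ⟨⟨x, hx1, rfl⟩, ((he.isDiaExt rfl rfl).map_apply hC.dual x).symm.trans ?_⟩
    exact congrArg (sigmaExt e ModalBiheytingAlgebra.dia) hx2
  | box t ih =>
    obtain ⟨x, hx, rfl⟩ := h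
    obtain ⟨hx1, hx2⟩ := ih ht hx
    refine ⟨⟨x, hx1, rfl⟩, (he.isBoxExt.map_apply hC x).symm.trans ?_⟩
    exact congrArg (piExt e ModalBiheytingAlgebra.box) hx2
  | mu c t ih =>
    obtain ⟨f, hf, hb⟩ := h
    have hf' := fun a => ih ⟨ht.1, ht.2.2⟩ (hf a)
    -- Having a minimum is essential: `e` carries a minimum to the minimum of the image, but need
    -- not preserve an infinite meet of `A`.
    have hleast := hb.isLeast (hmono ht.2.1 fun a => (hf' a).2)
    refine ⟨⟨f, fun a => (hf' a).1, hleast.isGLB⟩, le_antisymm (le_sInf ?_) (sInf_le ?_)⟩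
    · rintro _ ⟨⟨a, rfl⟩, ha⟩
      rw [map_extend, ← (hf' a).2] at ha
      exact hC.mono (hleast.2 ((hC.le_iff _ _).1 ha))
    · refine ⟨⟨b, rfl⟩, ?_⟩
      rw [map_extend, ← (hf' b).2]
      exact hC.mono hleast.1
  | nu c t ih =>
    obtain ⟨f, hf, hb⟩ := h
    have hf' := fun a => ih ⟨ht.1, ht.2.2⟩ (hf a)
    have hgr := hb.isGreatest (hmono ht.2.1 fun a => (hf' a).2)
    refine ⟨⟨f, fun a => (hf' a).1, hgr.isLUB⟩, le_antisymm (le_sSup ?_) (sSup_le ?_)⟩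
    · refine ⟨⟨b, rfl⟩, ?_⟩
      rw [map_extend, ← (hf' b).2]
      exact hC.mono hgr.1
    · rintro _ ⟨⟨a, rfl⟩, ha⟩
      rw [map_extend, ← (hf' a).2] at ha
      exact hC.mono (hgr.2 ((hC.le_iff _ _).1 ha))

end Val

/-! ### Canonicity -/

theorem Term.Basic.nomFree {β : Type} {n : ℕ} {t : Term β n} (h : t.Basic) (j : ℕ) :
    t.NomFree j ∧ t.CnomFree j := by
  induction t <;> simp_all [Term.Basic, Term.NomFree, Term.CnomFree]

section Main

variable {A : Type u} [ModalBiheytingAlgebra A] {C : Type v} [CompleteLattice C]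
  {e : BoundedLatticeHom A C} (he : IsCanonicalExtension e)
include he

theorem IsCanonicalExtension.preStep_validIn {l l' : List (Ineq Unit)}
    (h : Relation.ReflTransGen PreStep l l') {i m : ℕ}
    (H : ∀ I ∈ l, ValidIn (Set.range e) (piExt e ModalBiheytingAlgebra.box)
      (sigmaExt e ModalBiheytingAlgebra.dia) (firstApprox i m I)) :
    ∀ I ∈ l', ValidIn (Set.range e) (piExt e ModalBiheytingAlgebra.box)
      (sigmaExt e ModalBiheytingAlgebra.dia) (firstApprox i m I) := by
  induction h with
  | refl => exact H
  | tail _ hstep ih =>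
    cases hstep with
    | mk l₁ l₂ hr =>
      intro J hJ
      rcases List.mem_append.1 hJ with hJ | hJ
      · rcases List.mem_append.1 hJ with hJ | hJ
        · exact ih J (by simp [hJ])
        · exact hr.validIn he.perfectLaws (K := Set.range e) ⟨⊥, map_bot e⟩ ⟨⊤, map_top e⟩
            (ih _ (by simp)) J hJ
      · exact ih J (by simp [hJ])

theorem IsCanonicalExtension.preStep_validIn_univ {l l' : List (Ineq Unit)}
    (h : Relation.ReflTransGen PreStep l l') {i m : ℕ}
    (H : ∀ I ∈ l', ValidIn Set.univ (piExt e ModalBiheytingAlgebra.box)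
      (sigmaExt e ModalBiheytingAlgebra.dia) (firstApprox i m I)) :
    ∀ I ∈ l, ValidIn Set.univ (piExt e ModalBiheytingAlgebra.box)
      (sigmaExt e ModalBiheytingAlgebra.dia) (firstApprox i m I) := by
  induction h using Relation.ReflTransGen.head_induction_on with
  | refl => exact H
  | head hstep _ ih =>
    cases hstep with
    | mk l₁ l₂ hr =>
      intro J hJ
      rcases List.mem_append.1 hJ with hJ | hJ
      · exact ih J (by simp [hJ])
      · rcases List.mem_cons.1 hJ with rfl | hJ
        · exact hr.validIn_univ he.perfectLaws fun J hJ => ih J (by simp [hJ])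
        · exact ih J (by simp [hJ])

/-- Along a run, the passage from fixed points and assignments in `A` to arbitrary ones is
propagated backwards. -/
theorem IsCanonicalExtension.step_validIn {l l' : List QIneq}
    (h : Relation.ReflTransGen Step.{v} l l')
    (H : ∀ Q ∈ l', GoodQ Q → ValidIn (Set.range e) (piExt e ModalBiheytingAlgebra.box)
      (sigmaExt e ModalBiheytingAlgebra.dia) Q → ValidIn Set.univ
      (piExt e ModalBiheytingAlgebra.box) (sigmaExt e ModalBiheytingAlgebra.dia) Q) :
    ∀ Q ∈ l, GoodQ Q → ValidIn (Set.range e) (piExt e ModalBiheytingAlgebra.box)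
      (sigmaExt e ModalBiheytingAlgebra.dia) Q → ValidIn Set.univ
      (piExt e ModalBiheytingAlgebra.box) (sigmaExt e ModalBiheytingAlgebra.dia) Q := by
  induction h using Relation.ReflTransGen.head_induction_on with
  | refl => exact H
  | head hstep _ ih =>
    cases hstep with
    | mk l₁ l₂ hr =>
      intro Q hQ hg hv
      rcases List.mem_append.1 hQ with hQ | hQ
      · exact ih Q (by simp [hQ]) hg hv
      · rcases List.mem_cons.1 hQ with rfl | hQ
        · refine hr.validIn_univ he.perfectLaws hg fun Q' hQ' hg' => ih Q' (by simp [hQ']) hg' ?_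
          exact hr.validIn_range he.canExt he.isBoxExt (he.isDiaExt rfl rfl) he.perfectLaws hv Q' hQ'
        · exact ih Q (by simp [hQ]) hg hv

theorem IsCanonicalExtension.validIn_of_models (hA : SecondKind A) {φ ψ : Term Unit 0}
    (hφ : IsMuTerm φ) (hψ : IsMuTerm ψ) (hval : Models A φ ψ) (i m : ℕ) :
    ValidIn (Set.range e) (piExt e ModalBiheytingAlgebra.box)
      (sigmaExt e ModalBiheytingAlgebra.dia) (firstApprox i m ⟨φ, ψ⟩) := by
  rw [validIn_firstApprox_iff]
  intro V hV hK h1 h2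
  choose v hv using hK
  obtain ⟨a, ha⟩ := hA 0 φ hφ v Fin.elim0
  obtain ⟨b, hb⟩ := hA 0 ψ hψ v Fin.elim0
  obtain ⟨ha1, ha2⟩ := he.val (fun p => (hv p).symm) hφ ha
  obtain ⟨hb1, hb2⟩ := he.val (fun p => (hv p).symm) hψ hb
  have henv : (fun i => e (Fin.elim0 i)) = (Fin.elim0 : Fin 0 → C) := funext fun i => i.elim0
  rw [henv] at ha2 hb2
  refine h1.trans (le_trans ?_ h2)
  rw [← ha2, ← hb2]
  exact he.canExt.mono (hval v a b ha1 hb1)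

/-- First approximation is reversed by density: it suffices that each prime below the left side lies
below each meet-irreducible above the right side. The two sides contain no nominals or co-nominals,
so all of these may be sent to the given pair. -/
theorem IsCanonicalExtension.models_of_validIn {φ ψ : Term Unit 0} (hφ : φ.Basic) (hψ : ψ.Basic)
    {i m : ℕ} (h : ValidIn Set.univ (piExt e ModalBiheytingAlgebra.box)
      (sigmaExt e ModalBiheytingAlgebra.dia) (firstApprox i m ⟨φ, ψ⟩)) :
    CanonicalModels e φ ψ := by
  have hL := he.perfectLaws
  rw [validIn_firstApprox_iff] at h
  intro V
  rw [← evalIn_univ, ← evalIn_univ]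
  refine hL.joinDense _ _ fun j hj hjφ => ?_
  rw [hL.perfect.meet_dense (evalIn _ _ _ V ψ _)]
  refine le_sInf fun n hn => ?_
  have heq : ∀ t : Term Unit 0, t.Basic → evalIn Set.univ (piExt e ModalBiheytingAlgebra.box)
      (sigmaExt e ModalBiheytingAlgebra.dia) ⟨V.var, fun _ => j, fun _ => n⟩ t Fin.elim0 =
      evalIn Set.univ (piExt e ModalBiheytingAlgebra.box)
      (sigmaExt e ModalBiheytingAlgebra.dia) V t Fin.elim0 := fun t ht =>
    evalIn_congr hL.perfect.box_mono hL.perfect.dia_mono (fun _ _ => rfl) (fun _ _ => rfl)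
      (fun k hk => absurd (ht.nomFree k).1 hk) (fun k hk => absurd (ht.nomFree k).2 hk)
  refine h ⟨V.var, fun _ => j, fun _ => n⟩ ⟨fun _ => hj.irreducible, fun _ => hn.1⟩
    (fun _ => Set.mem_univ _) ?_ ?_
  · rw [heq φ hφ]
    exact hjφ
  · rw [heq ψ hψ]
    exact hn.2

end Main

end MuCanon

theorem mainTheorem3 {A : Type u} [MuCanon.ModalBiheytingAlgebra A] (hA : MuCanon.SecondKind A)
    {C : Type v} [CompleteLattice C] (e : BoundedLatticeHom A C)
    (he : MuCanon.IsCanonicalExtension e)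
    (φ ψ : MuCanon.Term Unit 0) (hφ : MuCanon.IsMuTerm φ) (hψ : MuCanon.IsMuTerm ψ)
    (hrun : MuCanon.ProperRunSucceeds.{v} φ ψ) (hval : MuCanon.Models A φ ψ) :
    MuCanon.CanonicalModels e φ ψ := by
  obtain ⟨Qs, ⟨Is, i, m, hpre, hsteps⟩, hpure, hhandled⟩ := hrun
  have hstar := he.preStep_validIn hpre (i := i) (m := m)
    (by
      rw [List.forall_mem_singleton]
      exact he.validIn_of_models hA hφ hψ hval i m)
  have hstd := he.step_validIn hsteps fun Q hQ hg hv =>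
    MuCanon.validIn_univ_of_pure he.perfectLaws (Set.range_nonempty e) hg (hpure Q hQ) (hhandled Q hQ) hv
  refine he.models_of_validIn hφ.1 hψ.1 (i := i) (m := m)
    (he.preStep_validIn_univ hpre (fun I hI => ?_) _ List.mem_cons_self)
  refine hstd _ (List.mem_map.2 ⟨I, hI, rfl⟩) ?_ (hstar I hI)
  intro J hJ
  simp only [MuCanon.firstApprox, List.mem_cons, List.not_mem_nil, or_false] at hJ
  rcases hJ with rfl | rfl
  · exact ⟨True.intro, MuCanon.good_star _ _⟩
  · exact ⟨MuCanon.good_star _ _, True.intro⟩
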